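/- Let $d\ge 1$ and $m\ge 1$ be integers and $R>0$, and let $\mathbb T^d=(\mathbb R/2\pi\mathbb Z)^d$. Let $\mathcal W$ be the set of potentials $$V(x)=\sum_{n\in\mathbb Z^d}v_n e^{in\cdot x},\qquad v_n=R(1+|n|)^{-m}\sigma_n,\qquad \sigma_n\in[-\tfrac12,\tfrac12]\quad(n\in\mathbb Z^d),$$ each identified with the family $(v_n)$ of its real Fourier coefficients, and equip $\mathcal W$ with the probability measure $\mathbb P$ under which the $\sigma_n$, $n\in\mathbb Z^d$, are independent and uniformly distributed on $[-\frac12,\frac12]$. The convolution $V*u$ is the function whose $n$-th Fourier coefficient is $v_n\hat u(n)$, and $\|u\|_{H^s}^2=\sum_{n\in\mathbb Z^d}(1+|n|^2)^s|\hat u(n)|^2$. There is a measurable set $\mathcal V\subset\mathcal W$ with $\mathbb P(\mathcal V)=1$ such that for every $V\in\mathcal V$ and every $B>0$ there is $s_0>d/2$, and for every real $s\ge s_0$ there is $\varepsilon_0>0$, with the following property. Let $0<\varepsilon\le\varepsilon_0$, put $T=\varepsilon^{-B}$, and let $u_0\in H^s(\mathbb T^d)$ with $\|u_0\|_{H^s}\le\varepsilon^2$.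 Then the Cauchy problem $$iu_t=-\Delta u+V*u+|u|^2u,\qquad u(0)=u_0,$$ has exactly one solution $u\in C((-T,T);H^s(\mathbb T^d))$ on the time interval $(-T,T)$ (the equation being understood in the sense of distributions in $x$, that is, for each Fourier coefficient, as an ordinary differential equation in $t$), and $$\sup_{|t|<T}\|u(t)\|_{H^s}<2\varepsilon^2 .$$ -/

import Mathlib

open MeasureTheory Filter Topology
open scoped ENNReal

namespace NLSTorus

noncomputable section

/-- The torus `𝕋^d = (ℝ/2πℤ)^d`, written in the coordinate `θ = x/(2π)`. In this coordinate the
character `e^{i n·x}` is `UnitAddTorus.mFourier n`, and the Fourier coefficient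
`(2π)^{-d} ∫ f(x) e^{-i n·x} dx` is `UnitAddTorus.mFourierCoeff f n`. -/
abbrev Torus (d : ℕ) : Type := UnitAddTorus (Fin d)

/-- Squared Euclidean length `|n|²` of a frequency `n ∈ ℤ^d`. -/
def normSq {d : ℕ} (n : Fin d → ℤ) : ℝ := ∑ j, (n j : ℝ) ^ 2

/-- The law of one coefficient `σ_n`: the uniform distribution on `[-1/2, 1/2]`. -/
def uniformLaw : Measure ℝ := volume.restrict (Set.Icc (-(1 / 2) : ℝ) (1 / 2))

instance : IsProbabilityMeasure uniformLaw :=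
  ⟨by simp [uniformLaw, Real.volume_Icc]; norm_num⟩

/-- The Fourier coefficients `v_n = R (1 + |n|)^{-m} σ_n` of the potential with parameters `σ`. -/
def potentialOf (d : ℕ) (R : ℝ) (m : ℕ) (σ : (Fin d → ℤ) → ℝ) : (Fin d → ℤ) → ℝ :=
  fun n => R * ((1 + Real.sqrt (normSq n)) ^ m)⁻¹ * σ n

/-- The space `𝒲` of potentials `V = ∑ v_n e^{i n·x}`, a potential being given by its (real)
Fourier coefficients: `R⁻¹ v_n (1 + |n|)^m ∈ [-1/2, 1/2]` for every `n`. -/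
def potentialSpace (d : ℕ) (R : ℝ) (m : ℕ) : Set ((Fin d → ℤ) → ℝ) :=
  {v | ∀ n, R⁻¹ * v n * (1 + Real.sqrt (normSq n)) ^ m ∈ Set.Icc (-(1 / 2) : ℝ) (1 / 2)}

/-- The law of the random potential: the image of the product of the uniform laws, that is, the
`σ_n` (`n ∈ ℤ^d`) are independent and uniformly distributed on `[-1/2, 1/2]`. -/
def potentialLaw (d : ℕ) (R : ℝ) (m : ℕ) : Measure ((Fin d → ℤ) → ℝ) :=
  (Measure.infinitePi fun _ : Fin d → ℤ => uniformLaw).map (potentialOf d R m)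

/-- The Sobolev norm `‖f‖_{H^s} = (∑ (1 + |n|²)^s |f̂(n)|²)^{1/2}`, with value `∞` exactly when
`f ∉ H^s`. -/
def sobolevNorm {d : ℕ} (s : ℝ) (f : C(Torus d, ℂ)) : ℝ≥0∞ :=
  (∑' n : Fin d → ℤ, ENNReal.ofReal ((1 + normSq n) ^ s) *
    ‖UnitAddTorus.mFourierCoeff f n‖ₑ ^ 2) ^ (1 / 2 : ℝ)

/-- `u ∈ C(J; H^s)` solves `i u_t = -Δu + V * u + |u|²u` on the open time interval `J`.
The space `H^s` is used for `s > d/2` only, where its elements are continuous functions. The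
equation holds in the sense of distributions on the torus, that is, after pairing with each
character: `-Δ` multiplies the `n`-th Fourier coefficient by `|n|²`, and convolution with
`V = ∑ v_n e^{i n·x}` multiplies it by `v_n`. -/
structure IsSolutionOn {d : ℕ} (v : (Fin d → ℤ) → ℝ) (s : ℝ) (J : Set ℝ)
    (u : ℝ → C(Torus d, ℂ)) : Prop where
  mem_sobolev : ∀ t ∈ J, sobolevNorm s (u t) < ∞
  continuous_sobolev : ∀ t₀ ∈ J,
    Tendsto (fun t => sobolevNorm s (u t - u t₀)) (𝓝[J] t₀) (𝓝 0)
  equation : ∀ t ∈ J, ∀ n : Fin d → ℤ, ∃ w : ℂ,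
    HasDerivAt (fun τ => UnitAddTorus.mFourierCoeff (u τ) n) w t ∧
    Complex.I * w =
      (normSq n : ℂ) * UnitAddTorus.mFourierCoeff (u t) n
        + (v n : ℂ) * UnitAddTorus.mFourierCoeff (u t) n
        + UnitAddTorus.mFourierCoeff (fun x => ((‖u t x‖ ^ 2 : ℝ) : ℂ) * u t x) n

end

end NLSTorus

namespace NLSTorus

noncomputable section

/-! ### Frequencies -/

/-- The Japanese bracket `⟨n⟩ = (1 + |n|²)^{1/2}`. -/
def jap {d : ℕ} (n : Fin d → ℤ) : ℝ := Real.sqrt (1 + normSq n)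

lemma normSq_nonneg {d : ℕ} (n : Fin d → ℤ) : 0 ≤ normSq n :=
  Finset.sum_nonneg fun _ _ => sq_nonneg _

lemma one_le_jap {d : ℕ} (n : Fin d → ℤ) : 1 ≤ jap n :=
  Real.one_le_sqrt.2 (by linarith [normSq_nonneg n])

lemma jap_pos {d : ℕ} (n : Fin d → ℤ) : 0 < jap n := zero_lt_one.trans_le (one_le_jap n)

lemma jap_sq {d : ℕ} (n : Fin d → ℤ) : jap n ^ 2 = 1 + normSq n :=
  Real.sq_sqrt (by linarith [normSq_nonneg n])

@[simp] lemma jap_neg {d : ℕ} (n : Fin d → ℤ) : jap (-n) = jap n := by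
  simp [jap, normSq]

lemma jap_add_le {d : ℕ} (a b : Fin d → ℤ) : jap (a + b) ≤ jap a + jap b := by
  refine abs_le_of_sq_le_sq' ?_ (add_nonneg (jap_pos a).le (jap_pos b).le) |>.2
  have hcs : (∑ j, (a j : ℝ) * b j) ^ 2 ≤ normSq a * normSq b :=
    Finset.sum_mul_sq_le_sq_mul_sq _ _ _
  have hab : (∑ j, (a j : ℝ) * b j) ≤ jap a * jap b := by
    refine abs_le_of_sq_le_sq' ?_ (mul_nonneg (jap_pos a).le (jap_pos b).le) |>.2
    rw [mul_pow, jap_sq, jap_sq]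
    nlinarith [normSq_nonneg a, normSq_nonneg b]
  have hadd : normSq (a + b) = normSq a + 2 * (∑ j, (a j : ℝ) * b j) + normSq b := by
    simp only [normSq, Finset.mul_sum, ← Finset.sum_add_distrib]
    refine Finset.sum_congr rfl fun j _ => ?_
    simp only [Pi.add_apply]; push_cast; ring
  rw [jap_sq, hadd, add_sq, jap_sq, jap_sq]
  linarith

lemma jap_rpow_two_mul {d : ℕ} (n : Fin d → ℤ) (s : ℝ) :
    jap n ^ (2 * s) = (1 + normSq n) ^ s := by
  rw [Real.rpow_mul (jap_pos n).le, ← jap_sq, Real.rpow_two]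

lemma jap_le_one_add_sqrt {d : ℕ} (n : Fin d → ℤ) : jap n ≤ 1 + Real.sqrt (normSq n) := by
  refine Real.sqrt_le_iff.2 ⟨by positivity, ?_⟩
  have := Real.sq_sqrt (normSq_nonneg n)
  nlinarith [Real.sqrt_nonneg (normSq n)]

lemma one_add_sqrt_le {d : ℕ} (n : Fin d → ℤ) : 1 + Real.sqrt (normSq n) ≤ 2 * jap n := by
  have h : Real.sqrt (normSq n) ≤ jap n := Real.sqrt_le_sqrt (by linarith)
  linarith [one_le_jap n]

/-- A product of summable nonnegative weights is summable over tuples. -/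
lemma summable_prod_tuple {ι α : Type*} [Fintype ι] {w : ι → α → ℝ}
    (h0 : ∀ i a, 0 ≤ w i a) (hw : ∀ i, Summable (w i)) :
    Summable fun t : ι → α => ∏ i, w i (t i) := by
  classical
  refine summable_of_sum_le (c := ∏ i, ∑' a, w i a) (fun t => Finset.prod_nonneg fun i _ => h0 _ _)
    fun u => ?_
  calc ∑ t ∈ u, ∏ i, w i (t i)
      ≤ ∑ t ∈ Fintype.piFinset fun i => u.image fun t => t i, ∏ i, w i (t i) := by
        refine Finset.sum_le_sum_of_subset_of_nonneg (fun t ht => ?_)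
          fun t _ _ => Finset.prod_nonneg fun i _ => h0 _ _
        exact Fintype.mem_piFinset.2 fun i => Finset.mem_image_of_mem _ ht
    _ = ∏ i, ∑ a ∈ u.image fun t => t i, w i a := (Finset.prod_univ_sum _ _).symm
    _ ≤ ∏ i, ∑' a, w i a :=
        Finset.prod_le_prod (fun i _ => Finset.sum_nonneg fun a _ => h0 _ _)
          fun i _ => (hw i).sum_le_tsum _ fun a _ => h0 _ _

lemma summable_int_inv_one_add_sq : Summable fun q : ℤ => (1 + (q : ℝ) ^ 2)⁻¹ := by
  have h : Summable fun q : ℤ => 1 / (q : ℝ) ^ 2 := Real.summable_one_div_int_pow.2 one_lt_two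
  refine Summable.of_norm_bounded_eventually h ?_
  filter_upwards [(Set.finite_singleton (0 : ℤ)).compl_mem_cofinite] with q hq
  have hq' : (0 : ℝ) < (q : ℝ) ^ 2 := by
    have : (q : ℝ) ≠ 0 := by exact_mod_cast hq
    positivity
  rw [Real.norm_of_nonneg (by positivity), one_div]
  exact inv_anti₀ hq' (by linarith)

lemma summable_jap_inv_pow (d : ℕ) : Summable fun n : Fin d → ℤ => (jap n ^ (2 * d))⁻¹ := by
  have h := summable_prod_tuple (ι := Fin d) (w := fun _ (q : ℤ) => (1 + (q : ℝ) ^ 2)⁻¹)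
    (fun _ _ => by positivity) (fun _ => summable_int_inv_one_add_sq)
  refine Summable.of_nonneg_of_le (fun n => by have := jap_pos n; positivity) (fun n => ?_) h
  rw [Finset.prod_inv_distrib]
  refine inv_anti₀ (Finset.prod_pos fun j _ => by positivity) ?_
  calc ∏ j, (1 + (n j : ℝ) ^ 2) ≤ ∏ _j : Fin d, jap n ^ 2 := by
        refine Finset.prod_le_prod (fun j _ => by positivity) fun j _ => ?_
        rw [jap_sq]
        have := Finset.single_le_sum (f := fun j => (n j : ℝ) ^ 2) (fun i _ => sq_nonneg _)
          (Finset.mem_univ j)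
        simpa [normSq] using this
    _ = jap n ^ (2 * d) := by rw [Finset.prod_const, Finset.card_univ, Fintype.card_fin, pow_mul]

lemma summable_jap_rpow {d : ℕ} {s : ℝ} (hs : 2 * (d : ℝ) ≤ s) :
    Summable fun n : Fin d → ℤ => jap n ^ (-s) := by
  refine Summable.of_nonneg_of_le (fun n => by have := jap_pos n; positivity) (fun n => ?_)
    (summable_jap_inv_pow d)
  rw [Real.rpow_neg (jap_pos n).le]
  refine inv_anti₀ (by have := jap_pos n; positivity) ?_
  rw [← Real.rpow_natCast]
  exact Real.rpow_le_rpow_of_exponent_le (one_le_jap n) (by push_cast; exact hs)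

/-! ### The Poisson algebra of polynomials in `u` and `ū` -/

section Poisson

open MvPolynomial
open Finset.HasAntidiagonal (antidiagonal)

/-- Polynomials in the variables `u_x` (`Sum.inl x`) and `ū_x` (`Sum.inr x`). -/
abbrev Poly (ι : Type*) := MvPolynomial (ι ⊕ ι) ℂ

variable {ι : Type*} [Fintype ι]

/-- The Poisson bracket `∑ₓ ∂P/∂uₓ ∂Q/∂ūₓ - ∂P/∂ūₓ ∂Q/∂uₓ`. -/
def pb (P Q : Poly ι) : Poly ι :=
  ∑ x, (pderiv (Sum.inl x) P * pderiv (Sum.inr x) Q - pderiv (Sum.inr x) P * pderiv (Sum.inl x) Q)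

lemma pb_skew (P Q : Poly ι) : pb P Q = -pb Q P := by
  simp only [pb, ← Finset.sum_neg_distrib]
  exact Finset.sum_congr rfl fun x _ => by ring

lemma pb_add_right (P Q Q' : Poly ι) : pb P (Q + Q') = pb P Q + pb P Q' := by
  simp only [pb, ← Finset.sum_add_distrib, map_add]
  exact Finset.sum_congr rfl fun x _ => by ring

lemma pb_add_left (P P' Q : Poly ι) : pb (P + P') Q = pb P Q + pb P' Q := by
  rw [pb_skew, pb_add_right, neg_add, ← pb_skew, ← pb_skew]

lemma pb_smul_right (c : ℂ) (P Q : Poly ι) : pb P (c • Q) = c • pb P Q := by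
  simp only [pb, Finset.smul_sum, Derivation.map_smul]
  exact Finset.sum_congr rfl fun x _ => by simp only [mul_smul_comm, smul_sub]

lemma pb_smul_left (c : ℂ) (P Q : Poly ι) : pb (c • P) Q = c • pb P Q := by
  rw [pb_skew, pb_smul_right, ← smul_neg, ← pb_skew]

/-- The Hamiltonian derivation `{P, ·}`. -/
def pbD (P : Poly ι) : Derivation ℂ (Poly ι) (Poly ι) where
  toFun := pb P
  map_add' := pb_add_right P
  map_smul' c Q := pb_smul_right c P Q
  map_one_eq_zero' := by simp [pb]
  leibniz' a b := by
    change pb P (a * b) = a * pb P b + b * pb P a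
    simp only [pb, Finset.mul_sum, ← Finset.sum_add_distrib, pderiv_mul]
    exact Finset.sum_congr rfl fun x _ => by ring

@[simp] lemma pbD_apply (P Q : Poly ι) : pbD P Q = pb P Q := rfl

@[simp] lemma pb_zero_right (P : Poly ι) : pb P 0 = 0 := map_zero (pbD P)

@[simp] lemma pb_zero_left (P : Poly ι) : pb 0 P = 0 := by rw [pb_skew]; simp

lemma pb_sum_right {α : Type*} (s : Finset α) (P : Poly ι) (f : α → Poly ι) :
    pb P (∑ i ∈ s, f i) = ∑ i ∈ s, pb P (f i) := map_sum (pbD P) f s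

lemma pb_sum_left {α : Type*} (s : Finset α) (P : Poly ι) (f : α → Poly ι) :
    pb (∑ i ∈ s, f i) P = ∑ i ∈ s, pb (f i) P := by
  rw [pb_skew, pb_sum_right, ← Finset.sum_neg_distrib]
  exact Finset.sum_congr rfl fun i _ => (pb_skew _ _).symm

lemma pb_X_inl (P : Poly ι) (x : ι) : pb P (X (Sum.inl x)) = -pderiv (Sum.inr x) P := by
  classical
  simp only [pb, pderiv_X]
  rw [Finset.sum_eq_single x]
  · simp
  · intro y _ hy
    simp [hy.symm]
  · simp

lemma pb_X_inr (P : Poly ι) (x : ι) : pb P (X (Sum.inr x)) = pderiv (Sum.inl x) P := by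
  classical
  simp only [pb, pderiv_X]
  rw [Finset.sum_eq_single x]
  · simp
  · intro y _ hy
    simp [hy.symm]
  · simp

omit [Fintype ι] in
lemma pderiv_comm (v w : ι ⊕ ι) (P : Poly ι) :
    pderiv v (pderiv w P) = pderiv w (pderiv v P) := by
  classical
  have h : ⁅(pderiv v : Derivation ℂ (Poly ι) (Poly ι)),
      (pderiv w : Derivation ℂ (Poly ι) (Poly ι))⁆ = 0 := by
    refine derivation_ext fun i => ?_
    simp only [Derivation.commutator_apply, pderiv_X, Derivation.coe_zero, Pi.zero_apply,
      Pi.single_apply]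
    split_ifs <;> simp
  have := DFunLike.congr_fun h P
  simpa [Derivation.commutator_apply, sub_eq_zero] using this

lemma pderiv_pb (v : ι ⊕ ι) (P Q : Poly ι) :
    pderiv v (pb P Q) = pb (pderiv v P) Q + pb P (pderiv v Q) := by
  simp only [pb, map_sum, map_sub, pderiv_mul, ← Finset.sum_add_distrib]
  refine Finset.sum_congr rfl fun x _ => ?_
  rw [pderiv_comm v (Sum.inl x) P, pderiv_comm v (Sum.inl x) Q, pderiv_comm v (Sum.inr x) P,
    pderiv_comm v (Sum.inr x) Q]
  ring

lemma pb_leibniz (P Q S : Poly ι) : pb P (pb Q S) = pb (pb P Q) S + pb Q (pb P S) := by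
  have h : ⁅pbD P, pbD Q⁆ = pbD (pb P Q) := by
    refine derivation_ext fun i => ?_
    rcases i with x | x
    · simp only [Derivation.commutator_apply, pbD_apply, pb_X_inl, pderiv_pb]
      rw [← pbD_apply P, ← pbD_apply Q, map_neg, map_neg, pbD_apply, pbD_apply,
        pb_skew (pderiv _ P) Q]
      ring
    · simp only [Derivation.commutator_apply, pbD_apply, pb_X_inr, pderiv_pb]
      rw [pb_skew (pderiv _ P) Q]
      ring
  have := DFunLike.congr_fun h S
  simp only [Derivation.commutator_apply, pbD_apply] at this
  rw [← this]; ring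

/-- The quadratic form `∑ₓ wₓ uₓ ūₓ`. -/
def diagForm (w : ι → ℂ) : Poly ι :=
  ∑ x, C (w x) * (X (Sum.inl x) * X (Sum.inr x))

lemma pb_monomial_diagForm (w : ι → ℂ) (m : ι ⊕ ι →₀ ℕ) (a : ℂ) :
    pb (monomial m a) (diagForm w) =
      (∑ x, ((m (Sum.inl x) : ℂ) - m (Sum.inr x)) * w x) • monomial m a := by
  rw [diagForm, pb_sum_right, Finset.sum_smul]
  refine Finset.sum_congr rfl fun x _ => ?_
  rw [← pbD_apply, (pbD _).leibniz, (pbD _).leibniz, pbD_apply, pbD_apply, pb_X_inl, pb_X_inr]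
  have hC : pbD (monomial m a) (C (w x)) = 0 := derivation_C _ _
  rw [hC]
  have h1 := X_mul_pderiv_monomial (R := ℂ) (i := Sum.inl x) (m := m) (r := a)
  have h2 := X_mul_pderiv_monomial (R := ℂ) (i := Sum.inr x) (m := m) (r := a)
  simp only [smul_eq_mul, mul_zero, add_zero, mul_neg, h1, h2]
  rw [nsmul_eq_mul, nsmul_eq_mul, smul_eq_C_mul]
  simp only [map_mul, map_sub, map_natCast]
  ring

lemma coeff_pb_diagForm (w : ι → ℂ) (P : Poly ι) (m : ι ⊕ ι →₀ ℕ) :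
    coeff m (pb P (diagForm w)) =
      (∑ x, ((m (Sum.inl x) : ℂ) - m (Sum.inr x)) * w x) * coeff m P := by
  classical
  induction P using MvPolynomial.induction_on' with
  | monomial k a =>
    rw [pb_monomial_diagForm, coeff_smul, coeff_monomial]
    split_ifs with h
    · rw [h, smul_eq_mul]
    · simp
  | add p q hp hq => rw [pb_add_left, coeff_add, hp, hq, coeff_add, mul_add]

/-! ### Truncated power series with coefficients in the Poisson algebra -/

/-- Formal series `∑ λⁿ Pₙ` of polynomials, multiplied by the Poisson bracket modulo `λ^(r+1)`. -/
def Ser (ι : Type*) (_r : ℕ) : Type _ := ℕ → Poly ι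

namespace Ser

variable {r : ℕ}

instance : AddCommGroup (Ser ι r) := inferInstanceAs (AddCommGroup (ℕ → Poly ι))

instance : Module ℂ (Ser ι r) := inferInstanceAs (Module ℂ (ℕ → Poly ι))

instance : Module ℚ (Ser ι r) := inferInstanceAs (Module ℚ (ℕ → Poly ι))

instance : Mul (Ser ι r) :=
  ⟨fun X Y n => if n ≤ r then ∑ p ∈ antidiagonal n, pb (X p.1) (Y p.2) else 0⟩

lemma mul_apply (X Y : Ser ι r) (n : ℕ) :
    (X * Y) n = if n ≤ r then ∑ p ∈ antidiagonal n, pb (X p.1) (Y p.2) else 0 := rfl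

omit [Fintype ι] in
lemma add_apply (X Y : Ser ι r) (n : ℕ) : (X + Y) n = X n + Y n := rfl

omit [Fintype ι] in
lemma smul_apply (c : ℂ) (X : Ser ι r) (n : ℕ) : (c • X) n = c • X n := rfl

omit [Fintype ι] in
lemma zero_apply (n : ℕ) : (0 : Ser ι r) n = 0 := rfl

instance : NonUnitalNonAssocRing (Ser ι r) where
  left_distrib X Y Z := by
    funext n
    simp only [mul_apply, add_apply, pb_add_right, Finset.sum_add_distrib]
    split_ifs <;> simp
  right_distrib X Y Z := by
    funext n
    simp only [mul_apply, add_apply, pb_add_left, Finset.sum_add_distrib]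
    split_ifs <;> simp
  zero_mul X := by
    funext n
    simp [mul_apply, zero_apply]
  mul_zero X := by
    funext n
    simp [mul_apply, zero_apply]

instance : SMulCommClass ℂ (Ser ι r) (Ser ι r) where
  smul_comm c X Y := by
    funext n
    simp only [smul_eq_mul, mul_apply, smul_apply, pb_smul_right, ← Finset.smul_sum]
    split_ifs <;> simp

instance : IsScalarTower ℂ (Ser ι r) (Ser ι r) where
  smul_assoc c X Y := by
    funext n
    simp only [smul_eq_mul, mul_apply, smul_apply, pb_smul_left, ← Finset.smul_sum]
    split_ifs <;> simp

/-- The derivation `Y ↦ {λᵏ χ, Y}`. -/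
def ad (r k : ℕ) (χ : Poly ι) : Module.End ℂ (Ser ι r) where
  toFun Y n := if k ≤ n ∧ n ≤ r then pb χ (Y (n - k)) else 0
  map_add' X Y := by
    funext n
    change (if k ≤ n ∧ n ≤ r then pb χ (X (n - k) + Y (n - k)) else 0) =
      (if k ≤ n ∧ n ≤ r then pb χ (X (n - k)) else 0) +
        (if k ≤ n ∧ n ≤ r then pb χ (Y (n - k)) else 0)
    rw [pb_add_right]
    split_ifs
    · rfl
    · exact (add_zero _).symm
  map_smul' c Y := by
    funext n
    change (if k ≤ n ∧ n ≤ r then pb χ (c • Y (n - k)) else 0) =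
      c • (if k ≤ n ∧ n ≤ r then pb χ (Y (n - k)) else 0)
    rw [pb_smul_right]
    split_ifs
    · rfl
    · exact (smul_zero _).symm

lemma ad_apply (k : ℕ) (χ : Poly ι) (Y : Ser ι r) (n : ℕ) :
    ad r k χ Y n = if k ≤ n ∧ n ≤ r then pb χ (Y (n - k)) else 0 := rfl

lemma sum_antidiagonal_shift_right {M : Type*} [AddCommMonoid M] (f : ℕ → ℕ → M) (k n : ℕ) :
    ∑ p ∈ antidiagonal n, (if k ≤ p.2 then f p.1 (p.2 - k) else 0) =
      if k ≤ n then ∑ p ∈ antidiagonal (n - k), f p.1 p.2 else 0 := by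
  split_ifs with h
  · rw [← Finset.sum_filter]
    refine Finset.sum_nbij' (fun p => (p.1, p.2 - k)) (fun p => (p.1, p.2 + k)) ?_ ?_ ?_ ?_ ?_ <;>
      simp <;> omega
  · refine Finset.sum_eq_zero fun p hp => if_neg ?_
    have := Finset.HasAntidiagonal.mem_antidiagonal.1 hp
    omega

lemma sum_antidiagonal_shift_left {M : Type*} [AddCommMonoid M] (f : ℕ → ℕ → M) (k n : ℕ) :
    ∑ p ∈ antidiagonal n, (if k ≤ p.1 then f (p.1 - k) p.2 else 0) =
      if k ≤ n then ∑ p ∈ antidiagonal (n - k), f p.1 p.2 else 0 := by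
  rw [← Finset.Nat.sum_antidiagonal_swap]
  simp only [Prod.fst_swap, Prod.snd_swap]
  rw [sum_antidiagonal_shift_right fun a b => f b a]
  congr 1
  rw [← Finset.Nat.sum_antidiagonal_swap]
  rfl

lemma ad_mul (k : ℕ) (χ : Poly ι) (X Y : Ser ι r) :
    ad r k χ (X * Y) = X * ad r k χ Y + ad r k χ X * Y := by
  funext n
  simp only [ad_apply, mul_apply, add_apply]
  by_cases hn : n ≤ r
  · have e1 : ∑ p ∈ antidiagonal n,
        pb (X p.1) (if k ≤ p.2 ∧ p.2 ≤ r then pb χ (Y (p.2 - k)) else 0) =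
        ∑ p ∈ antidiagonal n,
          if k ≤ p.2 then pb (X p.1) (pb χ (Y (p.2 - k))) else 0 := by
      refine Finset.sum_congr rfl fun p hp => ?_
      have : p.2 ≤ r := by
        have := Finset.HasAntidiagonal.mem_antidiagonal.1 hp
        omega
      split_ifs <;> simp_all
    have e2 : ∑ p ∈ antidiagonal n,
        pb (if k ≤ p.1 ∧ p.1 ≤ r then pb χ (X (p.1 - k)) else 0) (Y p.2) =
        ∑ p ∈ antidiagonal n,
          if k ≤ p.1 then pb (pb χ (X (p.1 - k))) (Y p.2) else 0 := by
      refine Finset.sum_congr rfl fun p hp => ?_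
      have : p.1 ≤ r := by
        have := Finset.HasAntidiagonal.mem_antidiagonal.1 hp
        omega
      split_ifs <;> simp_all
    rw [if_pos hn, if_pos hn, e1, e2,
      sum_antidiagonal_shift_right fun a b => pb (X a) (pb χ (Y b)),
      sum_antidiagonal_shift_left fun a b => pb (pb χ (X a)) (Y b)]
    by_cases hk : k ≤ n
    · rw [if_pos ⟨hk, hn⟩, if_pos (by omega), if_pos hk, if_pos hk, pb_sum_right,
        ← Finset.sum_add_distrib]
      exact Finset.sum_congr rfl fun p _ => by rw [pb_leibniz, add_comm]
    · simp [hk]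
  · simp [hn]

lemma ad_pow_apply_eq_zero {k : ℕ} (χ : Poly ι) (Y : Ser ι r) (j n : ℕ) (h : n < j * k) :
    (ad r k χ ^ j) Y n = 0 := by
  induction j generalizing n with
  | zero => simp at h
  | succ j ih =>
    rw [pow_succ', Module.End.mul_apply, ad_apply]
    split_ifs with hk
    · rw [ih _ (by rw [Nat.succ_mul] at h; omega), pb_zero_right]
    · rfl

lemma ad_pow_eq_zero {k : ℕ} (hk : 1 ≤ k) (χ : Poly ι) : ad r k χ ^ (r + 1) = 0 := by
  refine LinearMap.ext fun Y => funext fun n => ?_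
  by_cases hn : n ≤ r
  · exact ad_pow_apply_eq_zero χ Y _ _ (by nlinarith)
  · rw [pow_succ', Module.End.mul_apply, ad_apply, if_neg (by tauto)]
    rfl

/-- The Lie transform `exp {λᵏ χ, ·}`. -/
def lieExp (r k : ℕ) (χ : Poly ι) : Module.End ℂ (Ser ι r) := IsNilpotent.exp (ad r k χ)

lemma lieExp_apply {k : ℕ} (hk : 1 ≤ k) (χ : Poly ι) (Y : Ser ι r) (n : ℕ) :
    lieExp r k χ Y n =
      ∑ i ∈ Finset.range (r + 1), ((i.factorial : ℂ)⁻¹) • (ad r k χ ^ i) Y n := by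
  rw [lieExp, IsNilpotent.exp_eq_sum (ad_pow_eq_zero hk χ), LinearMap.sum_apply]
  have : ∀ (s : Finset ℕ) (f : ℕ → Ser ι r), (∑ i ∈ s, f i) n = ∑ i ∈ s, f i n :=
    fun s f => Finset.sum_apply n s f
  rw [this]
  refine Finset.sum_congr rfl fun i _ => ?_
  have h2 : ((i.factorial : ℚ)⁻¹ • (ad r k χ ^ i)) =
      ((i.factorial : ℂ)⁻¹ • (ad r k χ ^ i)) := by
    rw [← Rat.cast_smul_eq_qsmul ℂ]; push_cast; rfl
  rw [h2]; rfl

lemma lieExp_mul {k : ℕ} (hk : 1 ≤ k) (χ : Poly ι) (X Y : Ser ι r) :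
    lieExp r k χ (X * Y) = lieExp r k χ X * lieExp r k χ Y :=
  Module.End.exp_mul_of_derivation ℂ (Ser ι r) (ad r k χ) (ad_mul k χ)
    ⟨_, ad_pow_eq_zero hk χ⟩ X Y

lemma ad_neg (k : ℕ) (χ : Poly ι) : ad r k (-χ) = -ad r k χ := by
  refine LinearMap.ext fun Y => funext fun n => ?_
  change ad r k (-χ) Y n = -(ad r k χ Y n)
  rw [ad_apply, ad_apply, ← neg_one_smul ℂ, pb_smul_left]
  split_ifs <;> simp

lemma lieExp_neg_lieExp {k : ℕ} (hk : 1 ≤ k) (χ : Poly ι) (Y : Ser ι r) :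
    lieExp r k (-χ) (lieExp r k χ Y) = Y := by
  have h := IsNilpotent.exp_neg_mul_exp_self (A := Module.End ℂ (Ser ι r)) (a := ad r k χ)
    ⟨_, ad_pow_eq_zero hk χ⟩
  rw [lieExp, lieExp, ad_neg, ← Module.End.mul_apply, h]
  rfl

lemma lieExp_apply_of_lt {k : ℕ} (hk : 1 ≤ k) (χ : Poly ι) (Y : Ser ι r) {n : ℕ} (hn : n < k) :
    lieExp r k χ Y n = Y n := by
  rw [lieExp_apply hk, Finset.sum_eq_single 0]
  · simp
  · intro i _ hi
    rw [ad_pow_apply_eq_zero, smul_zero]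
    nlinarith [Nat.one_le_iff_ne_zero.2 hi]
  · simp

lemma lieExp_apply_self {k : ℕ} (hk : 1 ≤ k) (hkr : k ≤ r) (χ : Poly ι) (Y : Ser ι r) :
    lieExp r k χ Y k = Y k + pb χ (Y 0) := by
  rw [lieExp_apply hk, ← Finset.sum_erase_add _ _ (a := 0) (by simp),
    Finset.sum_eq_single 1]
  · simp [ad_apply, hkr, add_comm]
  · intro i hi hi'
    rw [ad_pow_apply_eq_zero, smul_zero]
    have : 2 ≤ i := by simp at hi; omega
    nlinarith
  · intro h
    simp at h
    omega

end Ser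

end Poisson

/-! ### Polynomials with zero momentum and controlled coefficients -/

section PolyClass

open MvPolynomial
open Finset.HasAntidiagonal (antidiagonal)

lemma sqrt_normSq_le_jap {d : ℕ} (n : Fin d → ℤ) : Real.sqrt (normSq n) ≤ jap n :=
  Real.sqrt_le_sqrt (by linarith)

lemma sqrt_normSq_eq_norm {d : ℕ} (n : Fin d → ℤ) :
    Real.sqrt (normSq n) = ‖WithLp.toLp 2 (fun j => (n j : ℝ))‖ := by
  rw [EuclideanSpace.norm_eq]
  simp [normSq]

lemma sqrt_normSq_add_le {d : ℕ} (a b : Fin d → ℤ) :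
    Real.sqrt (normSq (a + b)) ≤ Real.sqrt (normSq a) + Real.sqrt (normSq b) := by
  simp only [sqrt_normSq_eq_norm]
  refine le_trans (le_of_eq ?_) (norm_add_le _ _)
  congr 1
  ext j
  simp

lemma sqrt_normSq_nsmul {d : ℕ} (c : ℕ) (a : Fin d → ℤ) :
    Real.sqrt (normSq (c • a)) = c * Real.sqrt (normSq a) := by
  have : normSq (c • a) = (c : ℝ) ^ 2 * normSq a := by
    simp only [normSq, Finset.mul_sum]
    exact Finset.sum_congr rfl fun j _ => by simp; ring
  rw [this, Real.sqrt_mul (sq_nonneg _), Real.sqrt_sq (Nat.cast_nonneg c)]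

lemma jap_sum_nsmul_le {d : ℕ} {α : Type*} (s : Finset α) (c : α → ℕ) (f : α → Fin d → ℤ)
    {K : ℝ} (hf : ∀ i ∈ s, c i ≠ 0 → jap (f i) ≤ K) (hK : 1 ≤ K) :
    jap (∑ i ∈ s, c i • f i) ≤ ((∑ i ∈ s, c i : ℕ) + 1) * K := by
  have h1 : Real.sqrt (normSq (∑ i ∈ s, c i • f i)) ≤ ∑ i ∈ s, Real.sqrt (normSq (c i • f i)) :=
    Finset.le_sum_of_subadditive (fun n : Fin d → ℤ => Real.sqrt (normSq n))
      (by simp [normSq]) sqrt_normSq_add_le s _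
  have h2 : ∑ i ∈ s, Real.sqrt (normSq (c i • f i)) ≤ ∑ i ∈ s, (c i : ℝ) * K := by
    refine Finset.sum_le_sum fun i hi => ?_
    rw [sqrt_normSq_nsmul]
    by_cases hc : c i = 0
    · simp [hc]
    · exact mul_le_mul_of_nonneg_left ((sqrt_normSq_le_jap _).trans (hf i hi hc))
        (Nat.cast_nonneg _)
  have h3 := jap_le_one_add_sqrt (∑ i ∈ s, c i • f i)
  rw [← Finset.sum_mul] at h2
  push_cast
  linarith

variable {d : ℕ} {ι : Type*} [Fintype ι]

/-- The frequency of a variable. -/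
def freq (k : ι → Fin d → ℤ) : ι ⊕ ι → Fin d → ℤ := Sum.elim k k

/-- The frequency of a variable, counted negatively for `ū`. -/
def signedFreq (k : ι → Fin d → ℤ) : ι ⊕ ι → Fin d → ℤ := Sum.elim k (-k)

/-- The momentum of a monomial. -/
def momentum (k : ι → Fin d → ℤ) (m : ι ⊕ ι →₀ ℕ) : Fin d → ℤ := ∑ v, m v • signedFreq k v

/-- The number of factors of a monomial with frequency larger than `M`. -/
def highCount (k : ι → Fin d → ℤ) (M : ℝ) (m : ι ⊕ ι →₀ ℕ) : ℕ :=
  ∑ v, open Classical in if M < jap (freq k v) then m v else 0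

omit [Fintype ι] in
lemma jap_signedFreq (k : ι → Fin d → ℤ) (v : ι ⊕ ι) : jap (signedFreq k v) = jap (freq k v) := by
  rcases v with x | x <;> simp [signedFreq, freq]

lemma momentum_add (k : ι → Fin d → ℤ) (m m' : ι ⊕ ι →₀ ℕ) :
    momentum k (m + m') = momentum k m + momentum k m' := by
  simp [momentum, add_smul, Finset.sum_add_distrib]

lemma momentum_single (k : ι → Fin d → ℤ) (v : ι ⊕ ι) :
    momentum k (Finsupp.single v 1) = signedFreq k v := by
  classical
  rw [momentum, Finset.sum_eq_single v]
  · simp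
  · intro w _ hw
    simp [hw.symm]
  · simp

lemma highCount_add (k : ι → Fin d → ℤ) (M : ℝ) (m m' : ι ⊕ ι →₀ ℕ) :
    highCount k M (m + m') = highCount k M m + highCount k M m' := by
  classical
  simp only [highCount, ← Finset.sum_add_distrib]
  refine Finset.sum_congr rfl fun v _ => ?_
  split_ifs <;> simp

lemma highCount_single (k : ι → Fin d → ℤ) (M : ℝ) (v : ι ⊕ ι) :
    highCount k M (Finsupp.single v 1) = open Classical in if M < jap (freq k v) then 1 else 0 := by
  classical
  rw [highCount, Finset.sum_eq_single v]
  · simp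
  · intro w _ hw
    simp [hw.symm]
  · simp

lemma highCount_anti (k : ι → Fin d → ℤ) {M M' : ℝ} (h : M ≤ M') (m : ι ⊕ ι →₀ ℕ) :
    highCount k M' m ≤ highCount k M m := by
  classical
  refine Finset.sum_le_sum fun v _ => ?_
  split_ifs with h1 h2
  · exact le_rfl
  · exact absurd (h.trans_lt h1) h2
  · exact Nat.zero_le _
  · exact le_rfl

lemma jap_le_of_highCount_eq_zero {k : ι → Fin d → ℤ} {M : ℝ} {m : ι ⊕ ι →₀ ℕ}
    (h : highCount k M m = 0) {v : ι ⊕ ι} (hv : m v ≠ 0) : jap (freq k v) ≤ M := by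
  classical
  by_contra hM
  have := Finset.sum_eq_zero_iff.1 h v (Finset.mem_univ v)
  rw [if_pos (not_le.1 hM)] at this
  exact hv this

lemma sum_univ_sum_type (m : ι ⊕ ι →₀ ℕ) :
    ∑ v, m v = ∑ x, m (Sum.inl x) + ∑ x, m (Sum.inr x) := Fintype.sum_sum_type _

/-- If `m · v` has zero momentum, the frequency of `v` is controlled by those of `m`. -/
lemma jap_freq_le_of_momentum {k : ι → Fin d → ℤ} {m : ι ⊕ ι →₀ ℕ} {v : ι ⊕ ι}
    (h : momentum k (m + Finsupp.single v 1) = 0) {K : ℝ} (hK : 1 ≤ K)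
    (hm : ∀ w, m w ≠ 0 → jap (freq k w) ≤ K) :
    jap (freq k v) ≤ ((∑ w, m w : ℕ) + 1) * K := by
  rw [momentum_add, momentum_single] at h
  have hv : signedFreq k v = -momentum k m := (neg_eq_of_add_eq_zero_right h).symm
  rw [← jap_signedFreq, hv, jap_neg]
  exact jap_sum_nsmul_le _ _ _ (fun w _ hw => (jap_signedFreq k w).le.trans (hm w hw)) hK

/-- Homogeneous polynomials of bidegree `(p, p)` and zero momentum, whose coefficients are bounded
by `C μ₁^(2s) μ₃^ν`, where `μ₁` and `μ₃` are the largest and the third largest frequency. -/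
structure IsClass (k : ι → Fin d → ℤ) (p : ℕ) (s : ℝ) (ν : ℕ) (C : ℝ) (P : Poly ι) : Prop where
  degL : ∀ m, coeff m P ≠ 0 → ∑ x, m (Sum.inl x) = p
  degR : ∀ m, coeff m P ≠ 0 → ∑ x, m (Sum.inr x) = p
  mom : ∀ m, coeff m P ≠ 0 → momentum k m = 0
  nonneg : 0 ≤ C
  bound : ∀ m (K M : ℝ), 1 ≤ K → 1 ≤ M → (∀ v, m v ≠ 0 → jap (freq k v) ≤ K) →
    highCount k M m ≤ 2 → ‖coeff m P‖ ≤ C * K ^ (2 * s) * M ^ ν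

namespace IsClass

variable {k : ι → Fin d → ℤ} {p q : ℕ} {s : ℝ} {ν ν' : ℕ} {C C' : ℝ} {P Q : Poly ι}

lemma mono (h : IsClass k p s ν C P) (hν : ν ≤ ν') (hC : C ≤ C') : IsClass k p s ν' C' P where
  degL := h.degL
  degR := h.degR
  mom := h.mom
  nonneg := h.nonneg.trans hC
  bound m K M hK hM hm hc := by
    refine (h.bound m K M hK hM hm hc).trans ?_
    have hK0 : 0 ≤ K ^ (2 * s) := Real.rpow_nonneg (by linarith) _
    have hC' := h.nonneg
    have : M ^ ν ≤ M ^ ν' := pow_le_pow_right₀ hM hν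
    have : 0 ≤ C' := hC'.trans hC
    gcongr

lemma zero (hC : 0 ≤ C) : IsClass k p s ν C (0 : Poly ι) where
  degL m h := by simp at h
  degR m h := by simp at h
  mom m h := by simp at h
  nonneg := hC
  bound m K M hK hM _ _ := by
    rw [coeff_zero, norm_zero]
    have hK0 : 0 ≤ K ^ (2 * s) := Real.rpow_nonneg (by linarith) _
    positivity

lemma add (h : IsClass k p s ν C P) (h' : IsClass k p s ν C' Q) :
    IsClass k p s ν (C + C') (P + Q) where
  degL m hm := by
    by_cases h0 : coeff m P = 0
    · exact h'.degL m (by simpa [h0] using hm)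
    · exact h.degL m h0
  degR m hm := by
    by_cases h0 : coeff m P = 0
    · exact h'.degR m (by simpa [h0] using hm)
    · exact h.degR m h0
  mom m hm := by
    by_cases h0 : coeff m P = 0
    · exact h'.mom m (by simpa [h0] using hm)
    · exact h.mom m h0
  nonneg := add_nonneg h.nonneg h'.nonneg
  bound m K M hK hM hm hc := by
    rw [coeff_add, add_mul, add_mul]
    exact (norm_add_le _ _).trans
      (add_le_add (h.bound m K M hK hM hm hc) (h'.bound m K M hK hM hm hc))

/-- A polynomial with coefficients dominated by those of `P` lies in the same class. -/
lemma of_coeff_le (h : IsClass k p s ν C P) {c : ℝ} (hc : 0 ≤ c)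
    (hQ : ∀ m, ‖coeff m Q‖ ≤ c * ‖coeff m P‖) : IsClass k p s ν (c * C) Q := by
  have h0 : ∀ m, coeff m Q ≠ 0 → coeff m P ≠ 0 := fun m hm hP => hm <| by
    have := hQ m
    rwa [hP, norm_zero, mul_zero, norm_le_zero_iff] at this
  refine ⟨fun m hm => h.degL m (h0 m hm), fun m hm => h.degR m (h0 m hm),
    fun m hm => h.mom m (h0 m hm), mul_nonneg hc h.nonneg, fun m K M hK hM hm hcount => ?_⟩
  refine (hQ m).trans ?_
  rw [mul_assoc c, mul_assoc c]
  exact mul_le_mul_of_nonneg_left (h.bound m K M hK hM hm hcount) hc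

lemma smul (h : IsClass k p s ν C P) (c : ℂ) : IsClass k p s ν (‖c‖ * C) (c • P) :=
  h.of_coeff_le (norm_nonneg c) fun m => by rw [coeff_smul, norm_smul]

lemma neg (h : IsClass k p s ν C P) : IsClass k p s ν C (-P) := by
  simpa using h.of_coeff_le (Q := -P) zero_le_one fun m => by simp

lemma sum {α : Type*} (t : Finset α) {f : α → Poly ι} {c : α → ℝ}
    (h : ∀ i ∈ t, IsClass k p s ν (c i) (f i)) : IsClass k p s ν (∑ i ∈ t, c i) (∑ i ∈ t, f i) := by
  classical
  induction t using Finset.induction_on with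
  | empty => simpa using zero le_rfl
  | insert a t ha ih =>
    rw [Finset.sum_insert ha, Finset.sum_insert ha]
    exact (h a (Finset.mem_insert_self a t)).add (ih fun i hi => h i (Finset.mem_insert_of_mem hi))

end IsClass

lemma highCount_mul_single_le {k : ι → Fin d → ℤ} {m₁ m₂ : ι ⊕ ι →₀ ℕ} {v w : ι ⊕ ι}
    (hvw : freq k v = freq k w) (hmom : momentum k (m₂ + Finsupp.single w 1) = 0)
    {M D : ℝ} (hM : 1 ≤ M) (hD : ((∑ w, m₂ w : ℕ) : ℝ) + 1 ≤ D)
    (hc : highCount k M m₁ + highCount k M m₂ ≤ 2) :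
    highCount k (D * M) (m₁ + Finsupp.single v 1) ≤ 2 := by
  have hD1 : 1 ≤ D := le_trans (by linarith [Nat.cast_nonneg (α := ℝ) (∑ w, m₂ w)]) hD
  have hMD : M ≤ D * M := by nlinarith
  rw [highCount_add, highCount_single]
  have h1 := highCount_anti k hMD m₁
  by_cases h2 : highCount k M m₁ ≤ 1
  · split_ifs <;> omega
  · have h0 : highCount k M m₂ = 0 := by omega
    have hv := jap_freq_le_of_momentum hmom hM fun u hu => jap_le_of_highCount_eq_zero h0 hu
    rw [← hvw] at hv
    rw [if_neg (not_lt.2 (hv.trans (by nlinarith)))]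
    omega

lemma card_antidiagonal_le [DecidableEq ι] (m : ι ⊕ ι →₀ ℕ) :
    (antidiagonal m).card ≤ 2 ^ (∑ v, m v) := by
  classical
  calc (antidiagonal m).card ≤ (Finset.Iic m).card := by
        refine Finset.card_le_card_of_injOn Prod.fst (fun a ha => ?_) fun a ha b hb hab => ?_
        · have := Finset.HasAntidiagonal.mem_antidiagonal.1 (Finset.mem_coe.1 ha)
          simp only [Finset.coe_Iic, Set.mem_Iic]
          rw [← this]
          exact le_self_add
        · have h1 := Finset.HasAntidiagonal.mem_antidiagonal.1 (Finset.mem_coe.1 ha)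
          have h2 := Finset.HasAntidiagonal.mem_antidiagonal.1 (Finset.mem_coe.1 hb)
          refine Prod.ext hab ?_
          rw [← h2, hab] at h1
          exact add_left_cancel h1
    _ = ∏ v ∈ m.support, (m v + 1) := by rw [Finsupp.card_Iic]; simp
    _ ≤ ∏ v ∈ m.support, 2 ^ m v := Finset.prod_le_prod' fun v _ => Nat.lt_two_pow_self
    _ = 2 ^ (∑ v ∈ m.support, m v) := Finset.prod_pow_eq_pow_sum _ _ _
    _ = 2 ^ (∑ v, m v) := by
        congr 1
        exact Finset.sum_subset (Finset.subset_univ _) fun v _ hv => by simpa using hv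

lemma sum_le_of_subsingleton {α : Type*} [Fintype α] {f : α → ℝ} {B : ℝ} (hB : 0 ≤ B)
    (hf : ∀ x, f x ≤ B) (huniq : ∀ x y, f x ≠ 0 → f y ≠ 0 → x = y) : ∑ x, f x ≤ B := by
  by_cases h : ∃ x, f x ≠ 0
  · obtain ⟨x, hx⟩ := h
    rw [Finset.sum_eq_single x]
    · exact hf x
    · intro y _ hy
      by_contra h0
      exact hy (huniq y x h0 hx)
    · simp
  · push Not at h
    simpa [h] using hB

/-- The constant in the estimate of the Poisson bracket. -/
def pbConst (p q : ℕ) (s : ℝ) (n : ℕ) : ℝ :=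
  2 ^ (2 * (p + q + 1)) * (2 * (((p + 1 : ℕ) : ℝ) * ((q + 1 : ℕ) : ℝ) *
    (2 * (p + q + 1 : ℕ) : ℝ) ^ (2 * s) * (2 * (p + q + 1 : ℕ) : ℝ) ^ n))

lemma exists_of_coeff_pb_ne_zero {P Q : Poly ι} {m : ι ⊕ ι →₀ ℕ} (h : coeff m (pb P Q) ≠ 0) :
    ∃ m₁ m₂ x, m₁ + m₂ = m ∧
      ((coeff (m₁ + Finsupp.single (Sum.inl x) 1) P ≠ 0 ∧
        coeff (m₂ + Finsupp.single (Sum.inr x) 1) Q ≠ 0) ∨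
      (coeff (m₁ + Finsupp.single (Sum.inr x) 1) P ≠ 0 ∧
        coeff (m₂ + Finsupp.single (Sum.inl x) 1) Q ≠ 0)) := by
  classical
  rw [pb, coeff_sum] at h
  obtain ⟨x, -, hx⟩ := Finset.exists_ne_zero_of_sum_ne_zero h
  rw [coeff_sub] at hx
  have key : ∀ v w : ι ⊕ ι, coeff m (pderiv v P * pderiv w Q) ≠ 0 → ∃ m₁ m₂, m₁ + m₂ = m ∧
      coeff (m₁ + Finsupp.single v 1) P ≠ 0 ∧ coeff (m₂ + Finsupp.single w 1) Q ≠ 0 := by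
    intro v w hvw
    rw [coeff_mul] at hvw
    obtain ⟨a, ha, ha'⟩ := Finset.exists_ne_zero_of_sum_ne_zero hvw
    rw [coeff_pderiv, coeff_pderiv] at ha'
    refine ⟨a.1, a.2, Finset.HasAntidiagonal.mem_antidiagonal.1 ha, fun h0 => ha' ?_,
      fun h0 => ha' ?_⟩ <;> simp [h0]
  by_cases h1 : coeff m (pderiv (Sum.inl x) P * pderiv (Sum.inr x) Q) = 0
  · obtain ⟨m₁, m₂, h2, h3⟩ := key (Sum.inr x) (Sum.inl x) (by simpa [h1] using hx)
    exact ⟨m₁, m₂, x, h2, Or.inr h3⟩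
  · obtain ⟨m₁, m₂, h2, h3⟩ := key (Sum.inl x) (Sum.inr x) h1
    exact ⟨m₁, m₂, x, h2, Or.inl h3⟩

lemma norm_coeff_pderiv_le {k : ι → Fin d → ℤ} {p : ℕ} {s : ℝ} {ν : ℕ} {C : ℝ} {P : Poly ι}
    (h : IsClass k (p + 1) s ν C P) (v : ι ⊕ ι) (m : ι ⊕ ι →₀ ℕ) :
    ‖coeff m (pderiv v P)‖ ≤ ((p + 1 : ℕ) : ℝ) * ‖coeff (m + Finsupp.single v 1) P‖ := by
  classical
  rw [coeff_pderiv, norm_mul, mul_comm]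
  by_cases h0 : coeff (m + Finsupp.single v 1) P = 0
  · simp [h0]
  · refine mul_le_mul_of_nonneg_right ?_ (norm_nonneg _)
    have hv : m v + 1 ≤ p + 1 := by
      rcases v with x | x
      · rw [← h.degL _ h0]
        refine le_trans ?_ (Finset.single_le_sum (fun _ _ => Nat.zero_le _) (Finset.mem_univ x))
        simp
      · rw [← h.degR _ h0]
        refine le_trans ?_ (Finset.single_le_sum (fun _ _ => Nat.zero_le _) (Finset.mem_univ x))
        simp
    calc ‖((m v : ℂ) + 1)‖ = ((m v + 1 : ℕ) : ℝ) := by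
          rw [← Complex.norm_natCast (m v + 1)]; push_cast; rfl
      _ ≤ ((p + 1 : ℕ) : ℝ) := by exact_mod_cast hv

lemma IsClass.sum_eq {k : ι → Fin d → ℤ} {p : ℕ} {s : ℝ} {ν : ℕ} {C : ℝ} {P : Poly ι}
    (h : IsClass k p s ν C P) {m : ι ⊕ ι →₀ ℕ} (hm : coeff m P ≠ 0) : ∑ v, m v = 2 * p := by
  rw [sum_univ_sum_type, h.degL m hm, h.degR m hm, two_mul]

lemma sum_add_single (m : ι ⊕ ι →₀ ℕ) (v : ι ⊕ ι) :
    ∑ u, (m + Finsupp.single v 1 : ι ⊕ ι →₀ ℕ) u = ∑ u, m u + 1 := by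
  classical
  simp only [Finsupp.add_apply, Finset.sum_add_distrib]
  congr 1
  simp [Finsupp.single_apply]

lemma norm_coeff_pderiv_mul_le {k : ι → Fin d → ℤ} {p q : ℕ} {s : ℝ} {ν ν' : ℕ} {C C' : ℝ}
    {P Q : Poly ι} (hP : IsClass k (p + 1) s ν C P) (hQ : IsClass k (q + 1) 0 ν' C' Q)
    {v w : ι ⊕ ι} (hvw : freq k v = freq k w) {m₁ m₂ : ι ⊕ ι →₀ ℕ} {K M : ℝ} (hK : 1 ≤ K)
    (hM : 1 ≤ M) (hm : ∀ u, (m₁ + m₂) u ≠ 0 → jap (freq k u) ≤ K)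
    (hc : highCount k M (m₁ + m₂) ≤ 2) :
    ‖coeff m₁ (pderiv v P)‖ * ‖coeff m₂ (pderiv w Q)‖ ≤
      ((p + 1 : ℕ) : ℝ) * ((q + 1 : ℕ) : ℝ) * (2 * (p + q + 1 : ℕ) : ℝ) ^ (2 * s) *
        (2 * (p + q + 1 : ℕ) : ℝ) ^ (ν + ν') * (C * C' * K ^ (2 * s) * M ^ (ν + ν')) := by
  set D : ℝ := 2 * (p + q + 1 : ℕ) with hD
  have hD1 : 1 ≤ D := by
    have := Nat.cast_nonneg (α := ℝ) p
    have := Nat.cast_nonneg (α := ℝ) q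
    rw [hD]; push_cast; linarith
  have hC := hP.nonneg
  have hC' := hQ.nonneg
  have hR : 0 ≤ ((p + 1 : ℕ) : ℝ) * ((q + 1 : ℕ) : ℝ) * D ^ (2 * s) *
        D ^ (ν + ν') * (C * C' * K ^ (2 * s) * M ^ (ν + ν')) := by positivity
  by_cases h1 : coeff (m₁ + Finsupp.single v 1) P = 0
  · rw [coeff_pderiv, h1]; simpa using hR
  by_cases h2 : coeff (m₂ + Finsupp.single w 1) Q = 0
  · rw [coeff_pderiv (i := w), h2]; simpa using hR
  have hd1 : ∑ u, m₁ u = 2 * p + 1 := by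
    have := hP.sum_eq h1
    rw [sum_add_single] at this
    omega
  have hd2 : ∑ u, m₂ u = 2 * q + 1 := by
    have := hQ.sum_eq h2
    rw [sum_add_single] at this
    omega
  have hD2 : ((∑ u, m₁ u : ℕ) : ℝ) + 1 ≤ D := by
    rw [hd1, hD]; push_cast; linarith [Nat.cast_nonneg (α := ℝ) q]
  have hD3 : ((∑ u, m₂ u : ℕ) : ℝ) + 1 ≤ D := by
    rw [hd2, hD]; push_cast; linarith [Nat.cast_nonneg (α := ℝ) p]
  have hm1 : ∀ u, m₁ u ≠ 0 → jap (freq k u) ≤ K := fun u hu => hm u (by simp [hu])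
  rw [highCount_add] at hc
  have hDK : 1 ≤ D * K := by nlinarith
  have hDM : 1 ≤ D * M := by nlinarith
  have hv : jap (freq k v) ≤ D * K :=
    (jap_freq_le_of_momentum (hP.mom _ h1) hK hm1).trans
      (mul_le_mul_of_nonneg_right hD2 (by linarith))
  have b1 := hP.bound _ (D * K) (D * M) hDK hDM (fun u hu => by
    classical
    by_cases huv : u = v
    · rw [huv]; exact hv
    · have : m₁ u ≠ 0 := by
        simpa [Finsupp.single_apply, Ne.symm huv] using hu
      exact (hm1 u this).trans (by nlinarith))
    (highCount_mul_single_le hvw (hQ.mom _ h2) hM hD3 hc)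
  have b2 := hQ.bound (m₂ + Finsupp.single w 1)
    (∑ u, jap (freq k u) + 1) (D * M)
    (by linarith [Finset.sum_nonneg fun u (_ : u ∈ Finset.univ) => (jap_pos (freq k u)).le]) hDM
    (fun u _ => by
      have := Finset.single_le_sum (f := fun u => jap (freq k u))
        (fun u _ => (jap_pos (freq k u)).le) (Finset.mem_univ u)
      linarith)
    (highCount_mul_single_le hvw.symm (hP.mom _ h1) hM hD2 (by omega))
  rw [mul_zero, Real.rpow_zero, mul_one] at b2
  rw [Real.mul_rpow (by linarith) (by linarith)] at b1
  calc ‖coeff m₁ (pderiv v P)‖ * ‖coeff m₂ (pderiv w Q)‖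
      ≤ (((p + 1 : ℕ) : ℝ) * (C * (D ^ (2 * s) * K ^ (2 * s)) * (D * M) ^ ν)) *
        (((q + 1 : ℕ) : ℝ) * (C' * (D * M) ^ ν')) := by
        refine mul_le_mul ((norm_coeff_pderiv_le hP v m₁).trans ?_)
          ((norm_coeff_pderiv_le hQ w m₂).trans ?_) (norm_nonneg _) (by positivity)
        · exact mul_le_mul_of_nonneg_left b1 (Nat.cast_nonneg _)
        · exact mul_le_mul_of_nonneg_left b2 (Nat.cast_nonneg _)
    _ = _ := by rw [mul_pow, mul_pow, pow_add, pow_add]; ring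

lemma IsClass.pb {k : ι → Fin d → ℤ} (hk : Function.Injective k) {p q : ℕ} {s : ℝ} {ν ν' : ℕ}
    {C C' : ℝ} {P Q : Poly ι} (hP : IsClass k (p + 1) s ν C P)
    (hQ : IsClass k (q + 1) 0 ν' C' Q) :
    IsClass k (p + q + 1) s (ν + ν') (pbConst p q s (ν + ν') * (C * C')) (pb P Q) := by
  classical
  have hdeg : ∀ m, coeff m (NLSTorus.pb P Q) ≠ 0 → ∑ x, m (Sum.inl x) = p + q + 1 ∧
      ∑ x, m (Sum.inr x) = p + q + 1 ∧ momentum k m = 0 := by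
    intro m hm
    obtain ⟨m₁, m₂, x, rfl, h | h⟩ := exists_of_coeff_pb_ne_zero hm
    all_goals
      have a1 := hP.degL _ h.1
      have a2 := hP.degR _ h.1
      have a3 := hP.mom _ h.1
      have b1 := hQ.degL _ h.2
      have b2 := hQ.degR _ h.2
      have b3 := hQ.mom _ h.2
      simp only [Finsupp.add_apply, Finset.sum_add_distrib, Finsupp.single_apply,
        Sum.inl.injEq, Sum.inr.injEq, reduceCtorEq, Finset.sum_ite_eq, Finset.mem_univ, if_true,
        if_false, Finset.sum_const_zero, momentum_add, momentum_single, signedFreq,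
        Sum.elim_inl, Sum.elim_inr, Pi.neg_apply] at a1 a2 a3 b1 b2 b3 ⊢
      refine ⟨by omega, by omega, ?_⟩
    · rw [eq_neg_of_add_eq_zero_left a3, eq_neg_of_add_eq_zero_left b3]; abel
    · rw [eq_neg_of_add_eq_zero_left a3, eq_neg_of_add_eq_zero_left b3]; abel
  have hC := hP.nonneg
  have hC' := hQ.nonneg
  refine ⟨fun m hm => (hdeg m hm).1, fun m hm => (hdeg m hm).2.1, fun m hm => (hdeg m hm).2.2,
    by unfold pbConst; positivity, fun m K M hK hM hm hc => ?_⟩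
  set B : ℝ := ((p + 1 : ℕ) : ℝ) * ((q + 1 : ℕ) : ℝ) * (2 * (p + q + 1 : ℕ) : ℝ) ^ (2 * s) *
        (2 * (p + q + 1 : ℕ) : ℝ) ^ (ν + ν') * (C * C' * K ^ (2 * s) * M ^ (ν + ν')) with hB
  have hB0 : 0 ≤ B := by positivity
  have hRHS : pbConst p q s (ν + ν') * (C * C') * K ^ (2 * s) * M ^ (ν + ν') =
      2 ^ (2 * (p + q + 1)) * (2 * B) := by
    rw [hB, pbConst]; ring
  rw [hRHS]
  by_cases h0 : coeff m (NLSTorus.pb P Q) = 0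
  · rw [h0, norm_zero]; positivity
  have hcard : ((antidiagonal m).card : ℝ) ≤ 2 ^ (2 * (p + q + 1)) := by
    have := card_antidiagonal_le m
    rw [sum_univ_sum_type, (hdeg m h0).1, (hdeg m h0).2.1, ← two_mul] at this
    exact_mod_cast this
  have hterm : ∀ (v w : ι → ι ⊕ ι), (∀ x, freq k (v x) = freq k (w x)) →
      (∀ x y, signedFreq k (v x) = signedFreq k (v y) → x = y) →
      ∀ a ∈ antidiagonal m, ∑ x, ‖coeff a.1 (pderiv (v x) P)‖ * ‖coeff a.2 (pderiv (w x) Q)‖ ≤ B := by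
    intro v w hvw hinj a ha
    have ham := Finset.HasAntidiagonal.mem_antidiagonal.1 ha
    refine sum_le_of_subsingleton hB0 (fun x => ?_) fun x y hx hy => hinj x y ?_
    · exact norm_coeff_pderiv_mul_le hP hQ (hvw x) hK hM (by rwa [ham]) (by rwa [ham])
    · have hmom : ∀ x, ‖coeff a.1 (pderiv (v x) P)‖ * ‖coeff a.2 (pderiv (w x) Q)‖ ≠ 0 →
          momentum k a.1 + signedFreq k (v x) = 0 := by
        intro x hx
        rw [← momentum_single, ← momentum_add]
        refine hP.mom _ fun h => hx ?_
        rw [coeff_pderiv, h]; simp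
      exact add_left_cancel ((hmom x hx).trans (hmom y hy).symm)
  have h1 := hterm Sum.inl Sum.inr (fun x => rfl) (fun x y h => hk h)
  have h2 := hterm Sum.inr Sum.inl (fun x => rfl) (fun x y h => hk (neg_injective h))
  calc ‖coeff m (NLSTorus.pb P Q)‖
      ≤ ∑ x, (∑ a ∈ antidiagonal m,
          ‖coeff a.1 (pderiv (Sum.inl x) P)‖ * ‖coeff a.2 (pderiv (Sum.inr x) Q)‖ +
        ∑ a ∈ antidiagonal m,
          ‖coeff a.1 (pderiv (Sum.inr x) P)‖ * ‖coeff a.2 (pderiv (Sum.inl x) Q)‖) := by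
        rw [NLSTorus.pb, coeff_sum]
        refine (norm_sum_le _ _).trans (Finset.sum_le_sum fun x _ => ?_)
        rw [coeff_sub, coeff_mul, coeff_mul]
        refine (norm_sub_le _ _).trans (add_le_add ?_ ?_) <;>
        · refine (norm_sum_le _ _).trans (le_of_eq ?_)
          exact Finset.sum_congr rfl fun a _ => norm_mul _ _
    _ = ∑ a ∈ antidiagonal m,
          (∑ x, ‖coeff a.1 (pderiv (Sum.inl x) P)‖ * ‖coeff a.2 (pderiv (Sum.inr x) Q)‖ +
          ∑ x, ‖coeff a.1 (pderiv (Sum.inr x) P)‖ * ‖coeff a.2 (pderiv (Sum.inl x) Q)‖) := by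
        rw [Finset.sum_add_distrib, Finset.sum_add_distrib, Finset.sum_comm,
          Finset.sum_comm (s := Finset.univ)]
    _ ≤ ∑ _a ∈ antidiagonal m, (B + B) :=
        Finset.sum_le_sum fun a ha => add_le_add (h1 a ha) (h2 a ha)
    _ = (antidiagonal m).card * (2 * B) := by rw [Finset.sum_const, nsmul_eq_mul]; ring
    _ ≤ 2 ^ (2 * (p + q + 1)) * (2 * B) := mul_le_mul_of_nonneg_right hcard (by positivity)

end PolyClass

/-! ### The formal normal form -/

section NormalForm

open MvPolynomial
open Finset.HasAntidiagonal (antidiagonal)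

variable {d : ℕ} {ι : Type*} [Fintype ι]

/-- The divisor of a monomial: `∑ ωₓ` over the factors `uₓ` minus the sum over the factors `ūₓ`. -/
def divisor (ω : ι → ℝ) (m : ι ⊕ ι →₀ ℕ) : ℝ :=
  ∑ x, ((m (Sum.inl x) : ℝ) - m (Sum.inr x)) * ω x

/-- A monomial is resonant if on each sphere `|n|² = κ` it has as many factors `u` as `ū`. -/
def IsRes (k : ι → Fin d → ℤ) (m : ι ⊕ ι →₀ ℕ) : Prop :=
  ∀ κ : ℝ, open Classical in ∑ x with normSq (k x) = κ, m (Sum.inl x) =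
    ∑ x with normSq (k x) = κ, m (Sum.inr x)

/-- The small divisor condition, with loss measured by the third largest frequency. -/
def SmallDivisors (γ : ℕ → ℝ) (α : ℕ → ℕ) (k : ι → Fin d → ℤ) (ω : ι → ℝ) : Prop :=
  ∀ p m, ∑ x, m (Sum.inl x) = p → ∑ x, m (Sum.inr x) = p → ¬IsRes k m → ∀ M : ℝ, 1 ≤ M →
    highCount k M m ≤ 2 → γ p * (M ^ α p)⁻¹ ≤ |divisor ω m|

lemma coeff_pb_diagForm_ofReal (ω : ι → ℝ) (P : Poly ι) (m : ι ⊕ ι →₀ ℕ) :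
    coeff m (pb P (diagForm fun x => (ω x : ℂ))) = (divisor ω m : ℂ) * coeff m P := by
  rw [coeff_pb_diagForm, divisor]
  push_cast
  rfl

lemma divisor_eq_zero_of_isRes {k : ι → Fin d → ℤ} {m : ι ⊕ ι →₀ ℕ} (h : IsRes k m) (f : ℝ → ℝ) :
    divisor (fun x => f (normSq (k x))) m = 0 := by
  classical
  rw [divisor, ← Finset.sum_fiberwise_of_maps_to (t := Finset.univ.image fun x => normSq (k x))
    (g := fun x => normSq (k x)) (fun x _ => Finset.mem_image_of_mem _ (Finset.mem_univ x))]
  refine Finset.sum_eq_zero fun κ _ => ?_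
  have h1 : ∑ x with normSq (k x) = κ,
      ((m (Sum.inl x) : ℝ) - m (Sum.inr x)) * f (normSq (k x)) =
      ∑ x with normSq (k x) = κ, ((m (Sum.inl x) : ℝ) - m (Sum.inr x)) * f κ := by
    refine Finset.sum_congr rfl fun x hx => ?_
    rw [(Finset.mem_filter.1 hx).2]
  rw [h1, ← Finset.sum_mul, Finset.sum_sub_distrib]
  have h2 := h κ
  have h3 : (∑ x with normSq (k x) = κ, (m (Sum.inl x) : ℝ)) =
      ∑ x with normSq (k x) = κ, (m (Sum.inr x) : ℝ) := by
    have : ((∑ x with normSq (k x) = κ, m (Sum.inl x) : ℕ) : ℝ) =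
        ((∑ x with normSq (k x) = κ, m (Sum.inr x) : ℕ) : ℝ) := by
      congr 1
    exact_mod_cast this
  rw [h3, sub_self, zero_mul]

lemma pb_diagForm_eq_zero {k : ι → Fin d → ℤ} {P : Poly ι}
    (h : ∀ m, coeff m P ≠ 0 → IsRes k m) (f : ℝ → ℝ) :
    pb (diagForm fun x => (f (normSq (k x)) : ℂ)) P = 0 := by
  rw [pb_skew, neg_eq_zero]
  refine MvPolynomial.ext _ _ fun m => ?_
  rw [coeff_pb_diagForm_ofReal, coeff_zero]
  by_cases hm : coeff m P = 0
  · rw [hm, mul_zero]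
  · rw [divisor_eq_zero_of_isRes (h m hm) f]; simp

lemma diagForm_eq_sum_monomial (w : ι → ℂ) :
    diagForm w = ∑ x, monomial (Finsupp.single (Sum.inl x) 1 + Finsupp.single (Sum.inr x) 1) (w x) := by
  refine Finset.sum_congr rfl fun x _ => ?_
  rw [X, X, monomial_mul, C_mul_monomial]
  simp

lemma exists_of_coeff_diagForm_ne_zero {w : ι → ℂ} {m : ι ⊕ ι →₀ ℕ}
    (h : coeff m (diagForm w) ≠ 0) :
    ∃ x, m = Finsupp.single (Sum.inl x) 1 + Finsupp.single (Sum.inr x) 1 := by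
  classical
  rw [diagForm_eq_sum_monomial, coeff_sum] at h
  obtain ⟨x, -, hx⟩ := Finset.exists_ne_zero_of_sum_ne_zero h
  rw [coeff_monomial] at hx
  exact ⟨x, by by_contra h'; exact hx (if_neg fun h'' => h' h''.symm)⟩

lemma coeff_diagForm (w : ι → ℂ) (x : ι) :
    coeff (Finsupp.single (Sum.inl x) 1 + Finsupp.single (Sum.inr x) 1) (diagForm w) = w x := by
  classical
  rw [diagForm_eq_sum_monomial, coeff_sum, Finset.sum_eq_single x]
  · rw [coeff_monomial, if_pos rfl]
  · intro y _ hy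
    rw [coeff_monomial, if_neg]
    intro h
    have := DFunLike.congr_fun h (Sum.inl y)
    simp [hy.symm] at this
  · simp

lemma isRes_of_coeff_diagForm (k : ι → Fin d → ℤ) {w : ι → ℂ} {m : ι ⊕ ι →₀ ℕ}
    (h : coeff m (diagForm w) ≠ 0) : IsRes k m := by
  classical
  obtain ⟨x, rfl⟩ := exists_of_coeff_diagForm_ne_zero h
  intro κ
  refine Finset.sum_congr rfl fun y _ => ?_
  simp [Finsupp.single_apply]

lemma isClass_diagForm (k : ι → Fin d → ℤ) {s : ℝ} (hs : 0 ≤ s) :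
    IsClass k 1 s 0 1 (diagForm fun x => ((jap (k x) ^ (2 * s) : ℝ) : ℂ)) := by
  classical
  refine ⟨fun m hm => ?_, fun m hm => ?_, fun m hm => ?_, zero_le_one,
    fun m K M hK hM hm hc => ?_⟩
  · obtain ⟨x, rfl⟩ := exists_of_coeff_diagForm_ne_zero hm
    simp [Finsupp.single_apply]
  · obtain ⟨x, rfl⟩ := exists_of_coeff_diagForm_ne_zero hm
    simp [Finsupp.single_apply]
  · obtain ⟨x, rfl⟩ := exists_of_coeff_diagForm_ne_zero hm
    rw [momentum_add, momentum_single, momentum_single]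
    simp [signedFreq]
  · rw [one_mul, pow_zero, mul_one]
    by_cases h0 : coeff m (diagForm fun x => ((jap (k x) ^ (2 * s) : ℝ) : ℂ)) = 0
    · rw [h0, norm_zero]; positivity
    · obtain ⟨x, rfl⟩ := exists_of_coeff_diagForm_ne_zero h0
      rw [coeff_diagForm, Complex.norm_real, Real.norm_of_nonneg
        (Real.rpow_nonneg (jap_pos _).le _)]
      exact Real.rpow_le_rpow (jap_pos _).le (hm (Sum.inl x) (by simp)) (by positivity)

/-- The homological equation. -/
lemma exists_homological {k : ι → Fin d → ℤ} {ω : ι → ℝ} {γ : ℕ → ℝ} {α : ℕ → ℕ}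
    (hγ : ∀ p, 0 < γ p) (hNR : SmallDivisors γ α k ω) {p ν : ℕ} {C : ℝ} {G : Poly ι}
    (hG : IsClass k p 0 ν C G) :
    ∃ χ : Poly ι, IsClass k p 0 (ν + α p) (C * (γ p)⁻¹) χ ∧
      IsClass k p 0 ν C (pb χ (diagForm fun x => (ω x : ℂ))) ∧
      ∀ m, coeff m (G + pb χ (diagForm fun x => (ω x : ℂ))) ≠ 0 → IsRes k m := by
  classical
  set c : (ι ⊕ ι →₀ ℕ) → ℂ := fun m =>
    if IsRes k m then 0 else -coeff m G * ((divisor ω m)⁻¹ : ℝ) with hc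
  set χ : Poly ι := ∑ m ∈ G.support, monomial m (c m) with hχ
  have hcoeff : ∀ m, coeff m χ = c m := by
    intro m
    simp only [hχ, coeff_sum, coeff_monomial, Finset.sum_ite_eq']
    split_ifs with h
    · rfl
    · rw [notMem_support_iff] at h
      simp [hc, h]
  have hpos : ∀ m, coeff m G ≠ 0 → ¬IsRes k m → ∀ M : ℝ, 1 ≤ M → highCount k M m ≤ 2 →
      γ p * (M ^ α p)⁻¹ ≤ |divisor ω m| := fun m hm hr =>
    hNR p m (hG.degL m hm) (hG.degR m hm) hr
  have hdiv : ∀ m, coeff m G ≠ 0 → ¬IsRes k m → divisor ω m ≠ 0 := by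
    intro m hm hr h0
    have h1 := hpos m hm hr (∑ v, jap (freq k v) + 1)
      (by linarith [Finset.sum_nonneg fun u (_ : u ∈ Finset.univ) => (jap_pos (freq k u)).le]) ?_
    · rw [h0, abs_zero] at h1
      have h2 := hγ p
      have h3 : 0 < ∑ v, jap (freq k v) + 1 := by
        linarith [Finset.sum_nonneg fun u (_ : u ∈ Finset.univ) => (jap_pos (freq k u)).le]
      have : 0 < γ p * ((∑ v, jap (freq k v) + 1) ^ α p)⁻¹ := by positivity
      linarith
    · have : highCount k (∑ v, jap (freq k v) + 1) m = 0 := by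
        refine Finset.sum_eq_zero fun v _ => if_neg (not_lt.2 ?_)
        have := Finset.single_le_sum (f := fun u => jap (freq k u))
          (fun u _ => (jap_pos (freq k u)).le) (Finset.mem_univ v)
        linarith
      omega
  have hpb : ∀ m, coeff m (pb χ (diagForm fun x => (ω x : ℂ))) =
      if IsRes k m then 0 else -coeff m G := by
    intro m
    rw [coeff_pb_diagForm_ofReal, hcoeff]
    simp only [hc]
    split_ifs with h
    · simp
    · by_cases hm : coeff m G = 0
      · simp [hm]
      · have : (divisor ω m : ℂ) ≠ 0 := by exact_mod_cast hdiv m hm h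
        push_cast
        field_simp
  refine ⟨χ, ?_, ?_, ?_⟩
  · have hne : ∀ m, coeff m χ ≠ 0 → coeff m G ≠ 0 := fun m hm h0 => hm <| by
      rw [hcoeff]; simp [hc, h0]
    refine ⟨fun m hm => hG.degL m (hne m hm), fun m hm => hG.degR m (hne m hm),
      fun m hm => hG.mom m (hne m hm), mul_nonneg hG.nonneg (inv_nonneg.2 (hγ p).le),
      fun m K M hK hM hm hcount => ?_⟩
    have hb := hG.bound m K M hK hM hm hcount
    have hCn := hG.nonneg
    have hγp := hγ p
    rw [hcoeff]
    simp only [hc]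
    split_ifs with hr
    · rw [norm_zero]; positivity
    · by_cases h0 : coeff m G = 0
      · rw [h0, neg_zero, zero_mul, norm_zero]; positivity
      · rw [norm_mul, norm_neg, Complex.norm_real, norm_inv, Real.norm_eq_abs]
        have h1 := hpos m h0 hr M hM hcount
        have h2 : |divisor ω m|⁻¹ ≤ (γ p)⁻¹ * M ^ α p := by
          rw [← inv_inv (M ^ α p), ← mul_inv]
          exact inv_anti₀ (by positivity) h1
        calc ‖coeff m G‖ * |divisor ω m|⁻¹
            ≤ (C * K ^ (2 * (0 : ℝ)) * M ^ ν) * ((γ p)⁻¹ * M ^ α p) :=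
              mul_le_mul hb h2 (by positivity) (by positivity)
          _ = C * (γ p)⁻¹ * K ^ (2 * (0 : ℝ)) * M ^ (ν + α p) := by rw [pow_add]; ring
  · have := hG.of_coeff_le (Q := pb χ (diagForm fun x => (ω x : ℂ))) zero_le_one fun m => by
      rw [hpb, one_mul]
      split_ifs
      · simp
      · rw [norm_neg]
    simpa using this
  · intro m hm
    by_contra hr
    rw [coeff_add, hpb, if_neg hr] at hm
    simp at hm

/-- Series whose `i`-th coefficient is in the class of bidegree `(i + 1, i + 1)`. -/
def SerClass {r : ℕ} (k : ι → Fin d → ℤ) (s : ℝ) (ν : ℕ) (C : ℝ) (Y : Ser ι r) : Prop :=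
  ∀ i ≤ r, IsClass k (i + 1) s ν C (Y i)

/-- A bound for the constants of all brackets in degrees up to `r`. -/
def serConst (r : ℕ) (s : ℝ) (n : ℕ) : ℝ :=
  ∑ i ∈ Finset.range (r + 1), ∑ j ∈ Finset.range (r + 1), pbConst i j s n

lemma pbConst_nonneg (p q : ℕ) (s : ℝ) (n : ℕ) : 0 ≤ pbConst p q s n := by
  unfold pbConst; positivity

lemma serConst_nonneg (r : ℕ) (s : ℝ) (n : ℕ) : 0 ≤ serConst r s n :=
  Finset.sum_nonneg fun _ _ => Finset.sum_nonneg fun _ _ => pbConst_nonneg _ _ _ _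

lemma pbConst_le_serConst {r i j : ℕ} (hi : i ≤ r) (hj : j ≤ r) (s : ℝ) (n : ℕ) :
    pbConst i j s n ≤ serConst r s n :=
  (Finset.single_le_sum (f := fun j => pbConst i j s n) (fun _ _ => pbConst_nonneg _ _ _ _)
    (Finset.mem_range.2 (Nat.lt_succ_of_le hj))).trans
  (Finset.single_le_sum (f := fun i => ∑ j ∈ Finset.range (r + 1), pbConst i j s n)
    (fun _ _ => Finset.sum_nonneg fun _ _ => pbConst_nonneg _ _ _ _)
    (Finset.mem_range.2 (Nat.lt_succ_of_le hi)))

lemma SerClass.mono {r : ℕ} {k : ι → Fin d → ℤ} {s : ℝ} {ν ν' : ℕ} {C C' : ℝ} {Y : Ser ι r}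
    (h : SerClass k s ν C Y) (hν : ν ≤ ν') (hC : C ≤ C') : SerClass k s ν' C' Y :=
  fun i hi => (h i hi).mono hν hC

lemma IsClass.pb_symm {r : ℕ} {k : ι → Fin d → ℤ} (hk : Function.Injective k) {s : ℝ}
    {ν ν' : ℕ} {C C' : ℝ} {i j : ℕ} (hij : i + j ≤ r) {P χ : Poly ι}
    (hχ : IsClass k (j + 1) 0 ν' C' χ) (hP : IsClass k (i + 1) s ν C P) :
    IsClass k (i + j + 1) s (ν + ν') (serConst r s (ν + ν') * (C * C')) (NLSTorus.pb χ P) := by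
  rw [pb_skew]
  refine ((hP.pb hk hχ).neg).mono le_rfl ?_
  exact mul_le_mul_of_nonneg_right (pbConst_le_serConst (by omega) (by omega) _ _)
    (mul_nonneg hP.nonneg hχ.nonneg)

lemma SerClass.ad {r : ℕ} {k : ι → Fin d → ℤ} (hk : Function.Injective k) {s : ℝ}
    {ν ν' : ℕ} {C C' : ℝ} {Y : Ser ι r} (h : SerClass k s ν C Y) {j : ℕ} {χ : Poly ι}
    (hχ : IsClass k (j + 1) 0 ν' C' χ) :
    SerClass k s (ν + ν') (serConst r s (ν + ν') * (C * C')) (Ser.ad r j χ Y) := by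
  intro n hn
  have hC := (h 0 (Nat.zero_le r)).nonneg
  rw [Ser.ad_apply]
  split_ifs with hj
  · have := hχ.pb_symm (r := r) hk (i := n - j) (by omega) (h (n - j) (by omega))
    rwa [Nat.sub_add_cancel hj.1] at this
  · exact IsClass.zero (mul_nonneg (serConst_nonneg _ _ _) (mul_nonneg hC hχ.nonneg))

/-- The constants for the iterated brackets. -/
def adConst (r : ℕ) (s : ℝ) (ν ν' : ℕ) (C C' : ℝ) : ℕ → ℝ
  | 0 => C
  | j + 1 => serConst r s (ν + (j + 1) * ν') * (adConst r s ν ν' C C' j * C')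

lemma SerClass.ad_pow {r : ℕ} {k : ι → Fin d → ℤ} (hk : Function.Injective k) {s : ℝ}
    {ν ν' : ℕ} {C C' : ℝ} {Y : Ser ι r} (h : SerClass k s ν C Y) {j : ℕ} {χ : Poly ι}
    (hχ : IsClass k (j + 1) 0 ν' C' χ) (i : ℕ) :
    SerClass k s (ν + i * ν') (adConst r s ν ν' C C' i) ((Ser.ad r j χ ^ i) Y) := by
  induction i with
  | zero => simpa [adConst] using h
  | succ i ih =>
    have h1 := SerClass.ad hk ih hχ
    rw [pow_succ', Module.End.mul_apply]
    have h2 : ν + i * ν' + ν' = ν + (i + 1) * ν' := by ring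
    rw [h2] at h1
    exact h1

/-- The constant for the Lie transform. -/
def expConst (r : ℕ) (s : ℝ) (ν ν' : ℕ) (C C' : ℝ) : ℝ :=
  ∑ i ∈ Finset.range (r + 1), adConst r s ν ν' C C' i

lemma SerClass.sum_smul {r : ℕ} {k : ι → Fin d → ℤ} {s : ℝ} {ν : ℕ} {c : ℕ → ℝ}
    {f : ℕ → Ser ι r} (t : Finset ℕ) (h : ∀ i ∈ t, SerClass k s ν (c i) (f i)) (a : ℕ → ℂ)
    (ha : ∀ i, ‖a i‖ ≤ 1) {n : ℕ} (hn : n ≤ r) :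
    IsClass k (n + 1) s ν (∑ i ∈ t, c i) (∑ i ∈ t, a i • f i n) :=
  IsClass.sum _ fun i hi => ((h i hi n hn).smul (a i)).mono le_rfl
    (mul_le_of_le_one_left (h i hi n hn).nonneg (ha i))

lemma norm_inv_factorial_le (i : ℕ) : ‖((i.factorial : ℂ)⁻¹)‖ ≤ 1 := by
  rw [norm_inv, Complex.norm_natCast]
  exact inv_le_one_of_one_le₀ (by exact_mod_cast Nat.one_le_iff_ne_zero.2 i.factorial_ne_zero)

lemma SerClass.lieExp {r : ℕ} {k : ι → Fin d → ℤ} (hk : Function.Injective k) {s : ℝ}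
    {ν ν' : ℕ} {C C' : ℝ} {Y : Ser ι r} (h : SerClass k s ν C Y) {j : ℕ} (hj : 1 ≤ j) {χ : Poly ι}
    (hχ : IsClass k (j + 1) 0 ν' C' χ) :
    SerClass k s (ν + r * ν') (expConst r s ν ν' C C') (Ser.lieExp r j χ Y) := by
  intro n hn
  rw [Ser.lieExp_apply hj]
  refine SerClass.sum_smul (f := fun i => (Ser.ad r j χ ^ i) Y) _ (fun i hi => ?_) _
    norm_inv_factorial_le hn
  exact (SerClass.ad_pow hk h hχ i).mono (Nat.add_le_add_left (Nat.mul_le_mul_right _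
    (Nat.lt_succ_iff.1 (Finset.mem_range.1 hi))) _) le_rfl

/-- The series `λ⁰ P`. -/
def Ser.const (r : ℕ) (P : Poly ι) : Ser ι r := fun n => if n = 0 then P else 0

/-- Existence of a formal first integral `E` of `H` with leading part `∑ ⟨n⟩^(2s) |uₙ|²`, when `H` is
in normal form up to order `r - j`. The bounds do not depend on the set of modes. -/
theorem exists_formal_integral (d r : ℕ) {γ : ℕ → ℝ} (α : ℕ → ℕ) (hγ : ∀ p, 0 < γ p) (j : ℕ) :
    ∀ (ν : ℕ) (C : ℝ), 0 ≤ C → ∃ ν' : ℕ, ∀ s : ℝ, 0 ≤ s → ∃ C' : ℝ, ∀ (ι : Type) [Fintype ι]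
      (k : ι → Fin d → ℤ) (ω : ι → ℝ) (H : Ser ι r), Function.Injective k →
      SmallDivisors γ α k ω → H 0 = diagForm (fun x => (ω x : ℂ)) →
      (∀ i, 1 ≤ i → i ≤ r → IsClass k (i + 1) 0 ν C (H i)) →
      (∀ i, 1 ≤ i → i + j ≤ r → ∀ m, coeff m (H i) ≠ 0 → IsRes k m) →
      ∃ E : Ser ι r, E 0 = diagForm (fun x => ((jap (k x) ^ (2 * s) : ℝ) : ℂ)) ∧
        SerClass k s ν' C' E ∧ E * H = 0 := by
  induction j with
  | zero =>
    intro ν C hC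
    refine ⟨0, fun s hs => ⟨1, fun ι _ k ω H hk _ hH0 _ hres => ?_⟩⟩
    refine ⟨Ser.const r (diagForm fun x => ((jap (k x) ^ (2 * s) : ℝ) : ℂ)), rfl,
      fun i hi => ?_, funext fun n => ?_⟩
    · unfold Ser.const
      split_ifs with h0
      · rw [h0]; exact isClass_diagForm k hs
      · exact IsClass.zero zero_le_one
    · rw [Ser.mul_apply]
      split_ifs with hn
      · refine Finset.sum_eq_zero fun p hp => ?_
        have hp' := Finset.HasAntidiagonal.mem_antidiagonal.1 hp
        unfold Ser.const
        split_ifs with h0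
        · simp_rw [jap_rpow_two_mul]
          refine pb_diagForm_eq_zero (fun m hm => ?_) fun t => (1 + t) ^ s
          by_cases h2 : p.2 = 0
          · rw [h2, hH0] at hm
            exact isRes_of_coeff_diagForm k hm
          · exact hres p.2 (by omega) (by omega) m hm
        · exact pb_zero_left _
      · rfl
  | succ j ih =>
    intro ν C hC
    by_cases hjr : r ≤ j
    · obtain ⟨ν', h⟩ := ih ν C hC
      refine ⟨ν', fun s hs => ?_⟩
      obtain ⟨C', h⟩ := h s hs
      exact ⟨C', fun ι _ k ω H hk hNR hH0 hH _ =>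
        h ι k ω H hk hNR hH0 hH fun i h1 h2 => by omega⟩
    push Not at hjr
    obtain ⟨l, hl⟩ : ∃ l, l + j = r := ⟨r - j, by omega⟩
    have hl1 : 1 ≤ l := by omega
    set ν₁ := ν + α (l + 1) with hν₁
    set C₁ := C * (γ (l + 1))⁻¹ with hC₁
    have hC₁0 : 0 ≤ C₁ := mul_nonneg hC (inv_nonneg.2 (hγ _).le)
    set C₂ := max C (serConst r 0 (ν + ν₁) * (C * C₁)) with hC₂
    set ν₂ := ν + ν₁ + r * ν₁ with hν₂
    set C₃ := expConst r 0 (ν + ν₁) ν₁ C₂ C₁ + C with hC₃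
    have hC₂0 : 0 ≤ C₂ := hC.trans (le_max_left _ _)
    have hadc : ∀ i, 0 ≤ adConst r 0 (ν + ν₁) ν₁ C₂ C₁ i := by
      intro i
      induction i with
      | zero => exact hC₂0
      | succ i ih => exact mul_nonneg (serConst_nonneg _ _ _) (mul_nonneg ih hC₁0)
    have hC₃0 : 0 ≤ C₃ := add_nonneg (Finset.sum_nonneg fun i _ => hadc i) hC
    obtain ⟨ν', h⟩ := ih ν₂ C₃ hC₃0
    refine ⟨ν' + r * ν₁, fun s hs => ?_⟩
    obtain ⟨C', h⟩ := h s hs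
    refine ⟨expConst r s ν' ν₁ C' C₁, fun ι _ k ω H hk hNR hH0 hH hres => ?_⟩
    obtain ⟨χ, hχ, hχ0, hχres⟩ := exists_homological hγ hNR (hH l hl1 (by omega))
    set H' := Ser.lieExp r l χ H with hH'
    have hY : SerClass k 0 (ν + ν₁) C₂ (Ser.ad r l χ H) := by
      intro n hn
      rw [Ser.ad_apply]
      split_ifs with hln
      · by_cases hnl : n = l
        · rw [hnl, Nat.sub_self, hH0]
          exact hχ0.mono (Nat.le_add_right _ _) (le_max_left _ _)
        · have h1 := hχ.pb_symm (r := r) hk (i := n - l) (by omega)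
            (hH (n - l) (by omega) (by omega))
          rw [Nat.sub_add_cancel hln.1] at h1
          exact h1.mono le_rfl (le_max_right _ _)
      · exact IsClass.zero hC₂0
    obtain ⟨E', hE'0, hE', hEH'⟩ := h ι k ω H' hk hNR
      (by rw [hH', Ser.lieExp_apply_of_lt hl1 χ H hl1, hH0])
      (fun i hi1 hir => by
        rw [hH', Ser.lieExp_apply hl1, Finset.sum_range_succ']
        refine IsClass.add ?_ ?_
        · have := SerClass.sum_smul (c := fun i => adConst r 0 (ν + ν₁) ν₁ C₂ C₁ i)
            (f := fun i => (Ser.ad r l χ ^ i) (Ser.ad r l χ H)) (k := k) (s := 0) (ν := ν₂)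
            (Finset.range r) (fun i' hi' => (SerClass.ad_pow hk hY hχ i').mono
              (Nat.add_le_add_left (Nat.mul_le_mul_right _ (Finset.mem_range.1 hi').le) _) le_rfl)
            (fun i => (((i + 1).factorial : ℂ)⁻¹)) (fun i => norm_inv_factorial_le _) hir
          refine IsClass.mono ?_ le_rfl (Finset.sum_le_sum_of_subset_of_nonneg
            (Finset.range_subset_range.2 (Nat.le_succ r)) fun i _ _ => hadc i)
          convert this using 1
          refine Finset.sum_congr rfl fun i' _ => ?_
          rw [pow_succ, Module.End.mul_apply]
        · simpa using (hH i hi1 hir).mono (ν' := ν₂) (by omega) le_rfl)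
      (fun i hi1 hij m hm => by
        rcases lt_or_eq_of_le (show i ≤ l by omega) with hlt | rfl
        · rw [hH', Ser.lieExp_apply_of_lt hl1 χ H hlt] at hm
          exact hres i hi1 (by omega) m hm
        · rw [hH', Ser.lieExp_apply_self hl1 (by omega), hH0] at hm
          exact hχres m hm)
    refine ⟨Ser.lieExp r l (-χ) E', ?_, ?_, ?_⟩
    · rw [Ser.lieExp_apply_of_lt hl1 _ _ hl1, hE'0]
    · exact hE'.lieExp hk hl1 hχ.neg
    · rw [← Ser.lieExp_neg_lieExp hl1 χ H, ← Ser.lieExp_mul hl1, ← hH', hEH', map_zero]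

/-- The modified energy: a polynomial whose bracket with `H₀ + H₁` is of high order. -/
theorem exists_energy (d r : ℕ) {γ : ℕ → ℝ} (α : ℕ → ℕ) (hγ : ∀ p, 0 < γ p) (C : ℝ) (hC : 0 ≤ C) :
    ∃ ν : ℕ, ∀ s : ℝ, 0 ≤ s → ∃ C' : ℝ, 0 ≤ C' ∧ ∀ (ι : Type) [Fintype ι]
      (k : ι → Fin d → ℤ) (ω : ι → ℝ) (H₁ : Poly ι), Function.Injective k →
      SmallDivisors γ α k ω → IsClass k 2 0 0 C H₁ →
      ∃ (E : ℕ → Poly ι) (S : Poly ι),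
        E 0 = diagForm (fun x => ((jap (k x) ^ (2 * s) : ℝ) : ℂ)) ∧
        (∀ i ≤ r + 1, IsClass k (i + 1) s ν C' (E i)) ∧ IsClass k (r + 3) s ν C' S ∧
        pb (∑ i ∈ Finset.range (r + 2), E i) (diagForm (fun x => (ω x : ℂ)) + H₁) = S := by
  obtain ⟨ν, h⟩ := exists_formal_integral d (r + 1) α hγ (r + 1) 0 C hC
  refine ⟨ν, fun s hs => ?_⟩
  obtain ⟨C', h⟩ := h s hs
  refine ⟨max 0 (max C' (pbConst (r + 1) 1 s (ν + 0) * (C' * C))), le_max_left _ _,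
    fun ι _ k ω H₁ hk hNR hH₁ => ?_⟩
  set H : ℕ → Poly ι := fun n => if n = 0 then diagForm (fun x => (ω x : ℂ)) else
    if n = 1 then H₁ else 0 with hH
  obtain ⟨E, hE0, hE, hEH⟩ : ∃ E : ℕ → Poly ι,
      E 0 = diagForm (fun x => ((jap (k x) ^ (2 * s) : ℝ) : ℂ)) ∧
      (∀ i ≤ r + 1, IsClass k (i + 1) s ν C' (E i)) ∧
      ∀ n ≤ r + 1, ∑ p ∈ antidiagonal n, pb (E p.1) (H p.2) = 0 := by
    obtain ⟨E, hE0, hE, hEH⟩ := h ι k ω H hk hNR rfl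
      (fun i hi1 _ => by
        simp only [hH, if_neg (show i ≠ 0 by omega)]
        split_ifs with h1
        · rw [h1]; exact hH₁
        · exact IsClass.zero hC)
      (fun i _ _ => by omega)
    refine ⟨E, hE0, hE, fun n hn => ?_⟩
    have h1 : (E * (show Ser ι (r + 1) from H)) n = 0 := congrFun hEH n
    rw [Ser.mul_apply, if_pos hn] at h1
    exact h1
  have hn : ∀ n ≤ r, pb (E (n + 1)) (diagForm fun x => (ω x : ℂ)) + pb (E n) H₁ = 0 := by
    intro n hn
    have h1 := hEH (n + 1) (by omega)
    rw [Finset.Nat.sum_antidiagonal_succ', Finset.sum_eq_single (n, 0)] at h1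
    · simpa [hH, add_comm] using h1
    · intro p hp hp'
      have h2 := Finset.HasAntidiagonal.mem_antidiagonal.1 hp
      have h3 : p.2 ≠ 0 := fun h3 => hp' (Prod.ext (by simp; omega) h3)
      simp [hH, h3]
    · simp
  refine ⟨E, pb (E (r + 1)) H₁, hE0, fun i hi => (hE i hi).mono le_rfl ?_, ?_, ?_⟩
  · exact (le_max_left _ _).trans (le_max_right _ _)
  · exact ((hE (r + 1) le_rfl).pb hk hH₁).mono (by simp)
      ((le_max_right _ _).trans (le_max_right _ _))
  · have h0 : pb (E 0) (diagForm fun x => (ω x : ℂ)) = 0 := by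
      simpa [hH] using hEH 0 (by omega)
    rw [pb_sum_left]
    simp only [pb_add_right, Finset.sum_add_distrib]
    rw [Finset.sum_range_succ', h0, add_zero, Finset.sum_range_succ _ (r + 1), ← add_assoc,
      ← Finset.sum_add_distrib,
      Finset.sum_eq_zero fun n hn' => hn n (Nat.lt_succ_iff.1 (Finset.mem_range.1 hn')), zero_add]

end NormalForm

/-! ### Evaluation of polynomials on Sobolev balls -/

section Evaluation

open MvPolynomial

variable {d : ℕ} {ι : Type*} [Fintype ι]

/-- The majorant of a polynomial: all coefficients are replaced by their absolute values. -/
def majorant (P : Poly ι) (w : ι ⊕ ι → ℝ) : ℝ :=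
  ∑ m ∈ P.support, ‖coeff m P‖ * ∏ v, w v ^ m v

/-- The squared Sobolev norm of the variables. -/
def weightedSq (k : ι → Fin d → ℤ) (s : ℝ) (w : ι ⊕ ι → ℝ) : ℝ :=
  ∑ v, jap (freq k v) ^ (2 * s) * w v ^ 2

lemma weightedSq_nonneg (k : ι → Fin d → ℤ) (s : ℝ) (w : ι ⊕ ι → ℝ) : 0 ≤ weightedSq k s w :=
  Finset.sum_nonneg fun _ _ => mul_nonneg (Real.rpow_nonneg (jap_pos _).le _) (sq_nonneg _)

omit [Fintype ι] in
lemma exists_max_freq (k : ι → Fin d → ℤ) {m : ι ⊕ ι →₀ ℕ} (hm : m ≠ 0) :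
    ∃ v m', m = m' + Finsupp.single v 1 ∧ ∀ u, m u ≠ 0 → jap (freq k u) ≤ jap (freq k v) := by
  obtain ⟨v, hv, hmax⟩ := m.support.exists_max_image (fun v => jap (freq k v))
    (Finsupp.support_nonempty_iff.2 hm)
  refine ⟨v, m - Finsupp.single v 1, (tsub_add_cancel_of_le ?_).symm, fun u hu =>
    hmax u (Finsupp.mem_support_iff.2 hu)⟩
  rw [Finsupp.single_le_iff]
  exact Nat.one_le_iff_ne_zero.2 (Finsupp.mem_support_iff.1 hv)

lemma one_le_prod_of_one_le {α : Type*} {t : Finset α} {f : α → ℝ} (h : ∀ i ∈ t, 1 ≤ f i) :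
    1 ≤ ∏ i ∈ t, f i :=
  (Finset.prod_const_one (s := t) (M := ℝ)).symm.le.trans
    (Finset.prod_le_prod (fun _ _ => zero_le_one) h)

lemma sum_prod_pow_le {g : ι ⊕ ι → ℝ} (hg : ∀ v, 0 ≤ g v) (n : ℕ) (T : Finset (ι ⊕ ι →₀ ℕ))
    (hT : ∀ m ∈ T, ∑ v, m v = n) : ∑ m ∈ T, ∏ v, g v ^ m v ≤ (∑ v, g v) ^ n := by
  classical
  rw [Finset.sum_pow_eq_sum_piAntidiag]
  calc ∑ m ∈ T, ∏ v, g v ^ m v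
      = ∑ κ ∈ T.image (fun m : ι ⊕ ι →₀ ℕ => (⇑m : ι ⊕ ι → ℕ)), ∏ v, g v ^ κ v := by
        exact (Finset.sum_image (f := fun κ : ι ⊕ ι → ℕ => ∏ v, g v ^ κ v)
          (fun a _ b _ h => DFunLike.coe_injective h)).symm
    _ ≤ ∑ κ ∈ Finset.univ.piAntidiag n, ∏ v, g v ^ κ v := by
        refine Finset.sum_le_sum_of_subset_of_nonneg (fun κ hκ => ?_)
          fun κ _ _ => Finset.prod_nonneg fun v _ => pow_nonneg (hg v) _
        obtain ⟨m, hm, rfl⟩ := Finset.mem_image.1 hκ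
        simp [Finset.mem_piAntidiag, hT m hm]
    _ ≤ _ := by
        refine Finset.sum_le_sum fun κ _ => le_mul_of_one_le_left
          (Finset.prod_nonneg fun v _ => pow_nonneg (hg v) _) ?_
        exact_mod_cast Nat.multinomial_pos _ _

lemma sum_le_two_mul_of_injOn {V A β : Type*} [Fintype V] [DecidableEq A] (t : Finset β)
    (a : β → V) (b : β → A) (c : β → Bool)
    (hinj : Set.InjOn (fun x => (a x, b x, c x)) t) {f : V → ℝ} {G : A → ℝ} (hf : ∀ v, 0 ≤ f v)
    (hG : ∀ x, 0 ≤ G x) :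
    ∑ x ∈ t, f (a x) * G (b x) ≤ 2 * ((∑ v, f v) * ∑ y ∈ t.image b, G y) := by
  classical
  calc ∑ x ∈ t, f (a x) * G (b x)
      = ∑ z ∈ t.image fun x => (a x, b x, c x), f z.1 * G z.2.1 := by
        rw [Finset.sum_image hinj]
    _ ≤ ∑ z ∈ Finset.univ ×ˢ (t.image b ×ˢ Finset.univ), f z.1 * G z.2.1 := by
        refine Finset.sum_le_sum_of_subset_of_nonneg (fun z hz => ?_)
          fun z _ _ => mul_nonneg (hf _) (hG _)
        obtain ⟨x, hx, rfl⟩ := Finset.mem_image.1 hz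
        simp only [Finset.mem_product, Finset.mem_univ, true_and, and_true]
        exact Finset.mem_image_of_mem _ hx
    _ = 2 * ((∑ v, f v) * ∑ y ∈ t.image b, G y) := by
        rw [Finset.sum_mul_sum]
        simp only [Finset.sum_product, Finset.sum_const, Finset.card_univ, Fintype.card_bool,
          Finset.mul_sum, nsmul_eq_mul, Nat.cast_ofNat]

omit [Fintype ι] in
lemma signedFreq_injOn {k : ι → Fin d → ℤ} (hk : Function.Injective k) {v w : ι ⊕ ι}
    (h : signedFreq k v = signedFreq k w) (hs : v.isLeft = w.isLeft) : v = w := by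
  rcases v with x | x <;> rcases w with y | y <;> simp [signedFreq] at h hs ⊢
  · exact hk h
  · exact hk h

lemma prod_pow_add_single (h : ι ⊕ ι → ℝ) (m : ι ⊕ ι →₀ ℕ) (u : ι ⊕ ι) :
    ∏ v, h v ^ (m + Finsupp.single u 1 : ι ⊕ ι →₀ ℕ) v = (∏ v, h v ^ m v) * h u := by
  classical
  simp only [Finsupp.add_apply, pow_add, Finset.prod_mul_distrib]
  congr 1
  rw [Finset.prod_eq_single u]
  · simp
  · intro b _ hb
    simp [hb.symm]
  · simp

lemma norm_coeff_mul_prod_le {k : ι → Fin d → ℤ} {p : ℕ} {s : ℝ} (hs : 0 ≤ s)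
    {ν : ℕ} {C : ℝ} {P : Poly ι} (hP : IsClass k (p + 1) s ν C P) {w : ι ⊕ ι → ℝ}
    (hw : ∀ v, 0 ≤ w v) {m m₂ : ι ⊕ ι →₀ ℕ} {v₁ v₂ : ι ⊕ ι} (hm : coeff m P ≠ 0)
    (hdec : m = m₂ + Finsupp.single v₂ 1 + Finsupp.single v₁ 1)
    (hmax1 : ∀ u, m u ≠ 0 → jap (freq k u) ≤ jap (freq k v₁))
    (hmax2 : ∀ u, (m₂ + Finsupp.single v₂ 1 : ι ⊕ ι →₀ ℕ) u ≠ 0 →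
      jap (freq k u) ≤ jap (freq k v₂)) :
    ‖coeff m P‖ * ∏ v, w v ^ m v ≤ C * (2 * p + 2 : ℝ) ^ s *
      ((jap (freq k v₁) ^ s * w v₁) ^ 2 * ∏ v, (jap (freq k v) ^ ν * w v) ^ m₂ v +
        (jap (freq k v₂) ^ s * w v₂) ^ 2 * ∏ v, (jap (freq k v) ^ ν * w v) ^ m₂ v) := by
  obtain ⟨M, hM⟩ : ∃ M : ℝ, M = ∏ v, jap (freq k v) ^ m₂ v := ⟨_, rfl⟩
  have hM1 : 1 ≤ M := hM ▸ one_le_prod_of_one_le fun v _ => one_le_pow₀ (one_le_jap _)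
  have hdeg : ∑ v, m₂ v = 2 * p := by
    have hdeg := hP.sum_eq hm
    rw [hdec, sum_add_single, sum_add_single] at hdeg
    omega
  have hcount : highCount k M m ≤ 2 := by
    classical
    rw [hdec, highCount_add, highCount_add, highCount_single, highCount_single]
    have h0 : highCount k M m₂ = 0 := by
      refine Finset.sum_eq_zero fun v _ => ?_
      split_ifs with hv
      · by_contra h0
        refine absurd hv (not_lt.2 ?_)
        calc jap (freq k v) ≤ jap (freq k v) ^ m₂ v := le_self_pow₀ (one_le_jap _) h0
          _ ≤ M := by
            rw [hM, ← Finset.mul_prod_erase _ _ (Finset.mem_univ v)]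
            exact le_mul_of_one_le_right (pow_nonneg (jap_pos _).le _)
              (one_le_prod_of_one_le fun v _ => one_le_pow₀ (one_le_jap _))
      · rfl
    rw [h0]
    split_ifs <;> omega
  have hG : ∏ v, (jap (freq k v) ^ ν * w v) ^ m₂ v = M ^ ν * ∏ v, w v ^ m₂ v := by
    rw [hM, ← Finset.prod_pow, ← Finset.prod_mul_distrib]
    refine Finset.prod_congr rfl fun v _ => ?_
    rw [mul_pow, ← pow_mul, ← pow_mul, mul_comm ν]
  have hb := hP.bound m _ M (one_le_jap _) hM1 hmax1 hcount
  have h12 : jap (freq k v₁) ≤ (2 * p + 2) * jap (freq k v₂) := by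
    have := jap_freq_le_of_momentum (k := k) (m := m₂ + Finsupp.single v₂ 1) (v := v₁)
      (by rw [← hdec]; exact hP.mom m hm) (one_le_jap _) hmax2
    rw [sum_add_single, hdeg] at this
    push_cast at this
    linarith
  have hj1 := jap_pos (freq k v₁)
  have hj2 := jap_pos (freq k v₂)
  have hw1 := hw v₁
  have hw2 := hw v₂
  have hC := hP.nonneg
  have hprod : 0 ≤ ∏ v, w v ^ m₂ v := Finset.prod_nonneg fun v _ => pow_nonneg (hw v) _
  have hwm : ∏ v, w v ^ m v = (∏ v, w v ^ m₂ v) * w v₂ * w v₁ := by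
    rw [hdec, prod_pow_add_single, prod_pow_add_single]
  rw [hwm, hG]
  generalize ∏ v, w v ^ m₂ v = Y at hprod ⊢
  generalize jap (freq k v₁) = j₁ at *
  generalize jap (freq k v₂) = j₂ at *
  generalize w v₁ = w₁ at *
  generalize w v₂ = w₂ at *
  have hK : j₁ ^ (2 * s) ≤ (2 * p + 2 : ℝ) ^ s * (j₁ ^ s * j₂ ^ s) := by
    rw [two_mul, Real.rpow_add hj1]
    have := Real.rpow_le_rpow hj1.le h12 hs
    rw [Real.mul_rpow (by positivity) hj2.le] at this
    calc j₁ ^ s * j₁ ^ s ≤ j₁ ^ s * ((2 * p + 2 : ℝ) ^ s * j₂ ^ s) :=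
          mul_le_mul_of_nonneg_left this (by positivity)
      _ = _ := by ring
  have ha1 : 0 ≤ j₁ ^ s := by positivity
  have ha2 : 0 ≤ j₂ ^ s := by positivity
  have hA : (0 : ℝ) ≤ (2 * p + 2 : ℝ) ^ s := by positivity
  have hMν : 0 ≤ M ^ ν := by positivity
  generalize j₁ ^ s = a₁ at *
  generalize j₂ ^ s = a₂ at *
  generalize (2 * p + 2 : ℝ) ^ s = A at *
  generalize M ^ ν = N at *
  calc ‖coeff m P‖ * (Y * w₂ * w₁)
      ≤ (C * (A * (a₁ * a₂)) * N) * (Y * w₂ * w₁) := by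
        refine mul_le_mul_of_nonneg_right (hb.trans ?_) (by positivity)
        exact mul_le_mul_of_nonneg_right (mul_le_mul_of_nonneg_left hK hC) hMν
    _ = C * A * (((a₁ * w₁) * (a₂ * w₂)) * (N * Y)) := by ring
    _ ≤ C * A * ((a₁ * w₁) ^ 2 * (N * Y) + (a₂ * w₂) ^ 2 * (N * Y)) := by
        refine mul_le_mul_of_nonneg_left ?_ (by positivity)
        rw [← add_mul]
        refine mul_le_mul_of_nonneg_right ?_ (by positivity)
        nlinarith [sq_nonneg (a₁ * w₁ - a₂ * w₂), sq_nonneg (a₁ * w₁), sq_nonneg (a₂ * w₂)]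

theorem majorant_le {k : ι → Fin d → ℤ} (hk : Function.Injective k) {p : ℕ} {s : ℝ} (hs : 0 ≤ s)
    {ν : ℕ} {C : ℝ} {P : Poly ι} (hP : IsClass k (p + 1) s ν C P) {S : ℝ}
    (hS : ∑ v, jap (freq k v) ^ (2 * (ν - s)) ≤ S) {w : ι ⊕ ι → ℝ} (hw : ∀ v, 0 ≤ w v) :
    majorant P w ≤ C * (4 * (2 * p + 2 : ℝ) ^ s) * S ^ p * weightedSq k s w ^ (p + 1) := by
  classical
  set f : ι ⊕ ι → ℝ := fun v => jap (freq k v) ^ s * w v with hf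
  set g : ι ⊕ ι → ℝ := fun v => jap (freq k v) ^ ν * w v with hg
  set G : (ι ⊕ ι →₀ ℕ) → ℝ := fun m => ∏ v, g v ^ m v with hG
  set W := weightedSq k s w with hW
  have hjs : ∀ v, 0 < jap (freq k v) ^ s := fun v => Real.rpow_pos_of_pos (jap_pos _) _
  have hf0 : ∀ v, 0 ≤ f v := fun v => mul_nonneg (hjs v).le (hw v)
  have hg0 : ∀ v, 0 ≤ g v := fun v => mul_nonneg (pow_nonneg (jap_pos _).le _) (hw v)
  have hG0 : ∀ m, 0 ≤ G m := fun m => Finset.prod_nonneg fun v _ => pow_nonneg (hg0 v) _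
  have hfW : ∑ v, f v ^ 2 = W := by
    refine Finset.sum_congr rfl fun v _ => ?_
    rw [hf, mul_pow, mul_comm (2 : ℝ) s, Real.rpow_mul (jap_pos _).le, Real.rpow_two]
  have hex : ∀ m, coeff m P ≠ 0 → ∃ v₁ v₂ m₂,
      m = m₂ + Finsupp.single v₂ 1 + Finsupp.single v₁ 1 ∧
      (∀ u, m u ≠ 0 → jap (freq k u) ≤ jap (freq k v₁)) ∧
      (∀ u, (m₂ + Finsupp.single v₂ 1 : ι ⊕ ι →₀ ℕ) u ≠ 0 → jap (freq k u) ≤ jap (freq k v₂)) := by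
    intro m hm
    have hdeg := hP.sum_eq hm
    obtain ⟨v₁, m', rfl, h1⟩ := exists_max_freq k (m := m) (by rintro rfl; simp at hdeg)
    rw [sum_add_single] at hdeg
    obtain ⟨v₂, m₂, rfl, h2⟩ := exists_max_freq k (m := m')
      (by rintro rfl; simp at hdeg; omega)
    exact ⟨v₁, v₂, m₂, rfl, h1, h2⟩
  have hS0 : 0 ≤ S := le_trans (Finset.sum_nonneg fun v _ => Real.rpow_nonneg (jap_pos _).le _) hS
  have hC := hP.nonneg
  have hW0 : 0 ≤ W := weightedSq_nonneg _ _ _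
  rcases P.support.eq_empty_or_nonempty with hempty | ⟨m₀, hm₀⟩
  · rw [majorant, hempty, Finset.sum_empty]
    positivity
  obtain ⟨v₀, -⟩ := hex m₀ (mem_support_iff.1 hm₀)
  have : Nonempty (ι ⊕ ι) := ⟨v₀⟩
  choose! v₁ v₂ m₂ hdec hmax1 hmax2 using hex
  have hdeg2 : ∀ m, coeff m P ≠ 0 → ∑ v, m₂ m v = 2 * p := by
    intro m hm
    have hdeg := hP.sum_eq hm
    rw [hdec m hm, sum_add_single, sum_add_single] at hdeg
    omega
  have hmom : ∀ m, coeff m P ≠ 0 →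
      momentum k (m₂ m) + signedFreq k (v₂ m) + signedFreq k (v₁ m) = 0 := by
    intro m hm
    have := hP.mom m hm
    rwa [hdec m hm, momentum_add, momentum_add, momentum_single, momentum_single] at this
  have hterm : ∀ m ∈ P.support, ‖coeff m P‖ * ∏ v, w v ^ m v ≤
      C * (2 * p + 2 : ℝ) ^ s * (f (v₁ m) ^ 2 * G (m₂ m) + f (v₂ m) ^ 2 * G (m₂ m)) := by
    intro m hm
    rw [mem_support_iff] at hm
    exact norm_coeff_mul_prod_le hs hP hw hm (hdec m hm) (hmax1 m hm) (hmax2 m hm)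
  have hGsum : ∑ m ∈ P.support.image m₂, G m ≤ (S * W) ^ p := by
    have h1 := sum_prod_pow_le hg0 (2 * p) (P.support.image m₂) fun m hm => by
      obtain ⟨m', hm', rfl⟩ := Finset.mem_image.1 hm
      exact hdeg2 m' (mem_support_iff.1 hm')
    refine h1.trans ?_
    rw [pow_mul]
    refine pow_le_pow_left₀ (sq_nonneg _) ?_ p
    have h2 : ∑ v, g v = ∑ v, jap (freq k v) ^ ((ν : ℝ) - s) * f v := by
      refine Finset.sum_congr rfl fun v _ => ?_
      simp only [hf, hg]
      rw [← mul_assoc, ← Real.rpow_add (jap_pos _), sub_add_cancel, Real.rpow_natCast]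
    rw [h2]
    refine (Finset.sum_mul_sq_le_sq_mul_sq _ _ _).trans ?_
    rw [hfW]
    refine mul_le_mul_of_nonneg_right (le_trans (le_of_eq ?_) hS) (weightedSq_nonneg _ _ _)
    refine Finset.sum_congr rfl fun v _ => ?_
    rw [← Real.rpow_two, ← Real.rpow_mul (jap_pos _).le, mul_comm]
  have hinj1 : Set.InjOn (fun m => (v₁ m, m₂ m, (v₂ m).isLeft)) P.support := by
    intro a ha b hb hab
    simp only [Prod.mk.injEq] at hab
    have ha' := mem_support_iff.1 (Finset.mem_coe.1 ha)
    have hb' := mem_support_iff.1 (Finset.mem_coe.1 hb)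
    have h3 : signedFreq k (v₂ a) = signedFreq k (v₂ b) := by
      have e1 := hmom a ha'
      have e2 := hmom b hb'
      rw [hab.1, hab.2.1, ← e2] at e1
      exact add_left_cancel (add_right_cancel e1)
    rw [hdec a ha', hdec b hb', hab.1, hab.2.1, signedFreq_injOn hk h3 hab.2.2]
  have hinj2 : Set.InjOn (fun m => (v₂ m, m₂ m, (v₁ m).isLeft)) P.support := by
    intro a ha b hb hab
    simp only [Prod.mk.injEq] at hab
    have ha' := mem_support_iff.1 (Finset.mem_coe.1 ha)
    have hb' := mem_support_iff.1 (Finset.mem_coe.1 hb)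
    have h3 : signedFreq k (v₁ a) = signedFreq k (v₁ b) := by
      have e1 := hmom a ha'
      have e2 := hmom b hb'
      rw [hab.1, hab.2.1, ← e2] at e1
      exact add_left_cancel e1
    rw [hdec a ha', hdec b hb', hab.1, hab.2.1, signedFreq_injOn hk h3 hab.2.2]
  have hs1 := sum_le_two_mul_of_injOn P.support v₁ m₂ (fun m => (v₂ m).isLeft) hinj1
    (f := fun v => f v ^ 2) (fun v => sq_nonneg _) hG0
  have hs2 := sum_le_two_mul_of_injOn P.support v₂ m₂ (fun m => (v₁ m).isLeft) hinj2
    (f := fun v => f v ^ 2) (fun v => sq_nonneg _) hG0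
  rw [hfW] at hs1 hs2
  calc majorant P w
      ≤ ∑ m ∈ P.support, C * (2 * p + 2 : ℝ) ^ s *
          (f (v₁ m) ^ 2 * G (m₂ m) + f (v₂ m) ^ 2 * G (m₂ m)) := Finset.sum_le_sum hterm
    _ = C * (2 * p + 2 : ℝ) ^ s * (∑ m ∈ P.support, f (v₁ m) ^ 2 * G (m₂ m) +
          ∑ m ∈ P.support, f (v₂ m) ^ 2 * G (m₂ m)) := by
        rw [← Finset.mul_sum, Finset.sum_add_distrib]
    _ ≤ C * (2 * p + 2 : ℝ) ^ s * (2 * (W * (S * W) ^ p) + 2 * (W * (S * W) ^ p)) := by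
        refine mul_le_mul_of_nonneg_left (add_le_add (hs1.trans ?_) (hs2.trans ?_))
          (by positivity) <;>
        exact mul_le_mul_of_nonneg_left (mul_le_mul_of_nonneg_left hGsum hW0) zero_le_two
    _ = _ := by rw [mul_pow, pow_succ]; ring

lemma norm_eval_le_majorant (P : Poly ι) (ζ : ι ⊕ ι → ℂ) :
    ‖eval ζ P‖ ≤ majorant P fun v => ‖ζ v‖ := by
  rw [eval_eq', majorant]
  refine (norm_sum_le _ _).trans (le_of_eq (Finset.sum_congr rfl fun m _ => ?_))
  rw [norm_mul, norm_prod]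
  simp only [norm_pow]

omit [Fintype ι] in
lemma finsupp_nat_induction {motive : (ι ⊕ ι →₀ ℕ) → Prop} (h0 : motive 0)
    (h1 : ∀ m u, motive m → motive (m + Finsupp.single u 1)) (m : ι ⊕ ι →₀ ℕ) : motive m := by
  suffices h : ∀ m₀, motive m₀ → motive (m₀ + m) by simpa using h 0 h0
  induction m using Finsupp.induction_linear with
  | zero => intro m₀ h; simpa using h
  | add f g hf hg =>
    intro m₀ h
    rw [← add_assoc]
    exact hg _ (hf _ h)
  | single a b =>
    intro m₀ h
    induction b with
    | zero => simpa using h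
    | succ b ih =>
      rw [Finsupp.single_add, ← add_assoc]
      exact h1 _ _ ih

lemma norm_sum_eval_pderiv_monomial_le (ζ e : ι ⊕ ι → ℂ) (m : ι ⊕ ι →₀ ℕ) :
    ‖∑ v, eval ζ (pderiv v (monomial m (1 : ℂ))) * e v‖ ≤ ∏ v, (‖ζ v‖ + ‖e v‖) ^ m v := by
  classical
  induction m using finsupp_nat_induction with
  | h0 => simp
  | h1 m u ih =>
    have h1 : (monomial (m + Finsupp.single u 1) (1 : ℂ) : Poly ι) = monomial m 1 * X u := by
      rw [X, monomial_mul, mul_one]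
    have h2 : ∑ v, eval ζ (pderiv v (monomial (m + Finsupp.single u 1) (1 : ℂ))) * e v =
        (∑ v, eval ζ (pderiv v (monomial m (1 : ℂ))) * e v) * ζ u +
          eval ζ (monomial m (1 : ℂ)) * e u := by
      simp only [h1, pderiv_mul, map_add, map_mul, eval_X, add_mul, Finset.sum_add_distrib,
        Finset.sum_mul]
      congr 1
      · exact Finset.sum_congr rfl fun v _ => by ring
      · rw [Finset.sum_eq_single u]
        · simp
        · intro v _ hv
          simp [pderiv_X_of_ne hv.symm]
        · simp
    have h3 : ‖eval ζ (monomial m (1 : ℂ))‖ ≤ ∏ v, (‖ζ v‖ + ‖e v‖) ^ m v := by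
      rw [eval_monomial, one_mul, Finsupp.prod_fintype _ _ fun _ => pow_zero _, norm_prod]
      refine Finset.prod_le_prod (fun v _ => norm_nonneg _) fun v _ => ?_
      rw [norm_pow]
      exact pow_le_pow_left₀ (norm_nonneg _) (le_add_of_nonneg_right (norm_nonneg _)) _
    have h4 := prod_pow_add_single (fun v => ‖ζ v‖ + ‖e v‖) m u
    rw [h2, h4, mul_add]
    refine (norm_add_le _ _).trans (add_le_add ?_ ?_)
    · rw [norm_mul]
      exact mul_le_mul_of_nonneg_right ih (norm_nonneg _)
    · rw [norm_mul]
      exact mul_le_mul_of_nonneg_right h3 (norm_nonneg _)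

lemma norm_sum_eval_pderiv_le_majorant (P : Poly ι) (ζ e : ι ⊕ ι → ℂ) :
    ‖∑ v, eval ζ (pderiv v P) * e v‖ ≤ majorant P fun v => ‖ζ v‖ + ‖e v‖ := by
  have h : ∀ v, pderiv v P = ∑ m ∈ P.support, C (coeff m P) * pderiv v (monomial m (1 : ℂ)) := by
    intro v
    conv_lhs => rw [P.as_sum]
    rw [map_sum]
    refine Finset.sum_congr rfl fun m _ => ?_
    rw [← pderiv_C_mul, C_mul_monomial, mul_one]
  have h2 : ∑ v, eval ζ (pderiv v P) * e v = ∑ m ∈ P.support, coeff m P *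
      ∑ v, eval ζ (pderiv v (monomial m (1 : ℂ))) * e v := by
    simp only [h, map_sum, map_mul, eval_C, Finset.sum_mul, Finset.mul_sum]
    rw [Finset.sum_comm]
    exact Finset.sum_congr rfl fun m _ => Finset.sum_congr rfl fun v _ => by ring
  rw [h2, majorant]
  refine (norm_sum_le _ _).trans (Finset.sum_le_sum fun m _ => ?_)
  rw [norm_mul]
  exact mul_le_mul_of_nonneg_left (norm_sum_eval_pderiv_monomial_le ζ e m) (norm_nonneg _)

lemma norm_sum_eval_pderiv_le {k : ι → Fin d → ℤ} (hk : Function.Injective k) {p : ℕ} {s : ℝ}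
    (hs : 0 ≤ s) {ν : ℕ} {C : ℝ} {P : Poly ι} (hP : IsClass k (p + 1) s ν C P) {S : ℝ}
    (hS : ∑ v, jap (freq k v) ^ (2 * (ν - s)) ≤ S) {ζ e : ι ⊕ ι → ℂ} {η ρ : ℝ} (hη : 0 < η)
    (hζ : weightedSq k s (fun v => ‖ζ v‖) ≤ ρ) (he : weightedSq k s (fun v => ‖e v‖) ≤ η ^ 2) :
    ‖∑ v, eval ζ (pderiv v P) * e v‖ ≤
      η * (C * (4 * (2 * p + 2 : ℝ) ^ s) * S ^ p * (2 * ρ + 2) ^ (p + 1)) := by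
  have hS0 : 0 ≤ S := le_trans (Finset.sum_nonneg fun v _ => Real.rpow_nonneg (jap_pos _).le _) hS
  have hC := hP.nonneg
  have h1 := norm_sum_eval_pderiv_le_majorant P ζ fun v => (η : ℂ)⁻¹ * e v
  have h2 : ∑ v, eval ζ (pderiv v P) * e v =
      (η : ℂ) * ∑ v, eval ζ (pderiv v P) * ((η : ℂ)⁻¹ * e v) := by
    rw [Finset.mul_sum]
    refine Finset.sum_congr rfl fun v _ => ?_
    have : (η : ℂ) ≠ 0 := by exact_mod_cast hη.ne'
    field_simp
  rw [h2, norm_mul, Complex.norm_real, Real.norm_of_nonneg hη.le]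
  refine mul_le_mul_of_nonneg_left (h1.trans ((majorant_le hk hs hP hS
    fun v => by positivity).trans ?_)) hη.le
  refine mul_le_mul_of_nonneg_left (pow_le_pow_left₀ (weightedSq_nonneg _ _ _) ?_ _)
    (by positivity)
  calc weightedSq k s (fun v => ‖ζ v‖ + ‖(η : ℂ)⁻¹ * e v‖)
      ≤ ∑ v, (2 * (jap (freq k v) ^ (2 * s) * ‖ζ v‖ ^ 2) +
          2 * (η ^ 2)⁻¹ * (jap (freq k v) ^ (2 * s) * ‖e v‖ ^ 2)) := by
        refine Finset.sum_le_sum fun v _ => ?_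
        have hj : 0 ≤ jap (freq k v) ^ (2 * s) := Real.rpow_nonneg (jap_pos _).le _
        have : (‖ζ v‖ + ‖(η : ℂ)⁻¹ * e v‖) ^ 2 ≤ 2 * ‖ζ v‖ ^ 2 + 2 * (η ^ 2)⁻¹ * ‖e v‖ ^ 2 := by
          have h3 : (η ^ 2)⁻¹ * ‖e v‖ ^ 2 = ‖(η : ℂ)⁻¹ * e v‖ ^ 2 := by
            rw [norm_mul, mul_pow, norm_inv, Complex.norm_real, inv_pow, Real.norm_eq_abs, sq_abs]
          rw [mul_assoc, h3]
          nlinarith [sq_nonneg (‖ζ v‖ - ‖(η : ℂ)⁻¹ * e v‖)]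
        nlinarith
    _ = 2 * weightedSq k s (fun v => ‖ζ v‖) +
          2 * (η ^ 2)⁻¹ * weightedSq k s (fun v => ‖e v‖) := by
        rw [Finset.sum_add_distrib, ← Finset.mul_sum, ← Finset.mul_sum]; rfl
    _ ≤ 2 * ρ + 2 := by
        have : (η ^ 2)⁻¹ * weightedSq k s (fun v => ‖e v‖) ≤ 1 := by
          rw [inv_mul_le_iff₀ (by positivity), mul_one]; exact he
        linarith

lemma hasDerivAt_eval (P : Poly ι) {ζ : ℝ → ι ⊕ ι → ℂ} {ζ' : ι ⊕ ι → ℂ} {t : ℝ}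
    (h : ∀ v, HasDerivAt (fun τ => ζ τ v) (ζ' v) t) :
    HasDerivAt (fun τ => eval (ζ τ) P) (∑ v, eval (ζ t) (pderiv v P) * ζ' v) t := by
  classical
  induction P using MvPolynomial.induction_on with
  | C a => simpa using hasDerivAt_const t a
  | add p q hp hq =>
    have h1 : ∑ v, eval (ζ t) (pderiv v (p + q)) * ζ' v =
        ∑ v, eval (ζ t) (pderiv v p) * ζ' v + ∑ v, eval (ζ t) (pderiv v q) * ζ' v := by
      rw [← Finset.sum_add_distrib]
      exact Finset.sum_congr rfl fun v _ => by rw [map_add, map_add, add_mul]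
    have h2 : (fun τ => eval (ζ τ) (p + q)) = fun τ => eval (ζ τ) p + eval (ζ τ) q :=
      funext fun τ => map_add _ _ _
    rw [h1, h2]
    exact hp.add hq
  | mul_X p u hp =>
    have h2 : (fun τ => eval (ζ τ) (p * X u)) = fun τ => eval (ζ τ) p * ζ τ u :=
      funext fun τ => by rw [map_mul, eval_X]
    have h3 : ∀ v, eval (ζ t) (pderiv v (p * X u)) * ζ' v =
        eval (ζ t) (pderiv v p) * ζ' v * ζ t u +
          eval (ζ t) p * (eval (ζ t) (pderiv v (X u)) * ζ' v) := by
      intro v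
      rw [pderiv_mul, map_add, map_mul, map_mul, eval_X]
      ring
    have h4 : ∑ v, eval (ζ t) (pderiv v (p * X u)) * ζ' v =
        (∑ v, eval (ζ t) (pderiv v p) * ζ' v) * ζ t u + eval (ζ t) p * ζ' u := by
      simp only [h3, Finset.sum_add_distrib, ← Finset.sum_mul, ← Finset.mul_sum]
      congr 2
      rw [Finset.sum_eq_single u]
      · simp
      · intro v _ hv
        rw [pderiv_X_of_ne hv.symm, map_zero, zero_mul]
      · simp
    rw [h2, h4]
    exact hp.mul (h u)

end Evaluation

/-! ### Small divisors: the probabilistic estimate -/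

section Probability

open ProbabilityTheory

/-- The law of the independent coefficients `σ_n`. -/
abbrev sigmaLaw (d : ℕ) : Measure ((Fin d → ℤ) → ℝ) :=
  Measure.infinitePi fun _ : Fin d → ℤ => uniformLaw

lemma uniformLaw_abs_lt_le {c : ℝ} (hc : c ≠ 0) (y δ : ℝ) :
    uniformLaw {x | |c * x + y| < δ} ≤ ENNReal.ofReal (2 * δ / |c|) := by
  have hc' : 0 < |c| := abs_pos.2 hc
  have h : {x | |c * x + y| < δ} ⊆ Metric.ball (-y / c) (δ / |c|) := by
    intro x hx
    rw [Metric.mem_ball, Real.dist_eq, lt_div_iff₀ hc', ← abs_mul]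
    have : (x - -y / c) * c = c * x + y := by field_simp; ring
    rw [this]
    exact hx
  calc uniformLaw {x | |c * x + y| < δ} ≤ volume {x | |c * x + y| < δ} :=
        Measure.restrict_apply_le _ _
    _ ≤ volume (Metric.ball (-y / c) (δ / |c|)) := measure_mono h
    _ = ENNReal.ofReal (2 * δ / |c|) := by rw [Real.volume_ball, mul_div_assoc]

/-- A linear form in the `σ_n` with a nonzero coefficient is rarely small. -/
lemma sigmaLaw_abs_lt_le {d : ℕ} (S : Finset (Fin d → ℤ)) (c : (Fin d → ℤ) → ℝ) {n : Fin d → ℤ}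
    (hn : n ∈ S) (hc : c n ≠ 0) (q δ : ℝ) :
    sigmaLaw d {σ | |∑ i ∈ S, c i * σ i + q| < δ} ≤ ENNReal.ofReal (2 * δ / |c n|) := by
  classical
  set Y : ((Fin d → ℤ) → ℝ) → ℝ := fun σ => ∑ i ∈ S.erase n, c i * σ i with hY
  have hYm : Measurable Y := by fun_prop
  have hind : IndepFun Y (fun σ => c n * σ n) (sigmaLaw d) := by
    have h1 : iIndepFun (fun (i : Fin d → ℤ) (σ : (Fin d → ℤ) → ℝ) => c i * σ i) (sigmaLaw d) :=
      iIndepFun_infinitePi (X := fun i x => c i * x) fun i => by fun_prop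
    have h2 := h1.indepFun_finsetSum_of_notMem (fun i => by fun_prop)
      (s := S.erase n) (i := n) (by simp)
    convert h2 using 1
    funext σ
    simp [hY]
  have hind' : IndepFun (fun σ : (Fin d → ℤ) → ℝ => σ n) Y (sigmaLaw d) := by
    have := (hind.comp measurable_id (measurable_const_mul (c n)⁻¹)).symm
    have hid : (fun σ : (Fin d → ℤ) → ℝ => σ n) =
        (fun x => (c n)⁻¹ * x) ∘ fun σ : (Fin d → ℤ) → ℝ => c n * σ n := by
      funext σ
      simp [hc]
    rw [hid]
    exact this
  have hmap := (indepFun_iff_map_prod_eq_prod_map_map (measurable_pi_apply n).aemeasurable hYm.aemeasurable).1 hind'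
  have hsplit : ∀ σ : (Fin d → ℤ) → ℝ, ∑ i ∈ S, c i * σ i + q = c n * σ n + (Y σ + q) := by
    intro σ
    rw [← Finset.add_sum_erase S _ hn, add_assoc]
  have hA : MeasurableSet {z : ℝ × ℝ | |c n * z.1 + (z.2 + q)| < δ} :=
    measurableSet_lt (by fun_prop) measurable_const
  have hpre : {σ : (Fin d → ℤ) → ℝ | |∑ i ∈ S, c i * σ i + q| < δ} =
      (fun σ => (σ n, Y σ)) ⁻¹' {z : ℝ × ℝ | |c n * z.1 + (z.2 + q)| < δ} := by
    ext σ
    simp [hsplit]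
  have : IsProbabilityMeasure ((sigmaLaw d).map Y) := Measure.isProbabilityMeasure_map hYm.aemeasurable
  rw [hpre, ← Measure.map_apply (by fun_prop) hA, hmap, Measure.infinitePi_map_eval,
    Measure.prod_apply_symm hA]
  calc ∫⁻ y, uniformLaw ((fun x => (x, y)) ⁻¹' {z : ℝ × ℝ | |c n * z.1 + (z.2 + q)| < δ})
        ∂((sigmaLaw d).map Y)
      ≤ ∫⁻ _, ENNReal.ofReal (2 * δ / |c n|) ∂((sigmaLaw d).map Y) :=
        lintegral_mono fun y => uniformLaw_abs_lt_le hc (y + q) δ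
    _ = ENNReal.ofReal (2 * δ / |c n|) := by simp

lemma ae_exists_pos_forall_le {Ω I : Type*} [MeasurableSpace Ω] {μ : Measure Ω} [Countable I]
    (g : I → Ω → ℝ) (δ β : I → ℝ) (hβ0 : ∀ i, 0 ≤ β i) (hβ : Summable β)
    (h : ∀ γ : ℝ, 0 < γ → ∀ i, μ {ω | g i ω < γ * δ i} ≤ ENNReal.ofReal (γ * β i)) :
    ∀ᵐ ω ∂μ, ∃ γ : ℝ, 0 < γ ∧ ∀ i, γ * δ i ≤ g i ω := by
  rw [ae_iff]
  have hbound : ∀ γ : ℝ, 0 < γ → μ {ω | ¬∃ γ : ℝ, 0 < γ ∧ ∀ i, γ * δ i ≤ g i ω} ≤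
      ENNReal.ofReal (γ * ∑' i, β i) := by
    intro γ hγ
    calc μ {ω | ¬∃ γ : ℝ, 0 < γ ∧ ∀ i, γ * δ i ≤ g i ω}
        ≤ μ (⋃ i, {ω | g i ω < γ * δ i}) := by
          refine measure_mono fun ω hω => ?_
          by_contra hcon
          simp only [Set.mem_iUnion, Set.mem_ofPred_eq, not_exists, not_lt] at hcon
          exact hω ⟨γ, hγ, hcon⟩
      _ ≤ ∑' i, μ {ω | g i ω < γ * δ i} := measure_iUnion_le _
      _ ≤ ∑' i, ENNReal.ofReal (γ * β i) := ENNReal.tsum_le_tsum (h γ hγ)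
      _ = ENNReal.ofReal (γ * ∑' i, β i) := by
          rw [← tsum_mul_left, ENNReal.ofReal_tsum_of_nonneg
            (fun i => mul_nonneg hγ.le (hβ0 i)) (hβ.mul_left γ)]
  have hlim : Tendsto (fun γ : ℝ => ENNReal.ofReal (γ * ∑' i, β i)) (𝓝[>] 0) (𝓝 0) := by
    have : Tendsto (fun γ : ℝ => ENNReal.ofReal (γ * ∑' i, β i)) (𝓝 0) (𝓝 (ENNReal.ofReal (0 * ∑' i, β i))) :=
      (ENNReal.continuous_ofReal.comp (continuous_mul_const _)).tendsto 0
    simp only [zero_mul, ENNReal.ofReal_zero] at this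
    exact this.mono_left nhdsWithin_le_nhds
  exact le_antisymm (ge_of_tendsto hlim (by
    filter_upwards [self_mem_nhdsWithin] with γ hγ using hbound γ hγ)) bot_le

lemma one_le_prod_map_jap {d : ℕ} (a : Multiset (Fin d → ℤ)) : 1 ≤ (a.map jap).prod := by
  induction a using Multiset.induction_on with
  | empty => simp
  | cons n a ih =>
    rw [Multiset.map_cons, Multiset.prod_cons]
    exact one_le_mul_of_one_le_of_one_le (one_le_jap n) ih

lemma jap_le_prod_map_jap {d : ℕ} {a : Multiset (Fin d → ℤ)} {n : Fin d → ℤ} (hn : n ∈ a) :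
    jap n ≤ (a.map jap).prod := by
  obtain ⟨a', rfl⟩ := Multiset.exists_cons_of_mem hn
  rw [Multiset.map_cons, Multiset.prod_cons]
  exact le_mul_of_one_le_right (jap_pos n).le (one_le_prod_map_jap a')

lemma measurable_potentialOf (d : ℕ) (R : ℝ) (m : ℕ) : Measurable (potentialOf d R m) := by
  unfold potentialOf
  fun_prop

lemma map_sum_eq_sum {d : ℕ} (a : Multiset (Fin d → ℤ)) {S : Finset (Fin d → ℤ)}
    (hS : a.toFinset ⊆ S) (v : (Fin d → ℤ) → ℝ) :
    (a.map v).sum = ∑ n ∈ S, (a.count n : ℝ) * v n := by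
  rw [Finset.sum_multiset_map_count]
  simp only [nsmul_eq_mul]
  refine Finset.sum_subset hS fun n _ hn => ?_
  rw [Multiset.mem_toFinset, ← Multiset.count_eq_zero] at hn
  simp [hn]

/-- The probability that a given nontrivial combination is small. -/
lemma sigmaLaw_combination_le {d : ℕ} {R : ℝ} (hR : 0 < R) (m : ℕ) {a b : Multiset (Fin d → ℤ)}
    (hab : a ≠ b) (q : ℤ) {δ : ℝ} (hδ : 0 ≤ δ) :
    sigmaLaw d {σ | |(a.map (potentialOf d R m σ)).sum - (b.map (potentialOf d R m σ)).sum + q| < δ}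
      ≤ ENNReal.ofReal (2 * δ * (2 ^ m * ((a.map jap).prod * (b.map jap).prod) ^ m) / R) := by
  classical
  obtain ⟨n, hn⟩ : ∃ n, a.count n ≠ b.count n := by
    by_contra h
    push Not at h
    exact hab (Multiset.ext.2 h)
  set S := a.toFinset ∪ b.toFinset with hS
  have hnS : n ∈ S := by
    rw [hS, Finset.mem_union, Multiset.mem_toFinset, Multiset.mem_toFinset]
    by_contra h
    push Not at h
    exact hn (by rw [Multiset.count_eq_zero.2 h.1, Multiset.count_eq_zero.2 h.2])
  set c : (Fin d → ℤ) → ℝ := fun i =>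
    ((a.count i : ℝ) - b.count i) * (R * ((1 + Real.sqrt (normSq i)) ^ m)⁻¹) with hc
  have hset : ∀ σ, (a.map (potentialOf d R m σ)).sum - (b.map (potentialOf d R m σ)).sum + q =
      ∑ i ∈ S, c i * σ i + (q : ℝ) := by
    intro σ
    rw [map_sum_eq_sum a Finset.subset_union_left, map_sum_eq_sum b Finset.subset_union_right,
      ← Finset.sum_sub_distrib]
    congr 1
    refine Finset.sum_congr rfl fun i _ => ?_
    simp only [hc, potentialOf]
    ring
  have hpos : 0 < 1 + Real.sqrt (normSq n) := by positivity
  have hcount : 1 ≤ |(a.count n : ℝ) - b.count n| := by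
    have : (1 : ℤ) ≤ |(a.count n : ℤ) - b.count n| :=
      Int.one_le_abs (sub_ne_zero.2 (by exact_mod_cast hn))
    exact_mod_cast this
  have hcn : R * ((1 + Real.sqrt (normSq n)) ^ m)⁻¹ ≤ |c n| := by
    simp only [hc]
    rw [abs_mul, abs_of_pos (show 0 < R * ((1 + Real.sqrt (normSq n)) ^ m)⁻¹ by positivity)]
    exact le_mul_of_one_le_left (by positivity) hcount
  have hcn0 : 0 < R * ((1 + Real.sqrt (normSq n)) ^ m)⁻¹ := by positivity
  simp only [hset]
  refine (sigmaLaw_abs_lt_le S c hnS (abs_pos.1 (hcn0.trans_le hcn)) q δ).trans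
    (ENNReal.ofReal_le_ofReal ?_)
  have hjn : jap n ≤ (a.map jap).prod * (b.map jap).prod := by
    rw [hS, Finset.mem_union, Multiset.mem_toFinset, Multiset.mem_toFinset] at hnS
    have h1 := one_le_prod_map_jap a
    have h2 := one_le_prod_map_jap b
    rcases hnS with h | h
    · exact (jap_le_prod_map_jap h).trans (le_mul_of_one_le_right (by linarith) h2)
    · exact (jap_le_prod_map_jap h).trans (le_mul_of_one_le_left (by linarith) h1)
  calc 2 * δ / |c n| ≤ 2 * δ / (R * ((1 + Real.sqrt (normSq n)) ^ m)⁻¹) :=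
        div_le_div_of_nonneg_left (by positivity) hcn0 hcn
    _ = 2 * δ * (1 + Real.sqrt (normSq n)) ^ m / R := by field_simp
    _ ≤ 2 * δ * (2 ^ m * ((a.map jap).prod * (b.map jap).prod) ^ m) / R := by
        rw [← mul_pow]
        refine div_le_div_of_nonneg_right (mul_le_mul_of_nonneg_left (pow_le_pow_left₀ hpos.le ?_ m)
          (by positivity)) hR.le
        exact (one_add_sqrt_le n).trans (mul_le_mul_of_nonneg_left hjn zero_le_two)

/-- The almost sure lower bound for integer combinations of the potential. -/
def IsDiophantine {d : ℕ} (A : ℕ) (v : (Fin d → ℤ) → ℝ) : Prop :=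
  ∀ p : ℕ, ∃ γ : ℝ, 0 < γ ∧ ∀ a b : Multiset (Fin d → ℤ), a.card = p → b.card = p → a ≠ b →
    ∀ q : ℤ, γ * ((1 + (q : ℝ) ^ 2)⁻¹ * (((a.map jap).prod * (b.map jap).prod) ^ A)⁻¹) ≤
      |(a.map v).sum - (b.map v).sum + q|

lemma ae_isDiophantine {d : ℕ} {R : ℝ} (hR : 0 < R) (m : ℕ) :
    ∀ᵐ σ ∂sigmaLaw d, IsDiophantine (2 * d + m) (potentialOf d R m σ) := by
  unfold IsDiophantine
  rw [ae_all_iff]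
  intro p
  set ms : (Fin p → Fin d → ℤ) → Multiset (Fin d → ℤ) := fun t => Finset.univ.val.map t with hms
  set J := (Fin p → Fin d → ℤ) × (Fin p → Fin d → ℤ) × ℤ
  set w : J → ℝ := fun i => ((ms i.1).map jap).prod * ((ms i.2.1).map jap).prod with hw
  set I := {i : J // ms i.1 ≠ ms i.2.1}
  have hw1 : ∀ i, 1 ≤ w i := fun i =>
    one_le_mul_of_one_le_of_one_le (one_le_prod_map_jap _) (one_le_prod_map_jap _)
  set β : J → ℝ := fun i => 2 * 2 ^ m / R * ((1 + (i.2.2 : ℝ) ^ 2)⁻¹ * ((w i) ^ (2 * d))⁻¹) with hβ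
  have hsum : Summable β := by
    refine Summable.mul_left _ ?_
    have h1 : Summable fun t : Fin p → Fin d → ℤ => ∏ i, (jap (t i) ^ (2 * d))⁻¹ :=
      summable_prod_tuple (w := fun _ n => (jap n ^ (2 * d))⁻¹)
        (fun _ n => by have := jap_pos n; positivity) fun _ => summable_jap_inv_pow d
    have h0 : ∀ t : Fin p → Fin d → ℤ, 0 ≤ ∏ i, (jap (t i) ^ (2 * d))⁻¹ := fun t =>
      Finset.prod_nonneg fun i _ => by have := jap_pos (t i); positivity
    have h2 := h1.mul_of_nonneg (h1.mul_of_nonneg summable_int_inv_one_add_sq h0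
      fun q => by positivity) h0 fun z => mul_nonneg (h0 _) (by positivity)
    refine h2.congr fun i => ?_
    have h3 : ∀ t : Fin p → Fin d → ℤ, ((ms t).map jap).prod = ∏ i, jap (t i) := by
      intro t
      rw [hms, Multiset.map_map]
      rfl
    simp only [hw, h3, mul_pow, mul_inv, Finset.prod_inv_distrib, Finset.prod_pow]
    ring
  have hβ0 : ∀ i, 0 ≤ β i := fun i => by have := hw1 i; positivity
  have key := ae_exists_pos_forall_le (μ := sigmaLaw d) (I := I)
    (fun i σ => |((ms i.1.1).map (potentialOf d R m σ)).sum -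
      ((ms i.1.2.1).map (potentialOf d R m σ)).sum + (i.1.2.2 : ℤ)|)
    (fun i => (1 + (i.1.2.2 : ℝ) ^ 2)⁻¹ * ((w i.1) ^ (2 * d + m))⁻¹) (fun i => β i.1)
    (fun i => hβ0 _) (hsum.comp_injective Subtype.val_injective) (by
      intro γ hγ i
      have hwi := hw1 i.1
      refine (sigmaLaw_combination_le hR m i.2 i.1.2.2 (by positivity)).trans
        (ENNReal.ofReal_le_ofReal (le_of_eq ?_))
      simp only [hβ]
      change 2 * (γ * ((1 + (i.1.2.2 : ℝ) ^ 2)⁻¹ * (w i.1 ^ (2 * d + m))⁻¹)) *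
        (2 ^ m * w i.1 ^ m) / R = _
      rw [pow_add, mul_inv]
      field_simp)
  filter_upwards [key] with σ hσ
  obtain ⟨γ, hγ, h⟩ := hσ
  refine ⟨γ, hγ, fun a b ha hb hab q => ?_⟩
  have hrep : ∀ a : Multiset (Fin d → ℤ), a.card = p → ∃ t, ms t = a := by
    intro a ha
    subst ha
    induction a using Quotient.inductionOn with
    | h l =>
      refine ⟨l.get, ?_⟩
      have : (Finset.univ : Finset (Fin l.length)).val.map l.get = (l : Multiset (Fin d → ℤ)) := by
        rw [Fin.univ_val_map, List.ofFn_get]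
      exact this
  obtain ⟨t, rfl⟩ := hrep a ha
  obtain ⟨t', rfl⟩ := hrep b hb
  exact h ⟨(t, t', q), hab⟩

lemma ae_mem_potentialSpace {d : ℕ} {R : ℝ} (hR : 0 < R) (m : ℕ) :
    ∀ᵐ σ ∂sigmaLaw d, potentialOf d R m σ ∈ potentialSpace d R m := by
  have h : ∀ᵐ σ ∂sigmaLaw d, ∀ n, σ n ∈ Set.Icc (-(1 / 2) : ℝ) (1 / 2) := by
    rw [ae_all_iff]
    intro n
    have h1 : ∀ᵐ x ∂uniformLaw, x ∈ Set.Icc (-(1 / 2) : ℝ) (1 / 2) :=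
      ae_restrict_mem measurableSet_Icc
    have h2 := measurePreserving_eval_infinitePi (fun _ : Fin d → ℤ => uniformLaw) n
    exact h2.quasiMeasurePreserving.ae h1
  filter_upwards [h] with σ hσ n
  have hpos : 0 < 1 + Real.sqrt (normSq n) := by positivity
  have : R⁻¹ * potentialOf d R m σ n * (1 + Real.sqrt (normSq n)) ^ m = σ n := by
    unfold potentialOf
    field_simp
  rw [this]
  exact hσ n

lemma measurableSet_potentialSpace (d : ℕ) (R : ℝ) (m : ℕ) :
    MeasurableSet (potentialSpace d R m) := by
  unfold potentialSpace
  rw [measurableSet_setOfPred]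
  refine Measurable.forall fun n => ?_
  rw [← measurableSet_setOfPred]
  exact measurableSet_Icc.preimage (by fun_prop)

lemma isDiophantine_iff {d : ℕ} (A : ℕ) (v : (Fin d → ℤ) → ℝ) :
    IsDiophantine A v ↔ ∀ p : ℕ, ∃ k : ℕ, ∀ a b : Multiset (Fin d → ℤ), a.card = p → b.card = p →
      a ≠ b → ∀ q : ℤ, 1 / ((k : ℝ) + 1) *
        ((1 + (q : ℝ) ^ 2)⁻¹ * (((a.map jap).prod * (b.map jap).prod) ^ A)⁻¹) ≤
      |(a.map v).sum - (b.map v).sum + q| := by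
  refine forall_congr' fun p => ⟨?_, ?_⟩
  · rintro ⟨γ, hγ, h⟩
    obtain ⟨k, hk⟩ := exists_nat_one_div_lt hγ
    refine ⟨k, fun a b ha hb hab q => le_trans ?_ (h a b ha hb hab q)⟩
    have h1 := one_le_prod_map_jap a
    have h2 := one_le_prod_map_jap b
    exact mul_le_mul_of_nonneg_right hk.le (by positivity)
  · rintro ⟨k, h⟩
    exact ⟨1 / ((k : ℝ) + 1), by positivity, h⟩

lemma measurableSet_isDiophantine {d : ℕ} (A : ℕ) :
    MeasurableSet {v : (Fin d → ℤ) → ℝ | IsDiophantine A v} := by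
  have hs : ∀ a : Multiset (Fin d → ℤ), Measurable fun v : (Fin d → ℤ) → ℝ => (a.map v).sum := by
    intro a
    induction a using Multiset.induction_on with
    | empty => simp
    | cons n a ih =>
      simp only [Multiset.map_cons, Multiset.sum_cons]
      exact (measurable_pi_apply n).add ih
  simp only [isDiophantine_iff]
  rw [measurableSet_setOfPred]
  refine Measurable.forall fun p => Measurable.exists fun k => Measurable.forall fun a =>
    Measurable.forall fun b => measurable_const.imp (measurable_const.imp (measurable_const.imp
      (Measurable.forall fun q => ?_)))
  rw [← measurableSet_setOfPred]
  exact measurableSet_le measurable_const (((hs a).sub (hs b)).add_const _).abs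

/-- A measurable set of potentials of full measure with the Diophantine property. -/
theorem exists_full_measure {d : ℕ} {R : ℝ} (hR : 0 < R) (m : ℕ) :
    ∃ 𝒱 : Set ((Fin d → ℤ) → ℝ), 𝒱 ⊆ potentialSpace d R m ∧ MeasurableSet 𝒱 ∧
      potentialLaw d R m 𝒱 = 1 ∧ ∀ v ∈ 𝒱, IsDiophantine (2 * d + m) v := by
  have hm := measurable_potentialOf d R m
  have hP : IsProbabilityMeasure (potentialLaw d R m) :=
    Measure.isProbabilityMeasure_map hm.aemeasurable
  have hmeas := (measurableSet_potentialSpace d R m).inter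
    (measurableSet_isDiophantine (d := d) (2 * d + m))
  refine ⟨potentialSpace d R m ∩ {v | IsDiophantine (2 * d + m) v}, Set.inter_subset_left, hmeas,
    ?_, fun v hv => hv.2⟩
  rw [← prob_compl_eq_zero_iff hmeas]
  rw [potentialLaw, Measure.map_apply hm hmeas.compl]
  change ∀ᵐ σ ∂sigmaLaw d,
    potentialOf d R m σ ∈ potentialSpace d R m ∩ {v | IsDiophantine (2 * d + m) v}
  filter_upwards [ae_isDiophantine hR m, ae_mem_potentialSpace hR m] with σ h1 h2
  exact ⟨h2, h1⟩

end Probability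

/-! ### Small divisors: the deterministic consequence -/

section NonResonance

variable {d : ℕ}

lemma exists_int_sum_normSq (a : Multiset (Fin d → ℤ)) : ∃ q : ℤ, (a.map normSq).sum = q := by
  induction a using Multiset.induction_on with
  | empty => exact ⟨0, by simp⟩
  | cons n a ih =>
    obtain ⟨q, hq⟩ := ih
    refine ⟨∑ j, n j ^ 2 + q, ?_⟩
    rw [Multiset.map_cons, Multiset.sum_cons, hq]
    simp [normSq]

lemma normSq_le_sum {a : Multiset (Fin d → ℤ)} {x : Fin d → ℤ} (hx : x ∈ a) :
    normSq x ≤ (a.map normSq).sum := by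
  refine Multiset.single_le_sum (fun y hy => ?_) _ (Multiset.mem_map_of_mem _ hx)
  obtain ⟨n, _, rfl⟩ := Multiset.mem_map.1 hy
  exact normSq_nonneg n

lemma sum_map_le_card_mul {a : Multiset (Fin d → ℤ)} {f : (Fin d → ℤ) → ℝ} {c : ℝ}
    (h : ∀ n ∈ a, f n ≤ c) : (a.map f).sum ≤ a.card * c := by
  have := Multiset.sum_le_card_nsmul (a.map f) c (by
    intro y hy
    obtain ⟨n, hn, rfl⟩ := Multiset.mem_map.1 hy
    exact h n hn)
  simpa using this

lemma abs_sum_map_le_card_mul {a : Multiset (Fin d → ℤ)} {f : (Fin d → ℤ) → ℝ} {c : ℝ}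
    (h : ∀ n ∈ a, |f n| ≤ c) : |(a.map f).sum| ≤ a.card * c := by
  rw [abs_le]
  constructor
  · have := sum_map_le_card_mul (a := a) (f := fun n => -f n) (c := c)
      fun n hn => (neg_le_abs _).trans (h n hn)
    rw [Multiset.sum_map_neg] at this
    linarith
  · exact sum_map_le_card_mul fun n hn => (le_abs_self _).trans (h n hn)

lemma prod_map_jap_le {a : Multiset (Fin d → ℤ)} {L : ℝ} (h : ∀ n ∈ a, jap n ≤ L) :
    (a.map jap).prod ≤ L ^ a.card := by
  induction a using Multiset.induction_on with
  | empty => simp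
  | cons n a ih =>
    have h1 := h n (Multiset.mem_cons_self n a)
    have h2 := ih fun k hk => h k (Multiset.mem_cons_of_mem hk)
    rw [Multiset.map_cons, Multiset.prod_cons, Multiset.card_cons, pow_succ']
    exact mul_le_mul h1 h2 (by linarith [one_le_prod_map_jap a]) ((jap_pos n).le.trans h1)

lemma exists_mem_lt_jap {a b : Multiset (Fin d → ℤ)} {x : Fin d → ℤ} (hx : x ∈ a) {Q L : ℝ}
    (hQ : 0 ≤ Q) (hL : 1 ≤ L) (hq : (a.map normSq).sum - (b.map normSq).sum ≤ Q)
    (hxL : (1 + Q + b.card) * L < jap x) : ∃ y ∈ b, L < jap y := by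
  by_contra! hcon
  have h1 := normSq_le_sum hx
  have h2 : (b.map normSq).sum ≤ b.card * L ^ 2 := sum_map_le_card_mul fun n hn => by
    have h3 := pow_le_pow_left₀ (jap_pos n).le (hcon n hn) 2
    rw [jap_sq] at h3
    linarith
  have h3 : ((1 + Q + b.card) * L) ^ 2 < jap x ^ 2 := pow_lt_pow_left₀ hxL (by positivity) two_ne_zero
  rw [jap_sq] at h3
  have h4 : (1 : ℝ) ≤ L ^ 2 := one_le_pow₀ hL
  have h5 : (1 + Q + b.card) * L ^ 2 ≤ ((1 + Q + b.card) * L) ^ 2 := by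
    rw [mul_pow]
    refine mul_le_mul_of_nonneg_right (le_self_pow₀ ?_ two_ne_zero) (by positivity)
    have : (0 : ℝ) ≤ b.card := Nat.cast_nonneg _
    linarith
  nlinarith

/-- Lower bound for a combination all of whose frequencies are at most `L`. -/
lemma IsDiophantine.le_of_forall_jap_le {A : ℕ} {v : (Fin d → ℤ) → ℝ} {p : ℕ} {γ Q L : ℝ}
    (hγ : 0 ≤ γ) {a b : Multiset (Fin d → ℤ)} (ha : a.card = p) (hb : b.card = p) {q : ℤ}
    (hq : |(q : ℝ)| ≤ Q)
    (h : γ * ((1 + (q : ℝ) ^ 2)⁻¹ * (((a.map jap).prod * (b.map jap).prod) ^ A)⁻¹) ≤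
      |(a.map v).sum - (b.map v).sum + q|)
    (hL : ∀ n ∈ a + b, jap n ≤ L) :
    γ * ((1 + Q ^ 2)⁻¹ * (L ^ (2 * p * A))⁻¹) ≤ |(a.map v).sum - (b.map v).sum + q| := by
  refine le_trans (mul_le_mul_of_nonneg_left ?_ hγ) h
  have h1 := one_le_prod_map_jap a
  have h2 := one_le_prod_map_jap b
  have h3 := prod_map_jap_le (a := a) (L := L) fun n hn => hL n (Multiset.mem_add.2 (.inl hn))
  have h4 := prod_map_jap_le (a := b) (L := L) fun n hn => hL n (Multiset.mem_add.2 (.inr hn))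
  rw [ha] at h3
  rw [hb] at h4
  have h0 : 0 < (a.map jap).prod * (b.map jap).prod := mul_pos (by linarith) (by linarith)
  have h5 : ((a.map jap).prod * (b.map jap).prod) ^ A ≤ L ^ (2 * p * A) := by
    rw [pow_mul]
    refine pow_le_pow_left₀ h0.le ?_ A
    rw [two_mul, pow_add]
    exact mul_le_mul h3 h4 (by linarith) (by linarith)
  have h6 : (q : ℝ) ^ 2 ≤ Q ^ 2 := by
    rw [← sq_abs]
    exact pow_le_pow_left₀ (abs_nonneg _) hq 2
  refine mul_le_mul (inv_anti₀ (by positivity) (by linarith)) (inv_anti₀ (pow_pos h0 A) h5)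
    (inv_nonneg.2 ((pow_pos h0 A).le.trans h5)) (by positivity)

lemma one_le_abs_normSq_sub {x y : Fin d → ℤ} (h : normSq x ≠ normSq y) :
    1 ≤ |normSq x - normSq y| := by
  obtain ⟨q, hq⟩ := exists_int_sum_normSq {x}
  obtain ⟨q', hq'⟩ := exists_int_sum_normSq {y}
  simp only [Multiset.map_singleton, Multiset.sum_singleton] at hq hq'
  rw [hq, hq'] at h ⊢
  have : (1 : ℤ) ≤ |q - q'| := Int.one_le_abs (sub_ne_zero.2 (by exact_mod_cast h))
  exact_mod_cast this

lemma sum_map_normSq_add (a : Multiset (Fin d → ℤ)) (v : (Fin d → ℤ) → ℝ) :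
    (a.map fun n => normSq n + v n).sum = (a.map normSq).sum + (a.map v).sum :=
  Multiset.sum_map_add

/-- Two large frequencies with opposite signs do not spoil the lower bound. -/
lemma le_abs_of_two_large {A : ℕ} {v : (Fin d → ℤ) → ℝ} {p : ℕ} {γ Q M : ℝ} (hγ : 0 ≤ γ)
    (hdio : ∀ a b : Multiset (Fin d → ℤ), a.card = p → b.card = p → a ≠ b →
      ∀ q : ℤ, γ * ((1 + (q : ℝ) ^ 2)⁻¹ * (((a.map jap).prod * (b.map jap).prod) ^ A)⁻¹) ≤
        |(a.map v).sum - (b.map v).sum + q|)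
    {a b : Multiset (Fin d → ℤ)} (ha : a.card = p) (hb : b.card = p) {x y : Fin d → ℤ}
    (hab : (x ::ₘ a).map normSq ≠ (y ::ₘ b).map normSq) (hM : ∀ n ∈ a + b, jap n ≤ M)
    (hQ : |((x ::ₘ a).map normSq).sum - ((y ::ₘ b).map normSq).sum| ≤ Q) {D : ℝ} (hD1 : D ≤ 1)
    (hD : D ≤ γ * ((1 + Q ^ 2)⁻¹ * (M ^ (2 * p * A))⁻¹)) (hx : |v x| ≤ D / 4) (hy : |v y| ≤ D / 4) :
    D / 2 ≤ |((x ::ₘ a).map fun n => normSq n + v n).sum -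
      ((y ::ₘ b).map fun n => normSq n + v n).sum| := by
  rw [sum_map_normSq_add, sum_map_normSq_add]
  by_cases h : a = b
  · subst h
    have hne : normSq x ≠ normSq y := fun h => hab (by simp [h])
    have h1 := one_le_abs_normSq_sub hne
    simp only [Multiset.map_cons, Multiset.sum_cons]
    have h2 : normSq x - normSq y = (normSq x + (a.map normSq).sum + (v x + (a.map v).sum) -
      (normSq y + (a.map normSq).sum + (v y + (a.map v).sum))) - v x + v y := by ring
    have h3 := abs_add_three (normSq x + (a.map normSq).sum + (v x + (a.map v).sum) -
      (normSq y + (a.map normSq).sum + (v y + (a.map v).sum))) (-v x) (v y)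
    rw [abs_neg, ← sub_eq_add_neg, ← h2] at h3
    linarith
  · obtain ⟨q, hq⟩ := exists_int_sum_normSq (x ::ₘ a)
    obtain ⟨q', hq'⟩ := exists_int_sum_normSq (y ::ₘ b)
    rw [hq, hq'] at hQ ⊢
    have h1 := IsDiophantine.le_of_forall_jap_le hγ ha hb (q := q - q') (by exact_mod_cast hQ)
      (hdio a b ha hb h _) hM
    simp only [Multiset.map_cons, Multiset.sum_cons]
    have h3 := abs_add_three (q + (v x + (a.map v).sum) - (q' + (v y + (b.map v).sum))) (-v x) (v y)
    rw [abs_neg] at h3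
    have h4 : q + (v x + (a.map v).sum) - (q' + (v y + (b.map v).sum)) + -v x + v y =
        (a.map v).sum - (b.map v).sum + ((q - q' : ℤ) : ℝ) := by
      push_cast
      ring
    rw [h4] at h3
    linarith

/-- The small divisor estimate: at most two frequencies are not controlled by `M`. -/
theorem exists_nonresonance {A : ℕ} {v : (Fin d → ℤ) → ℝ} (hv : IsDiophantine A v) {R : ℝ}
    (hR : 0 ≤ R) (hb : ∀ n, |v n| ≤ R / jap n) (p : ℕ) :
    ∃ γ : ℝ, 0 < γ ∧ ∃ α : ℕ, ∀ a b : Multiset (Fin d → ℤ), a.card = p → b.card = p →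
      a.map normSq ≠ b.map normSq → ∀ M : ℝ, 1 ≤ M →
      Multiset.card (Multiset.filter (fun n => M < jap n) (a + b)) ≤ 2 →
      γ * (M ^ α)⁻¹ ≤ |(a.map fun n => normSq n + v n).sum - (b.map fun n => normSq n + v n).sum| := by
  rcases p with _ | p
  · refine ⟨1, one_pos, 0, fun a b ha hb hab => absurd ?_ hab⟩
    rw [Multiset.card_eq_zero.1 ha, Multiset.card_eq_zero.1 hb]
  obtain ⟨γ₁, hγ₁, h₁⟩ := hv (p + 1)
  obtain ⟨γ₀', hγ₀', h₀'⟩ := hv p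
  obtain ⟨γ₀, hγ₀, hγ₀1, h₀⟩ : ∃ γ₀ : ℝ, 0 < γ₀ ∧ γ₀ ≤ 1 ∧
      ∀ a b : Multiset (Fin d → ℤ), a.card = p → b.card = p → a ≠ b →
      ∀ q : ℤ, γ₀ * ((1 + (q : ℝ) ^ 2)⁻¹ * (((a.map jap).prod * (b.map jap).prod) ^ A)⁻¹) ≤
        |(a.map v).sum - (b.map v).sum + q| := by
    refine ⟨min γ₀' 1, lt_min hγ₀' one_pos, min_le_right _ _, fun a b ha hb hab q =>
      le_trans ?_ (h₀' a b ha hb hab q)⟩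
    have := one_le_prod_map_jap a
    have := one_le_prod_map_jap b
    exact mul_le_mul_of_nonneg_right (min_le_left _ _) (by positivity)
  obtain ⟨Q, hQ⟩ : ∃ Q : ℝ, Q = 1 + 2 * (p + 1) * R := ⟨_, rfl⟩
  have hQ0 : 0 ≤ Q := by rw [hQ]; positivity
  obtain ⟨c, hc⟩ : ∃ c : ℝ, c = (4 * R + 1) * (1 + Q ^ 2) / γ₀ := ⟨_, rfl⟩
  have hc1 : 1 ≤ c := by
    rw [hc, le_div_iff₀ hγ₀]
    nlinarith [sq_nonneg Q, mul_nonneg hR (sq_nonneg Q)]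
  obtain ⟨β, hβ⟩ : ∃ β : ℕ, β = 2 * p * A + 1 := ⟨_, rfl⟩
  obtain ⟨c', hc'⟩ : ∃ c' : ℝ, c' = (1 + Q + (p + 1)) * c := ⟨_, rfl⟩
  have hc'c : c ≤ c' := by
    rw [hc']
    refine le_mul_of_one_le_left (by linarith) ?_
    have : (0 : ℝ) ≤ p := Nat.cast_nonneg _
    linarith
  obtain ⟨γ, hγ⟩ : ∃ γ : ℝ, γ = min (min 1 (γ₁ * ((1 + Q ^ 2)⁻¹ * (c' ^ (2 * (p + 1) * A))⁻¹)))
    (γ₀ * (1 + Q ^ 2)⁻¹ / 2) := ⟨_, rfl⟩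
  have hc'0 : 0 < c' := by linarith
  have hγ0 : 0 < γ := by
    rw [hγ]
    refine lt_min (lt_min one_pos ?_) ?_ <;> positivity
  obtain ⟨α, hα⟩ : ∃ α : ℕ, α = β * (2 * (p + 1) * A) + 2 * p * A := ⟨_, rfl⟩
  refine ⟨γ, hγ0, α, ?_⟩
  -- the case of one large frequency, up to symmetry
  have large : ∀ a b : Multiset (Fin d → ℤ), a.card = p + 1 → b.card = p + 1 →
      a.map normSq ≠ b.map normSq → ∀ M : ℝ, 1 ≤ M →
      Multiset.card (Multiset.filter (fun n => M < jap n) (a + b)) ≤ 2 →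
      |(a.map normSq).sum - (b.map normSq).sum| ≤ Q → (∃ x ∈ a, c' * M ^ β < jap x) →
      γ * (M ^ α)⁻¹ ≤
        |(a.map fun n => normSq n + v n).sum - (b.map fun n => normSq n + v n).sum| := by
    rintro a b ha hb' hab M hM hcard hq ⟨x, hxa, hx⟩
    have hMβ : 1 ≤ M ^ β := one_le_pow₀ hM
    obtain ⟨y, hyb, hy⟩ := exists_mem_lt_jap hxa hQ0 (L := c * M ^ β)
      (one_le_mul_of_one_le_of_one_le hc1 hMβ) ((le_abs_self _).trans hq) (by
        rw [hb', ← mul_assoc]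
        push_cast
        rwa [← hc'])
    have hx' : c * M ^ β < jap x :=
      (mul_le_mul_of_nonneg_right hc'c (by positivity)).trans_lt hx
    obtain ⟨a', rfl⟩ := Multiset.exists_cons_of_mem hxa
    obtain ⟨b', rfl⟩ := Multiset.exists_cons_of_mem hyb
    have hMc : M ≤ c * M ^ β := by
      have h1 : M ≤ M ^ β := le_self_pow₀ hM (by omega)
      nlinarith
    have hsmall : ∀ n ∈ a' + b', jap n ≤ M := by
      have h1 : x ::ₘ a' + y ::ₘ b' = x ::ₘ y ::ₘ (a' + b') := by
        rw [Multiset.cons_add, Multiset.add_cons]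
      rw [h1, Multiset.filter_cons_of_pos (p := fun n => M < jap n) _ (hMc.trans_lt hx'),
        Multiset.filter_cons_of_pos (p := fun n => M < jap n) _ (hMc.trans_lt hy), Multiset.card_cons,
        Multiset.card_cons] at hcard
      have h2 : Multiset.filter (fun n => M < jap n) (a' + b') = 0 :=
        Multiset.card_eq_zero.1 (by omega)
      rw [Multiset.filter_eq_nil] at h2
      exact fun n hn => not_lt.1 (h2 n hn)
    have hMp : 1 ≤ M ^ (2 * p * A) := one_le_pow₀ hM
    obtain ⟨D, hD⟩ : ∃ D, D = γ₀ * ((1 + Q ^ 2)⁻¹ * (M ^ (2 * p * A))⁻¹) := ⟨_, rfl⟩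
    have hD0 : 0 < D := by rw [hD]; positivity
    have hD1 : D ≤ 1 := by
      rw [hD]
      refine mul_le_one₀ hγ₀1 (by positivity) (mul_le_one₀ (inv_le_one_of_one_le₀ ?_)
        (by positivity) (inv_le_one_of_one_le₀ hMp))
      nlinarith [sq_nonneg Q]
    have hvx : ∀ x, c * M ^ β < jap x → |v x| ≤ D / 4 := by
      intro x hx
      refine (hb x).trans ?_
      rw [div_le_iff₀ (jap_pos x)]
      have h1 : R ≤ D / 4 * (c * M ^ β) := by
        have h2 : D / 4 * (c * M ^ β) = (R + 1 / 4) * M := by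
          rw [hD, hc, hβ]
          field_simp
          ring
        rw [h2]
        nlinarith
      exact h1.trans (mul_le_mul_of_nonneg_left hx.le (by positivity))
    refine le_trans ?_ (le_abs_of_two_large hγ₀.le h₀ (by simpa using ha) (by simpa using hb') hab
      hsmall hq hD1 hD.le (hvx x hx') (hvx y hy))
    calc γ * (M ^ α)⁻¹ ≤ (γ₀ * (1 + Q ^ 2)⁻¹ / 2) * (M ^ (2 * p * A))⁻¹ := by
          refine mul_le_mul (hγ.le.trans (min_le_right _ _)) (inv_anti₀ (by positivity)
            (pow_le_pow_right₀ hM (by omega))) (by positivity) (by positivity)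
      _ = D / 2 := by rw [hD]; ring
  intro a b ha hb' hab M hM hcard
  have hMβ : 1 ≤ M ^ β := one_le_pow₀ hM
  have hMα : 1 ≤ M ^ α := one_le_pow₀ hM
  rcases le_or_gt 1 |(a.map fun n => normSq n + v n).sum - (b.map fun n => normSq n + v n).sum|
    with h | hlt
  · refine le_trans ?_ h
    have : γ ≤ 1 := hγ.le.trans ((min_le_left _ _).trans (min_le_left _ _))
    exact mul_le_one₀ this (by positivity) (inv_le_one_of_one_le₀ hMα)
  have hvR : ∀ n, |v n| ≤ R := fun n =>
    (hb n).trans (div_le_self hR (one_le_jap n))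
  have hq : |(a.map normSq).sum - (b.map normSq).sum| ≤ Q := by
    have h1 := abs_sum_map_le_card_mul (a := a) fun n _ => hvR n
    have h2 := abs_sum_map_le_card_mul (a := b) fun n _ => hvR n
    rw [ha] at h1
    rw [hb'] at h2
    push_cast at h1 h2
    rw [sum_map_normSq_add, sum_map_normSq_add] at hlt
    rw [abs_le] at h1 h2 ⊢
    rw [abs_lt] at hlt
    constructor <;> rw [hQ] <;> linarith [hlt.1, hlt.2, h1.1, h1.2, h2.1, h2.2]
  by_cases hxa : ∃ x ∈ a, c' * M ^ β < jap x
  · exact large a b ha hb' hab M hM hcard hq hxa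
  by_cases hxb : ∃ x ∈ b, c' * M ^ β < jap x
  · rw [abs_sub_comm]
    exact large b a hb' ha hab.symm M hM (by rwa [add_comm]) (by rwa [abs_sub_comm]) hxb
  push Not at hxa hxb
  have hne : a ≠ b := fun h => hab (by rw [h])
  obtain ⟨q, hq1⟩ := exists_int_sum_normSq a
  obtain ⟨q', hq2⟩ := exists_int_sum_normSq b
  have h1 := IsDiophantine.le_of_forall_jap_le hγ₁.le ha hb' (q := q - q') (L := c' * M ^ β) (Q := Q)
    (by rw [hq1, hq2] at hq; exact_mod_cast hq) (h₁ a b ha hb' hne _) (by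
      intro n hn
      rcases Multiset.mem_add.1 hn with h | h
      exacts [hxa n h, hxb n h])
  rw [sum_map_normSq_add, sum_map_normSq_add, hq1, hq2]
  have h2 : (q : ℝ) + (a.map v).sum - (q' + (b.map v).sum) =
      (a.map v).sum - (b.map v).sum + ((q - q' : ℤ) : ℝ) := by
    push_cast
    ring
  rw [h2]
  refine le_trans ?_ h1
  rw [mul_pow, mul_inv, ← mul_assoc ((1 + Q ^ 2)⁻¹), ← mul_assoc]
  refine mul_le_mul (hγ.le.trans ((min_le_left _ _).trans (min_le_right _ _))) (inv_anti₀
    (by positivity) ?_) (by positivity) (by positivity)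
  rw [← pow_mul]
  exact pow_le_pow_right₀ hM (by omega)

lemma map_sum_smul_singleton {ι N : Type*} [Fintype ι] [AddCommMonoid N] (k : ι → Fin d → ℤ)
    (c : ι → ℕ) (φ : Multiset (Fin d → ℤ) →+ N) :
    φ (∑ x, c x • {k x}) = ∑ x, c x • φ {k x} := by
  simp

/-- The small divisor estimate for the frequencies `|n|² + v_n` on a finite set. -/
theorem exists_smallDivisors {A : ℕ} {v : (Fin d → ℤ) → ℝ} (hv : IsDiophantine A v) {R : ℝ}
    (hR : 0 ≤ R) (hb : ∀ n, |v n| ≤ R / jap n) :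
    ∃ (γ : ℕ → ℝ) (α : ℕ → ℕ), (∀ p, 0 < γ p) ∧ ∀ (ι : Type) [Fintype ι] (k : ι → Fin d → ℤ),
      SmallDivisors γ α k fun x => normSq (k x) + v (k x) := by
  classical
  choose γ hγ α h using exists_nonresonance hv hR hb
  refine ⟨γ, α, hγ, fun ι _ k p m hl hr hres M hM hcard => ?_⟩
  have hcd : ∀ c : ι → ℕ, (∑ x, c x • ({k x} : Multiset (Fin d → ℤ))).card = ∑ x, c x := by
    intro c
    simp
  have hsum : ∀ (c : ι → ℕ) (f : (Fin d → ℤ) → ℝ),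
      ((∑ x, c x • ({k x} : Multiset (Fin d → ℤ))).map f).sum = ∑ x, (c x : ℝ) * f (k x) := by
    intro c f
    have := map_sum_smul_singleton k c
      ((Multiset.sumAddMonoidHom (M := ℝ)).comp (Multiset.mapAddMonoidHom f))
    refine this.trans (Finset.sum_congr rfl fun x _ => ?_)
    simp
  have hcnt : ∀ (c : ι → ℕ) (κ : ℝ),
      ((∑ x, c x • ({k x} : Multiset (Fin d → ℤ))).map normSq).count κ =
        ∑ x with normSq (k x) = κ, c x := by
    intro c κ
    have := map_sum_smul_singleton k c
      ((Multiset.countAddMonoidHom κ).comp (Multiset.mapAddMonoidHom normSq))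
    rw [Finset.sum_filter]
    refine this.trans (Finset.sum_congr rfl fun x _ => ?_)
    simp [Multiset.count_singleton, eq_comm]
  have hflt : ∀ c : ι → ℕ, ((∑ x, c x • ({k x} : Multiset (Fin d → ℤ))).filter
      fun n => M < jap n).card = ∑ x, if M < jap (k x) then c x else 0 := by
    intro c
    have := map_sum_smul_singleton k c (Multiset.countPAddMonoidHom fun n => M < jap n)
    rw [← Multiset.countP_eq_card_filter]
    refine this.trans (Finset.sum_congr rfl fun x _ => ?_)
    simp [← Multiset.cons_zero, Multiset.countP_cons]
  have key := h p (∑ x, m (Sum.inl x) • {k x}) (∑ x, m (Sum.inr x) • {k x})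
    (by rw [hcd, hl]) (by rw [hcd, hr]) (by
      intro heq
      refine hres fun κ => ?_
      have := congrArg (Multiset.count κ) heq
      rw [hcnt, hcnt] at this
      convert this) M hM (by
      rw [Multiset.filter_add, Multiset.card_add, hflt, hflt]
      refine le_trans (le_of_eq ?_) hcard
      rw [highCount, Fintype.sum_sum_type]
      congr 1)
  rw [hsum, hsum, ← Finset.sum_sub_distrib] at key
  refine key.trans (le_of_eq ?_)
  rw [divisor]
  congr 1
  exact Finset.sum_congr rfl fun x _ => by ring

end NonResonance

/-! ### The Sobolev space in Fourier variables -/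

section SobolevSpace

variable {d : ℕ}

/-- The space `H^s` in the variables `⟨n⟩^s û(n)`. -/
abbrev Hs (d : ℕ) : Type := lp (fun _ : Fin d → ℤ => ℂ) 2

lemma memℓp_two_of_summable {f : (Fin d → ℤ) → ℂ} (h : Summable fun n => ‖f n‖ ^ 2) :
    Memℓp f 2 := memℓp_gen (by simpa using h)

lemma Hs.summable_sq (x : Hs d) : Summable fun n => ‖x n‖ ^ 2 := by
  simpa using (lp.memℓp x).summable (by simp)

lemma Hs.norm_sq (x : Hs d) : ‖x‖ ^ 2 = ∑' n, ‖x n‖ ^ 2 := by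
  have := lp.norm_rpow_eq_tsum (p := 2) (by simp) x
  simpa using this

lemma Hs.norm_le_of_tsum_sq_le {x : Hs d} {c : ℝ} (hc : 0 ≤ c) (h : ∑' n, ‖x n‖ ^ 2 ≤ c ^ 2) :
    ‖x‖ ≤ c := by
  rw [← Hs.norm_sq] at h
  exact (sq_le_sq₀ (norm_nonneg x) hc).1 h

/-- The multiplier with symbol `a`, a contraction. -/
def multiplier (a : (Fin d → ℤ) → ℂ) (ha : ∀ n, ‖a n‖ ≤ 1) : Hs d →L[ℂ] Hs d :=
  LinearMap.mkContinuous
    { toFun := fun x => ⟨fun n => a n * x n, memℓp_two_of_summable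
        (x.summable_sq.of_nonneg_of_le (fun n => by positivity) fun n => by
          rw [norm_mul]
          exact pow_le_pow_left₀ (by positivity) (mul_le_of_le_one_left (norm_nonneg _) (ha n)) 2)⟩
      map_add' := fun x y => by
        ext n
        exact mul_add (a n) (x n) (y n)
      map_smul' := fun c x => by
        ext n
        exact mul_left_comm (a n) c (x n) } 1 fun x => by
    rw [one_mul]
    refine Hs.norm_le_of_tsum_sq_le (norm_nonneg x) ?_
    rw [Hs.norm_sq]
    have h : ∀ n, ‖a n * x n‖ ^ 2 ≤ ‖x n‖ ^ 2 := fun n => by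
      rw [norm_mul]
      exact pow_le_pow_left₀ (by positivity) (mul_le_of_le_one_left (norm_nonneg _) (ha n)) 2
    exact Summable.tsum_le_tsum h
      (x.summable_sq.of_nonneg_of_le (fun n => by positivity) h) x.summable_sq

@[simp]
lemma multiplier_apply (a : (Fin d → ℤ) → ℂ) (ha : ∀ n, ‖a n‖ ≤ 1) (x : Hs d) (n : Fin d → ℤ) :
    multiplier a ha x n = a n * x n := rfl

lemma norm_multiplier_le (a : (Fin d → ℤ) → ℂ) (ha : ∀ n, ‖a n‖ ≤ 1) (x : Hs d) :
    ‖multiplier a ha x‖ ≤ ‖x‖ := by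
  have := (multiplier a ha).le_of_opNorm_le (LinearMap.mkContinuous_norm_le _ zero_le_one _) x
  rwa [one_mul] at this

/-- Reflection and conjugation of the coefficients, corresponding to `u ↦ ū`. -/
def conjRefl (x : Hs d) : Hs d :=
  ⟨fun n => (starRingEnd ℂ) (x (-n)), memℓp_two_of_summable (by
    simpa [Function.comp_def] using (Equiv.neg (Fin d → ℤ)).summable_iff.2 x.summable_sq)⟩

@[simp]
lemma conjRefl_apply (x : Hs d) (n : Fin d → ℤ) : conjRefl x n = (starRingEnd ℂ) (x (-n)) := rfl

lemma conjRefl_sub (x y : Hs d) : conjRefl (x - y) = conjRefl x - conjRefl y := by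
  ext n
  simp

lemma norm_conjRefl (x : Hs d) : ‖conjRefl x‖ = ‖x‖ := by
  have h : ‖conjRefl x‖ ^ 2 = ‖x‖ ^ 2 := by
    rw [Hs.norm_sq, Hs.norm_sq, ← (Equiv.neg (Fin d → ℤ)).tsum_eq fun n => ‖x n‖ ^ 2]
    simp
  exact (sq_eq_sq₀ (norm_nonneg _) (norm_nonneg _)).1 h

lemma summable_mul_and_tsum_sq_le {I : Type*} {f g : I → ℝ} (hf0 : ∀ i, 0 ≤ f i) (hg0 : ∀ i, 0 ≤ g i)
    (hf : Summable fun i => f i ^ 2) (hg : Summable fun i => g i ^ 2) :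
    (Summable fun i => f i * g i) ∧
      (∑' i, f i * g i) ^ 2 ≤ (∑' i, f i ^ 2) * ∑' i, g i ^ 2 := by
  have h := Real.summable_and_inner_le_Lp_mul_Lq_tsum_of_nonneg (p := 2) (q := 2)
    Real.HolderConjugate.two_two hf0 hg0 (by simpa using hf) (by simpa using hg)
  refine ⟨h.1, ?_⟩
  have h2 := pow_le_pow_left₀ (tsum_nonneg fun i => mul_nonneg (hf0 i) (hg0 i)) h.2 2
  refine h2.trans (le_of_eq ?_)
  rw [mul_pow, ← Real.sqrt_eq_rpow, ← Real.sqrt_eq_rpow]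
  simp only [Real.rpow_two]
  rw [Real.sq_sqrt (tsum_nonneg fun i => sq_nonneg _), Real.sq_sqrt (tsum_nonneg fun i => sq_nonneg _)]

/-- The weight of the product in the variables `⟨n⟩^s û(n)`. -/
def convWeight (s : ℝ) (n k : Fin d → ℤ) : ℝ := jap n ^ s * (jap k ^ (-s) * jap (n - k) ^ (-s))

lemma convWeight_nonneg (s : ℝ) (n k : Fin d → ℤ) : 0 ≤ convWeight s n k := by
  have := jap_pos n
  have := jap_pos k
  have := jap_pos (n - k)
  unfold convWeight
  positivity

lemma convWeight_sq_le {s : ℝ} (hs : 0 ≤ s) (n k : Fin d → ℤ) :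
    convWeight s n k ^ 2 ≤ 2 ^ (2 * s) * (jap k ^ (-(2 * s)) + jap (n - k) ^ (-(2 * s))) := by
  have hn := jap_pos n
  have hk := jap_pos k
  have hl := jap_pos (n - k)
  have h1 : jap n ^ (2 * s) ≤ 2 ^ (2 * s) * (jap k ^ (2 * s) + jap (n - k) ^ (2 * s)) := by
    have h2 : jap n ≤ 2 * max (jap k) (jap (n - k)) := by
      have := jap_add_le k (n - k)
      rw [add_sub_cancel] at this
      have := le_max_left (jap k) (jap (n - k))
      have := le_max_right (jap k) (jap (n - k))
      linarith
    refine (Real.rpow_le_rpow hn.le h2 (by positivity)).trans ?_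
    rw [Real.mul_rpow zero_le_two (le_max_of_le_left hk.le)]
    refine mul_le_mul_of_nonneg_left ?_ (by positivity)
    rcases max_choice (jap k) (jap (n - k)) with h | h <;> rw [h]
    · exact le_add_of_nonneg_right (by positivity)
    · exact le_add_of_nonneg_left (by positivity)
  have hsq : ∀ {y : ℝ} (t : ℝ), 0 < y → (y ^ t) ^ 2 = y ^ (2 * t) := fun t hy => by
    rw [← Real.rpow_natCast, ← Real.rpow_mul hy.le, mul_comm]
    norm_num
  have hinv : ∀ {y : ℝ}, 0 < y → y ^ (2 * s) * y ^ (2 * -s) = 1 := fun hy => by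
    rw [← Real.rpow_add hy]
    simp
  rw [convWeight, mul_pow, mul_pow, hsq s hn, hsq (-s) hk, hsq (-s) hl]
  calc jap n ^ (2 * s) * (jap k ^ (2 * -s) * jap (n - k) ^ (2 * -s))
      ≤ 2 ^ (2 * s) * (jap k ^ (2 * s) + jap (n - k) ^ (2 * s)) *
        (jap k ^ (2 * -s) * jap (n - k) ^ (2 * -s)) :=
        mul_le_mul_of_nonneg_right h1 (by positivity)
    _ = 2 ^ (2 * s) * ((jap k ^ (2 * s) * jap k ^ (2 * -s)) * jap (n - k) ^ (2 * -s) +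
        (jap (n - k) ^ (2 * s) * jap (n - k) ^ (2 * -s)) * jap k ^ (2 * -s)) := by ring
    _ = _ := by
        rw [hinv hk, hinv hl, mul_neg]
        ring

/-- The square of the norm of the product. -/
def convConst (d : ℕ) (s : ℝ) : ℝ :=
  2 ^ (2 * s) * (2 * ∑' n : Fin d → ℤ, jap n ^ (-(2 * s)))

lemma convConst_nonneg (d : ℕ) (s : ℝ) : 0 ≤ convConst d s := by
  unfold convConst
  have : 0 ≤ ∑' n : Fin d → ℤ, jap n ^ (-(2 * s)) := tsum_nonneg fun n => by
    have := jap_pos n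
    positivity
  positivity

lemma convWeight_sq_summable {s : ℝ} (hs : (d : ℝ) ≤ s) (n : Fin d → ℤ) :
    (Summable fun k => convWeight s n k ^ 2) ∧ ∑' k, convWeight s n k ^ 2 ≤ convConst d s := by
  have hs0 : 0 ≤ s := (Nat.cast_nonneg d).trans hs
  have h1 : Summable fun k : Fin d → ℤ => jap k ^ (-(2 * s)) := summable_jap_rpow (by linarith)
  have h2 : Summable fun k : Fin d → ℤ => jap (n - k) ^ (-(2 * s)) :=
    (Equiv.subLeft n).summable_iff.2 h1
  have h3 := (h1.add h2).mul_left (2 ^ (2 * s))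
  have h4 : Summable fun k => convWeight s n k ^ 2 :=
    h3.of_nonneg_of_le (fun k => sq_nonneg _) (convWeight_sq_le hs0 n)
  refine ⟨h4, (Summable.tsum_le_tsum (convWeight_sq_le hs0 n) h4 h3).trans (le_of_eq ?_)⟩
  have h5 : ∑' k, jap (n - k) ^ (-(2 * s)) = ∑' k : Fin d → ℤ, jap k ^ (-(2 * s)) :=
    (Equiv.subLeft n).tsum_eq fun k : Fin d → ℤ => jap k ^ (-(2 * s))
  rw [tsum_mul_left, h1.tsum_add h2, convConst, h5]
  ring

lemma summable_sq_mul_sq (x y : Hs d) :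
    (Summable fun q : (Fin d → ℤ) × (Fin d → ℤ) => (‖x q.2‖ * ‖y (q.1 - q.2)‖) ^ 2) ∧
      ∑' q : (Fin d → ℤ) × (Fin d → ℤ), (‖x q.2‖ * ‖y (q.1 - q.2)‖) ^ 2 = ‖x‖ ^ 2 * ‖y‖ ^ 2 := by
  let e : (Fin d → ℤ) × (Fin d → ℤ) ≃ (Fin d → ℤ) × (Fin d → ℤ) :=
    { toFun := fun q => (q.2, q.1 - q.2)
      invFun := fun q => (q.1 + q.2, q.1)
      left_inv := fun q => by simp
      right_inv := fun q => by simp }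
  have h0 : Summable fun q : (Fin d → ℤ) × (Fin d → ℤ) => ‖x q.1‖ ^ 2 * ‖y q.2‖ ^ 2 :=
    x.summable_sq.mul_of_nonneg y.summable_sq (fun n => sq_nonneg _) fun n => sq_nonneg _
  have hfun : (fun q : (Fin d → ℤ) × (Fin d → ℤ) => (‖x q.2‖ * ‖y (q.1 - q.2)‖) ^ 2) =
      (fun q : (Fin d → ℤ) × (Fin d → ℤ) => ‖x q.1‖ ^ 2 * ‖y q.2‖ ^ 2) ∘ e := by
    funext q
    exact mul_pow _ _ 2
  rw [hfun]
  refine ⟨e.summable_iff.2 h0, ?_⟩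
  rw [Hs.norm_sq, Hs.norm_sq, x.summable_sq.tsum_mul_tsum y.summable_sq h0]
  exact e.tsum_eq fun q : (Fin d → ℤ) × (Fin d → ℤ) => ‖x q.1‖ ^ 2 * ‖y q.2‖ ^ 2

/-- The coefficients of the product. -/
def convCoeff (s : ℝ) (x y : (Fin d → ℤ) → ℂ) (n : Fin d → ℤ) : ℂ :=
  ∑' k, (convWeight s n k : ℂ) * (x k * y (n - k))

lemma summable_convCoeff {s : ℝ} (hs : (d : ℝ) ≤ s) (x y : Hs d) (n : Fin d → ℤ) :
    (Summable fun k => (convWeight s n k : ℂ) * (x k * y (n - k))) ∧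
      ‖convCoeff s x y n‖ ^ 2 ≤ convConst d s * ∑' k, (‖x k‖ * ‖y (n - k)‖) ^ 2 := by
  have hw := convWeight_sq_summable hs n
  have h1 := (summable_sq_mul_sq x y).1.prod_factor n
  have h2 := summable_mul_and_tsum_sq_le (convWeight_nonneg s n)
    (fun k => mul_nonneg (norm_nonneg (x k)) (norm_nonneg (y (n - k)))) hw.1 h1
  have hnorm : ∀ k, ‖(convWeight s n k : ℂ) * (x k * y (n - k))‖ =
      convWeight s n k * (‖x k‖ * ‖y (n - k)‖) := fun k => by
    rw [norm_mul, norm_mul, Complex.norm_real, Real.norm_of_nonneg (convWeight_nonneg s n k)]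
  have h3 : Summable fun k => ‖(convWeight s n k : ℂ) * (x k * y (n - k))‖ := by
    simpa only [hnorm] using h2.1
  refine ⟨h3.of_norm, ?_⟩
  have h4 := norm_tsum_le_tsum_norm h3
  simp only [hnorm] at h4
  refine (pow_le_pow_left₀ (norm_nonneg _) h4 2).trans (h2.2.trans ?_)
  exact mul_le_mul_of_nonneg_right hw.2 (tsum_nonneg fun k => sq_nonneg _)

lemma summable_convCoeff_sq {s : ℝ} (hs : (d : ℝ) ≤ s) (x y : Hs d) :
    (Summable fun n => ‖convCoeff s x y n‖ ^ 2) ∧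
      ∑' n, ‖convCoeff s x y n‖ ^ 2 ≤ convConst d s * (‖x‖ ^ 2 * ‖y‖ ^ 2) := by
  have h := summable_sq_mul_sq x y
  have h1 := h.1.prod.mul_left (convConst d s)
  have h2 := fun n => (summable_convCoeff hs x y n).2
  have h3 : Summable fun n => ‖convCoeff s x y n‖ ^ 2 :=
    h1.of_nonneg_of_le (fun n => sq_nonneg _) h2
  refine ⟨h3, (Summable.tsum_le_tsum h2 h3 h1).trans (le_of_eq ?_)⟩
  rw [tsum_mul_left, ← h.2, h.1.tsum_prod]

/-- The product of `H^s` as a continuous bilinear map. -/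
def conv (s : ℝ) (hs : (d : ℝ) ≤ s) : Hs d →L[ℂ] Hs d →L[ℂ] Hs d :=
  LinearMap.mkContinuous₂
    (LinearMap.mk₂ ℂ
      (fun x y => (⟨convCoeff s x y, memℓp_two_of_summable (summable_convCoeff_sq hs x y).1⟩ : Hs d))
      (fun x x' y => by
        ext n
        change convCoeff s (⇑(x + x')) y n = convCoeff s x y n + convCoeff s x' y n
        unfold convCoeff
        rw [← (summable_convCoeff hs x y n).1.tsum_add (summable_convCoeff hs x' y n).1]
        refine tsum_congr fun k => ?_
        rw [lp.coeFn_add, Pi.add_apply]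
        ring)
      (fun c x y => by
        ext n
        change convCoeff s (⇑(c • x)) y n = c * convCoeff s x y n
        unfold convCoeff
        rw [← tsum_mul_left]
        refine tsum_congr fun k => ?_
        rw [lp.coeFn_smul, Pi.smul_apply, smul_eq_mul]
        ring)
      (fun x y y' => by
        ext n
        change convCoeff s x (⇑(y + y')) n = convCoeff s x y n + convCoeff s x y' n
        unfold convCoeff
        rw [← (summable_convCoeff hs x y n).1.tsum_add (summable_convCoeff hs x y' n).1]
        refine tsum_congr fun k => ?_
        rw [lp.coeFn_add, Pi.add_apply]
        ring)
      (fun c x y => by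
        ext n
        change convCoeff s x (⇑(c • y)) n = c * convCoeff s x y n
        unfold convCoeff
        rw [← tsum_mul_left]
        refine tsum_congr fun k => ?_
        rw [lp.coeFn_smul, Pi.smul_apply, smul_eq_mul]
        ring))
    (Real.sqrt (convConst d s)) fun x y => by
      refine Hs.norm_le_of_tsum_sq_le (by positivity) ?_
      rw [mul_pow, mul_pow, Real.sq_sqrt (convConst_nonneg d s), mul_assoc]
      exact (summable_convCoeff_sq hs x y).2

lemma conv_apply {s : ℝ} (hs : (d : ℝ) ≤ s) (x y : Hs d) (n : Fin d → ℤ) :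
    conv s hs x y n = convCoeff s x y n := rfl

lemma norm_conv_le {s : ℝ} (hs : (d : ℝ) ≤ s) (x y : Hs d) :
    ‖conv s hs x y‖ ≤ Real.sqrt (convConst d s) * ‖x‖ * ‖y‖ :=
  (conv s hs).le_of_opNorm₂_le_of_le (LinearMap.mkContinuous₂_norm_le _ (Real.sqrt_nonneg _) _)
    le_rfl le_rfl

/-- The cubic nonlinearity `|u|²u`. -/
def cubic (s : ℝ) (hs : (d : ℝ) ≤ s) (x : Hs d) : Hs d := conv s hs (conv s hs x x) (conjRefl x)

lemma norm_cubic_le {s : ℝ} (hs : (d : ℝ) ≤ s) (x : Hs d) :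
    ‖cubic s hs x‖ ≤ convConst d s * ‖x‖ ^ 3 := by
  have h0 := Real.sq_sqrt (convConst_nonneg d s)
  have h1 := norm_conv_le hs (conv s hs x x) (conjRefl x)
  have h2 := norm_conv_le hs x x
  rw [norm_conjRefl] at h1
  refine h1.trans ?_
  calc Real.sqrt (convConst d s) * ‖conv s hs x x‖ * ‖x‖
      ≤ Real.sqrt (convConst d s) * (Real.sqrt (convConst d s) * ‖x‖ * ‖x‖) * ‖x‖ := by gcongr
    _ = Real.sqrt (convConst d s) ^ 2 * ‖x‖ ^ 3 := by ring
    _ = _ := by rw [h0]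

lemma norm_cubic_sub_le {s : ℝ} (hs : (d : ℝ) ≤ s) {ρ : ℝ} {x y : Hs d} (hx : ‖x‖ ≤ ρ)
    (hy : ‖y‖ ≤ ρ) :
    ‖cubic s hs x - cubic s hs y‖ ≤ 3 * convConst d s * ρ ^ 2 * ‖x - y‖ := by
  have h0 := Real.sq_sqrt (convConst_nonneg d s)
  have hρ : 0 ≤ ρ := (norm_nonneg x).trans hx
  have hsplit : cubic s hs x - cubic s hs y =
      conv s hs (conv s hs (x - y) x) (conjRefl x) + conv s hs (conv s hs y (x - y)) (conjRefl x) +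
        conv s hs (conv s hs y y) (conjRefl (x - y)) := by
    simp only [cubic, conjRefl_sub, map_sub, sub_apply]
    abel
  have hb : ∀ a b c : Hs d, ‖conv s hs (conv s hs a b) (conjRefl c)‖ ≤
      convConst d s * ‖a‖ * ‖b‖ * ‖c‖ := by
    intro a b c
    have h1 := norm_conv_le hs (conv s hs a b) (conjRefl c)
    have h2 := norm_conv_le hs a b
    rw [norm_conjRefl] at h1
    refine h1.trans ?_
    calc Real.sqrt (convConst d s) * ‖conv s hs a b‖ * ‖c‖
        ≤ Real.sqrt (convConst d s) * (Real.sqrt (convConst d s) * ‖a‖ * ‖b‖) * ‖c‖ := by gcongr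
      _ = Real.sqrt (convConst d s) ^ 2 * ‖a‖ * ‖b‖ * ‖c‖ := by ring
      _ = _ := by rw [h0]
  have hC := convConst_nonneg d s
  rw [hsplit]
  refine (norm_add₃_le).trans ?_
  have h1 : ‖conv s hs (conv s hs (x - y) x) (conjRefl x)‖ ≤ convConst d s * ρ ^ 2 * ‖x - y‖ :=
    (hb _ _ _).trans (by
      calc convConst d s * ‖x - y‖ * ‖x‖ * ‖x‖ ≤ convConst d s * ‖x - y‖ * ρ * ρ := by gcongr
        _ = _ := by ring)
  have h2 : ‖conv s hs (conv s hs y (x - y)) (conjRefl x)‖ ≤ convConst d s * ρ ^ 2 * ‖x - y‖ :=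
    (hb _ _ _).trans (by
      calc convConst d s * ‖y‖ * ‖x - y‖ * ‖x‖ ≤ convConst d s * ρ * ‖x - y‖ * ρ := by gcongr
        _ = _ := by ring)
  have h3 : ‖conv s hs (conv s hs y y) (conjRefl (x - y))‖ ≤ convConst d s * ρ ^ 2 * ‖x - y‖ :=
    (hb _ _ _).trans (by
      calc convConst d s * ‖y‖ * ‖y‖ * ‖x - y‖ ≤ convConst d s * ρ * ρ * ‖x - y‖ := by gcongr
        _ = _ := by ring)
  linarith

end SobolevSpace

/-! ### The equation in the interaction picture -/

section RadialRetraction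

variable {E : Type*} [NormedAddCommGroup E] [NormedSpace ℝ E]

/-- The radial retraction onto the closed ball of radius `ρ`. -/
def radialRetraction (ρ : ℝ) (x : E) : E := (max 1 (‖x‖ / ρ))⁻¹ • x

lemma radialRetraction_of_norm_le {ρ : ℝ} (hρ : 0 < ρ) {x : E} (hx : ‖x‖ ≤ ρ) :
    radialRetraction ρ x = x := by
  rw [radialRetraction, max_eq_left ((div_le_one hρ).2 hx), inv_one, one_smul]

lemma norm_radialRetraction_le {ρ : ℝ} (hρ : 0 < ρ) (x : E) : ‖radialRetraction ρ x‖ ≤ ρ := by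
  have h : 0 < max 1 (‖x‖ / ρ) := lt_max_of_lt_left one_pos
  rw [radialRetraction, norm_smul, norm_inv, Real.norm_of_nonneg h.le, inv_mul_le_iff₀ h]
  calc ‖x‖ = ‖x‖ / ρ * ρ := by field_simp
    _ ≤ max 1 (‖x‖ / ρ) * ρ := by
        gcongr
        exact le_max_right _ _

lemma norm_radialRetraction_sub_le {ρ : ℝ} (hρ : 0 < ρ) (x y : E) :
    ‖radialRetraction ρ x - radialRetraction ρ y‖ ≤ 2 * ‖x - y‖ := by
  have hα : 1 ≤ max 1 (‖x‖ / ρ) := le_max_left _ _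
  have hβ : 1 ≤ max 1 (‖y‖ / ρ) := le_max_left _ _
  have hd : |max 1 (‖y‖ / ρ) - max 1 (‖x‖ / ρ)| ≤ ‖x - y‖ / ρ := by
    refine (abs_max_sub_max_le_max _ _ _ _).trans ?_
    rw [sub_self, abs_zero, max_eq_right (abs_nonneg _), ← sub_div, abs_div, abs_of_pos hρ,
      norm_sub_rev]
    gcongr
    exact abs_norm_sub_norm_le y x
  have hy := norm_radialRetraction_le hρ y
  rw [radialRetraction] at hy
  simp only [radialRetraction]
  generalize max 1 (‖x‖ / ρ) = α at *
  generalize max 1 (‖y‖ / ρ) = β at *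
  have hα0 : 0 < α := by linarith
  have hβ0 : 0 < β := by linarith
  have hsplit : α⁻¹ • x - β⁻¹ • y = α⁻¹ • (x - y) + (α⁻¹ * (β - α)) • (β⁻¹ • y) := by
    have h1 : α⁻¹ * (β - α) * β⁻¹ = α⁻¹ - β⁻¹ := by field_simp
    rw [smul_smul, h1, smul_sub, sub_smul]
    abel
  rw [hsplit]
  have hinv : α⁻¹ ≤ 1 := inv_le_one_of_one_le₀ hα
  have h1 : ‖α⁻¹ • (x - y)‖ ≤ ‖x - y‖ := by
    rw [norm_smul, norm_inv, Real.norm_of_nonneg hα0.le]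
    exact mul_le_of_le_one_left (norm_nonneg _) hinv
  have h2 : ‖(α⁻¹ * (β - α)) • (β⁻¹ • y)‖ ≤ ‖x - y‖ := by
    rw [norm_smul, norm_mul, norm_inv, Real.norm_of_nonneg hα0.le, Real.norm_eq_abs]
    calc α⁻¹ * |β - α| * ‖β⁻¹ • y‖ ≤ 1 * (‖x - y‖ / ρ) * ρ := by gcongr
      _ = ‖x - y‖ := by field_simp
  calc _ ≤ _ := norm_add_le _ _
    _ ≤ _ := by linarith

end RadialRetraction

section InteractionPicture

variable {d : ℕ}

/-- The unitary group `e^{itω}` on coefficients. -/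
def rot (ω : (Fin d → ℤ) → ℝ) (t : ℝ) : Hs d →L[ℂ] Hs d :=
  multiplier (fun n => Complex.exp ((t * ω n : ℝ) * Complex.I)) fun _ =>
    (Complex.norm_exp_ofReal_mul_I _).le

lemma rot_apply (ω : (Fin d → ℤ) → ℝ) (t : ℝ) (x : Hs d) (n : Fin d → ℤ) :
    rot ω t x n = Complex.exp ((t * ω n : ℝ) * Complex.I) * x n := rfl

lemma norm_rot_apply (ω : (Fin d → ℤ) → ℝ) (t : ℝ) (x : Hs d) (n : Fin d → ℤ) :
    ‖rot ω t x n‖ = ‖x n‖ := by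
  rw [rot_apply, norm_mul, Complex.norm_exp_ofReal_mul_I, one_mul]

lemma norm_rot (ω : (Fin d → ℤ) → ℝ) (t : ℝ) (x : Hs d) : ‖rot ω t x‖ = ‖x‖ := by
  have : ‖rot ω t x‖ ^ 2 = ‖x‖ ^ 2 := by simp only [Hs.norm_sq, norm_rot_apply]
  exact (sq_eq_sq₀ (norm_nonneg _) (norm_nonneg _)).1 this

lemma rot_rot (ω : (Fin d → ℤ) → ℝ) (t t' : ℝ) (x : Hs d) :
    rot ω t (rot ω t' x) = rot ω (t + t') x := by
  ext n
  rw [rot_apply, rot_apply, rot_apply, ← mul_assoc, ← Complex.exp_add]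
  congr 2
  push_cast
  ring

lemma rot_zero (ω : (Fin d → ℤ) → ℝ) (x : Hs d) : rot ω 0 x = x := by
  ext n
  simp [rot_apply]

lemma tendsto_rot (ω : (Fin d → ℤ) → ℝ) (t₀ : ℝ) (x : Hs d) :
    Tendsto (fun t => rot ω t x) (𝓝 t₀) (𝓝 (rot ω t₀ x)) := by
  rw [tendsto_iff_norm_sub_tendsto_zero]
  have h : Tendsto (fun t => ∑' n, ‖(rot ω t x - rot ω t₀ x) n‖ ^ 2) (𝓝 t₀)
      (𝓝 (∑' _ : Fin d → ℤ, (0 : ℝ))) := by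
    refine tendsto_tsum_of_dominated_convergence (bound := fun n => 4 * ‖x n‖ ^ 2)
      (x.summable_sq.mul_left 4) (fun n => ?_) (Eventually.of_forall fun t n => ?_)
    · have hc : Continuous fun t : ℝ => ‖(rot ω t x - rot ω t₀ x) n‖ ^ 2 := by
        simp only [lp.coeFn_sub, Pi.sub_apply, rot_apply]
        fun_prop
      have := hc.tendsto t₀
      simpa using this
    · rw [Real.norm_of_nonneg (sq_nonneg _), lp.coeFn_sub, Pi.sub_apply]
      have h1 := norm_sub_le (rot ω t x n) (rot ω t₀ x n)
      rw [norm_rot_apply, norm_rot_apply, ← two_mul] at h1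
      calc _ ≤ (2 * ‖x n‖) ^ 2 := pow_le_pow_left₀ (norm_nonneg _) h1 2
        _ = _ := by ring
  simp only [← Hs.norm_sq, tsum_zero] at h
  have h2 := h.sqrt
  simpa [Real.sqrt_sq] using h2

lemma continuous_rot (ω : (Fin d → ℤ) → ℝ) : Continuous fun q : ℝ × Hs d => rot ω q.1 q.2 := by
  rw [continuous_iff_continuousAt]
  rintro ⟨t₀, x₀⟩
  rw [ContinuousAt, tendsto_iff_norm_sub_tendsto_zero]
  have h1 : Tendsto (fun q : ℝ × Hs d => ‖q.2 - x₀‖ + ‖rot ω q.1 x₀ - rot ω t₀ x₀‖) (𝓝 (t₀, x₀))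
      (𝓝 (0 + 0)) := by
    refine Tendsto.add ?_ ?_
    · exact (tendsto_iff_norm_sub_tendsto_zero.1 (continuous_snd.tendsto (t₀, x₀)))
    · exact (tendsto_iff_norm_sub_tendsto_zero.1 (tendsto_rot ω t₀ x₀)).comp
        (continuous_fst.tendsto (t₀, x₀))
  rw [add_zero] at h1
  refine squeeze_zero (fun q => norm_nonneg _) (fun q => ?_) h1
  have h2 : rot ω q.1 q.2 - rot ω t₀ x₀ =
      rot ω q.1 (q.2 - x₀) + (rot ω q.1 x₀ - rot ω t₀ x₀) := by
    rw [map_sub]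
    abel
  rw [h2, ← norm_rot ω q.1 (q.2 - x₀)]
  exact norm_add_le _ _

/-- The vector field of the equation in the interaction picture. -/
def field (ω : (Fin d → ℤ) → ℝ) (s : ℝ) (hs : (d : ℝ) ≤ s) (t : ℝ) (y : Hs d) : Hs d :=
  (-Complex.I) • rot ω t (cubic s hs (rot ω (-t) y))

lemma norm_field_le (ω : (Fin d → ℤ) → ℝ) {s : ℝ} (hs : (d : ℝ) ≤ s) (t : ℝ) (y : Hs d) :
    ‖field ω s hs t y‖ ≤ convConst d s * ‖y‖ ^ 3 := by
  have := norm_cubic_le hs (rot ω (-t) y)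
  rw [norm_rot] at this
  rw [field, norm_smul, norm_neg, Complex.norm_I, one_mul, norm_rot]
  exact this

lemma norm_field_sub_le (ω : (Fin d → ℤ) → ℝ) {s : ℝ} (hs : (d : ℝ) ≤ s) (t : ℝ) {ρ : ℝ}
    {x y : Hs d} (hx : ‖x‖ ≤ ρ) (hy : ‖y‖ ≤ ρ) :
    ‖field ω s hs t x - field ω s hs t y‖ ≤ 3 * convConst d s * ρ ^ 2 * ‖x - y‖ := by
  have := norm_cubic_sub_le hs (x := rot ω (-t) x) (y := rot ω (-t) y) (ρ := ρ)
    (by rwa [norm_rot]) (by rwa [norm_rot])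
  rw [← map_sub, norm_rot] at this
  rw [field, field, ← smul_sub, ← map_sub, norm_smul, norm_neg, Complex.norm_I, one_mul, norm_rot]
  exact this

lemma continuous_conjRefl : Continuous (conjRefl : Hs d → Hs d) :=
  continuous_iff_continuousAt.2 fun x => by
    rw [ContinuousAt, tendsto_iff_norm_sub_tendsto_zero]
    simp only [← conjRefl_sub, norm_conjRefl]
    exact tendsto_iff_norm_sub_tendsto_zero.1 tendsto_id

lemma continuous_cubic {s : ℝ} (hs : (d : ℝ) ≤ s) : Continuous (cubic (d := d) s hs) :=
  ((conv s hs).continuous.comp (((conv s hs).continuous).clm_apply continuous_id)).clm_apply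
    continuous_conjRefl

lemma continuous_field (ω : (Fin d → ℤ) → ℝ) {s : ℝ} (hs : (d : ℝ) ≤ s) :
    Continuous fun q : ℝ × Hs d => field ω s hs q.1 q.2 := by
  have h1 : Continuous fun q : ℝ × Hs d => rot ω (-q.1) q.2 :=
    (continuous_rot ω).comp (continuous_fst.neg.prodMk continuous_snd)
  exact ((continuous_rot ω).comp
    (continuous_fst.prodMk ((continuous_cubic hs).comp h1))).const_smul (-Complex.I)

/-- Global solutions of the equation with the nonlinearity cut off outside a ball. -/
theorem exists_cutoff_solution (ω : (Fin d → ℤ) → ℝ) {s : ℝ} (hs : (d : ℝ) ≤ s) {ρ T : ℝ}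
    (hρ : 0 < ρ) (hT : 0 ≤ T) (y₀ : Hs d) :
    ∃ y : ℝ → Hs d, y 0 = y₀ ∧ ∀ t ∈ Set.Icc (-T) T,
      HasDerivWithinAt y (field ω s hs t (radialRetraction ρ (y t))) (Set.Icc (-T) T) t := by
  have hC := convConst_nonneg d s
  have hL : 0 ≤ convConst d s * ρ ^ 3 := by positivity
  have hPL : IsPicardLindelof (fun t y => field ω s hs t (radialRetraction ρ y))
      (tmin := -T) (tmax := T) ⟨0, by constructor <;> linarith⟩ y₀
      (NNReal.mk (convConst d s * ρ ^ 3 * T) (by positivity)) 0 (NNReal.mk (convConst d s * ρ ^ 3) hL)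
      (NNReal.mk (3 * convConst d s * ρ ^ 2 * 2) (by positivity)) := by
    refine ⟨fun t _ => LipschitzOnWith.of_dist_le_mul fun x _ y _ => ?_, fun x _ => ?_,
      fun t _ x _ => ?_, ?_⟩
    · rw [dist_eq_norm, dist_eq_norm]
      refine (norm_field_sub_le ω hs t (norm_radialRetraction_le hρ x)
        (norm_radialRetraction_le hρ y)).trans ?_
      rw [NNReal.coe_mk, mul_assoc _ 2]
      exact mul_le_mul_of_nonneg_left (norm_radialRetraction_sub_le hρ x y) (by positivity)
    · exact ((continuous_field ω hs).comp (continuous_id.prodMk continuous_const)).continuousOn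
    · refine (norm_field_le ω hs t _).trans ?_
      exact mul_le_mul_of_nonneg_left
        (pow_le_pow_left₀ (norm_nonneg _) (norm_radialRetraction_le hρ x) 3) hC
    · simp
  exact hPL.exists_eq_forall_mem_Icc_hasDerivWithinAt₀

end InteractionPicture

section Truncation

variable {d : ℕ}

/-- The projection to the frequencies in `Λ`. -/
def proj (Λ : Finset (Fin d → ℤ)) : Hs d →L[ℂ] Hs d :=
  open Classical in multiplier (fun n => if n ∈ Λ then 1 else 0) fun n => by split_ifs <;> simp

lemma proj_apply_of_mem {Λ : Finset (Fin d → ℤ)} {n : Fin d → ℤ} (hn : n ∈ Λ) (x : Hs d) :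
    proj Λ x n = x n := by
  simp [proj, hn]

lemma proj_apply_of_notMem {Λ : Finset (Fin d → ℤ)} {n : Fin d → ℤ} (hn : n ∉ Λ) (x : Hs d) :
    proj Λ x n = 0 := by
  simp [proj, hn]

lemma norm_proj_le (Λ : Finset (Fin d → ℤ)) (x : Hs d) : ‖proj Λ x‖ ≤ ‖x‖ :=
  norm_multiplier_le _ _ x

lemma norm_proj_sq (Λ : Finset (Fin d → ℤ)) (x : Hs d) : ‖proj Λ x‖ ^ 2 = ∑ n ∈ Λ, ‖x n‖ ^ 2 := by
  rw [Hs.norm_sq, tsum_eq_sum (s := Λ) fun n hn => by simp [proj_apply_of_notMem hn]]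
  exact Finset.sum_congr rfl fun n hn => by rw [proj_apply_of_mem hn]

lemma proj_rot (Λ : Finset (Fin d → ℤ)) (ω : (Fin d → ℤ) → ℝ) (t : ℝ) (x : Hs d) :
    proj Λ (rot ω t x) = rot ω t (proj Λ x) := by
  ext n
  exact mul_left_comm _ _ _

lemma proj_eq_sum (Λ : Finset (Fin d → ℤ)) (x : Hs d) :
    proj Λ x = ∑ n ∈ Λ, lp.single 2 n (x n) := by
  classical
  ext n
  rw [lp.coeFn_sum, Finset.sum_apply]
  by_cases hn : n ∈ Λ
  · rw [proj_apply_of_mem hn, Finset.sum_eq_single_of_mem n hn]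
    · simp
    · intro k _ hk
      rw [lp.single_apply_ne _ _ _ hk.symm]
  · rw [proj_apply_of_notMem hn, Finset.sum_eq_zero]
    intro k hk
    rw [lp.single_apply_ne]
    rintro rfl
    exact hn hk

lemma norm_sub_proj_sq (Λ : Finset (Fin d → ℤ)) (x : Hs d) :
    ‖x‖ ^ 2 = ∑ n ∈ Λ, ‖x n‖ ^ 2 + ‖x - proj Λ x‖ ^ 2 := by
  have h := lp.norm_compl_sum_single (p := 2) (by simp) x Λ
  rw [← proj_eq_sum] at h
  simp only [ENNReal.toReal_ofNat, Real.rpow_two] at h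
  rw [h]
  ring

/-- Truncation converges uniformly on compact sets. -/
lemma exists_norm_sub_proj_le {K : Set (Hs d)} (hK : IsCompact K) {η : ℝ} (hη : 0 < η) :
    ∃ Λ : Finset (Fin d → ℤ), ∀ x ∈ K, ‖x - proj Λ x‖ ≤ η := by
  classical
  have h1 : ∀ x : Hs d, ∃ Λ : Finset (Fin d → ℤ), ∀ Λ', Λ ⊆ Λ' → ‖x - proj Λ' x‖ < η / 3 := by
    intro x
    have h2 := lp.hasSum_single ENNReal.ofNat_ne_top x
    rw [HasSum, SummationFilter.unconditional_filter, Metric.tendsto_atTop] at h2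
    obtain ⟨Λ, hΛ⟩ := h2 (η / 3) (by positivity)
    refine ⟨Λ, fun Λ' h => ?_⟩
    have := hΛ Λ' h
    rwa [dist_comm, dist_eq_norm, ← proj_eq_sum] at this
  choose L hL using h1
  obtain ⟨t, -, ht⟩ := hK.elim_nhds_subcover (fun x => Metric.ball x (η / 3))
    fun x _ => Metric.ball_mem_nhds x (by positivity)
  refine ⟨t.biUnion L, fun x hx => ?_⟩
  obtain ⟨c, hc, hxc⟩ := Set.mem_iUnion₂.1 (ht hx)
  have h3 := hL c (t.biUnion L) (Finset.subset_biUnion_of_mem L hc)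
  rw [Metric.mem_ball, dist_eq_norm] at hxc
  have h4 := norm_proj_le (t.biUnion L) (x - c)
  have h5 : x - proj (t.biUnion L) x =
      (x - c) + (c - proj (t.biUnion L) c) - proj (t.biUnion L) (x - c) := by
    rw [map_sub]
    abel
  rw [h5]
  refine (norm_sub_le _ _).trans ?_
  have := norm_add_le (x - c) (c - proj (t.biUnion L) c)
  linarith

end Truncation

/-! ### The quartic part of the Hamiltonian -/

section Quartic

open MvPolynomial

variable {d : ℕ} {ι : Type*} [Fintype ι]

/-- The polynomial `½ ∫ |u|⁴` restricted to finitely many modes. -/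
def quartic (k : ι → Fin d → ℤ) : Poly ι :=
  C (1 / 2) * ∑ a, ∑ b, ∑ c, ∑ e, if k a + k b = k c + k e then
    X (Sum.inl a) * X (Sum.inl b) * (X (Sum.inr c) * X (Sum.inr e)) else 0

omit [Fintype ι] in
lemma C_half_mul_add_self (P : Poly ι) : C (1 / 2) * (P + P) = P := by
  rw [← two_smul ℂ P, C_mul', smul_smul]
  norm_num

lemma pderiv_inr_quartic (k : ι → Fin d → ℤ) (x : ι) :
    pderiv (Sum.inr x) (quartic k) = ∑ a, ∑ b, ∑ c, if k a + k b = k c + k x then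
      X (Sum.inl a) * X (Sum.inl b) * X (Sum.inr c) else 0 := by
  classical
  have h : ∀ a b c e : ι, pderiv (Sum.inr x) (if k a + k b = k c + k e then
      X (Sum.inl a) * X (Sum.inl b) * (X (Sum.inr c) * X (Sum.inr e)) else (0 : Poly ι)) =
      (if c = x then (if k a + k b = k c + k e then
        X (Sum.inl a) * X (Sum.inl b) * X (Sum.inr e) else 0) else 0) +
      if e = x then (if k a + k b = k c + k e then
        X (Sum.inl a) * X (Sum.inl b) * X (Sum.inr c) else 0) else 0 := by
    intro a b c e
    by_cases hk : k a + k b = k c + k e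
    · simp only [hk, if_true, Derivation.leibniz, pderiv_X, Pi.single_apply, smul_eq_mul, reduceCtorEq,
        if_false, Sum.inr.injEq, mul_zero, add_zero]
      split_ifs <;> ring
    · simp [hk]
  rw [quartic, pderiv_C_mul]
  simp only [map_sum, h, Finset.sum_add_distrib, Finset.sum_ite_irrel, Finset.sum_const_zero,
    Finset.sum_ite_eq', Finset.mem_univ, if_true]
  have hx : ∀ a b e : ι, (k a + k b = k x + k e) = (k a + k b = k e + k x) := fun a b e => by
    rw [add_comm (k x)]
  simp only [hx]
  rw [C_half_mul_add_self]

lemma pderiv_inl_quartic (k : ι → Fin d → ℤ) (x : ι) :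
    pderiv (Sum.inl x) (quartic k) = ∑ a, ∑ b, ∑ c, if k a + k b = k c + k x then
      X (Sum.inr a) * X (Sum.inr b) * X (Sum.inl c) else 0 := by
  classical
  have hswap : quartic k = C (1 / 2) * ∑ c, ∑ e, ∑ a, ∑ b, if k a + k b = k c + k e then
      X (Sum.inl a) * X (Sum.inl b) * (X (Sum.inr c) * X (Sum.inr e)) else 0 := by
    rw [quartic]
    congr 1
    calc _ = ∑ a, ∑ c, ∑ e, ∑ b, if k a + k b = k c + k e then
          X (Sum.inl a) * X (Sum.inl b) * (X (Sum.inr c) * X (Sum.inr e)) else (0 : Poly ι) := by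
          refine Finset.sum_congr rfl fun a _ => ?_
          rw [Finset.sum_comm]
          exact Finset.sum_congr rfl fun c _ => Finset.sum_comm
      _ = _ := by
          rw [Finset.sum_comm]
          exact Finset.sum_congr rfl fun c _ => Finset.sum_comm
  have h : ∀ c e a b : ι, pderiv (Sum.inl x) (if k a + k b = k c + k e then
      X (Sum.inl a) * X (Sum.inl b) * (X (Sum.inr c) * X (Sum.inr e)) else (0 : Poly ι)) =
      (if a = x then (if k a + k b = k c + k e then
        X (Sum.inr c) * X (Sum.inr e) * X (Sum.inl b) else 0) else 0) +
      if b = x then (if k a + k b = k c + k e then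
        X (Sum.inr c) * X (Sum.inr e) * X (Sum.inl a) else 0) else 0 := by
    intro c e a b
    by_cases hk : k a + k b = k c + k e
    · simp only [hk, if_true, Derivation.leibniz, pderiv_X, Pi.single_apply, smul_eq_mul, reduceCtorEq,
        if_false, Sum.inl.injEq, mul_zero, add_zero, zero_add]
      split_ifs <;> ring
    · simp [hk]
  rw [hswap, pderiv_C_mul]
  simp only [map_sum, h, Finset.sum_add_distrib, Finset.sum_ite_irrel, Finset.sum_const_zero,
    Finset.sum_ite_eq', Finset.mem_univ, if_true]
  have hx : ∀ c e b : ι, (k x + k b = k c + k e) = (k c + k e = k b + k x) := fun c e b => by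
    rw [add_comm (k x)]
    exact propext eq_comm
  have hx' : ∀ c e b : ι, (k b + k x = k c + k e) = (k c + k e = k b + k x) := fun c e b =>
    propext eq_comm
  simp only [hx, hx']
  rw [C_half_mul_add_self]

/-- The exponent of `u_a u_b ū_c ū_e`. -/
def quarticExponent (q : ι × ι × ι × ι) : ι ⊕ ι →₀ ℕ :=
  Finsupp.single (Sum.inl q.1) 1 + Finsupp.single (Sum.inl q.2.1) 1 +
    (Finsupp.single (Sum.inr q.2.2.1) 1 + Finsupp.single (Sum.inr q.2.2.2) 1)

omit [Fintype ι] in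
lemma monomial_quarticExponent (q : ι × ι × ι × ι) : (monomial (quarticExponent q) 1 : Poly ι) =
    X (Sum.inl q.1) * X (Sum.inl q.2.1) * (X (Sum.inr q.2.2.1) * X (Sum.inr q.2.2.2)) := by
  simp only [X, monomial_mul, quarticExponent, one_mul]

open Classical in
lemma coeff_quartic (k : ι → Fin d → ℤ) (m : ι ⊕ ι →₀ ℕ) :
    coeff m (quartic k) = 1 / 2 * ((Finset.univ.filter fun q : ι × ι × ι × ι =>
      k q.1 + k q.2.1 = k q.2.2.1 + k q.2.2.2 ∧ quarticExponent q = m).card : ℂ) := by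
  have h : quartic k = C (1 / 2) * ∑ q : ι × ι × ι × ι,
      if k q.1 + k q.2.1 = k q.2.2.1 + k q.2.2.2 then
        X (Sum.inl q.1) * X (Sum.inl q.2.1) * (X (Sum.inr q.2.2.1) * X (Sum.inr q.2.2.2)) else 0 := by
    rw [quartic, Fintype.sum_prod_type]
    simp only [Fintype.sum_prod_type]
  simp only [← monomial_quarticExponent] at h
  rw [h, coeff_C_mul, coeff_sum, Finset.card_filter, Nat.cast_sum]
  congr 1
  refine Finset.sum_congr rfl fun q _ => ?_
  by_cases h1 : k q.1 + k q.2.1 = k q.2.2.1 + k q.2.2.2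
  · rw [if_pos h1, coeff_monomial]
    by_cases h2 : quarticExponent q = m
    · rw [if_pos h2, if_pos ⟨h1, h2⟩, Nat.cast_one]
    · rw [if_neg h2, if_neg fun h => h2 h.2, Nat.cast_zero]
  · rw [if_neg h1, if_neg fun h => h1 h.1, coeff_zero, Nat.cast_zero]

omit [Fintype ι] in
lemma mem_support_quarticExponent (q : ι × ι × ι × ι) :
    Sum.inl q.1 ∈ (quarticExponent q).support ∧ Sum.inl q.2.1 ∈ (quarticExponent q).support ∧
      Sum.inr q.2.2.1 ∈ (quarticExponent q).support ∧
      Sum.inr q.2.2.2 ∈ (quarticExponent q).support := by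
  classical
  simp only [quarticExponent, Finsupp.mem_support_iff, Finsupp.add_apply, Finsupp.single_eq_same]
  refine ⟨?_, ?_, ?_, ?_⟩ <;> omega

lemma sum_quarticExponent (q : ι × ι × ι × ι) :
    ∑ x, quarticExponent q (Sum.inl x) = 2 ∧ ∑ x, quarticExponent q (Sum.inr x) = 2 := by
  classical
  simp [quarticExponent, Finsupp.single_apply, Finset.sum_add_distrib]

lemma isClass_quartic (k : ι → Fin d → ℤ) : IsClass k 2 0 0 128 (quartic k) := by
  classical
  have hex : ∀ m, coeff m (quartic k) ≠ 0 → ∃ q : ι × ι × ι × ι,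
      k q.1 + k q.2.1 = k q.2.2.1 + k q.2.2.2 ∧ quarticExponent q = m := by
    intro m hm
    rw [coeff_quartic] at hm
    by_contra hcon
    push Not at hcon
    refine hm ?_
    rw [Finset.card_eq_zero.2, Nat.cast_zero, mul_zero]
    exact Finset.filter_eq_empty_iff.2 fun q _ h => hcon q h.1 h.2
  refine ⟨fun m hm => ?_, fun m hm => ?_, fun m hm => ?_, by norm_num, fun m K M hK hM _ _ => ?_⟩
  · obtain ⟨q, -, rfl⟩ := hex m hm
    exact (sum_quarticExponent q).1
  · obtain ⟨q, -, rfl⟩ := hex m hm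
    exact (sum_quarticExponent q).2
  · obtain ⟨q, hq, rfl⟩ := hex m hm
    simp only [quarticExponent, momentum_add, momentum_single, signedFreq, Sum.elim_inl,
      Sum.elim_inr, Pi.neg_apply, hq]
    abel
  · simp only [mul_zero, Real.rpow_zero, mul_one, pow_zero]
    by_cases hm : coeff m (quartic k) = 0
    · rw [hm, norm_zero]
      norm_num
    obtain ⟨q₀, -, hq₀⟩ := hex m hm
    have hsupp : m.support.card ≤ 4 := by
      calc m.support.card ≤ ∑ v ∈ m.support, m v := by
            rw [Finset.card_eq_sum_ones]
            exact Finset.sum_le_sum fun v hv => Nat.one_le_iff_ne_zero.2 (Finsupp.mem_support_iff.1 hv)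
        _ ≤ ∑ v, m v := Finset.sum_le_sum_of_subset (Finset.subset_univ _)
        _ = 4 := by
            have h1 := sum_quarticExponent q₀
            rw [hq₀] at h1
            rw [Fintype.sum_sum_type, h1.1, h1.2]
    have hcard : (Finset.univ.filter fun q : ι × ι × ι × ι =>
        k q.1 + k q.2.1 = k q.2.2.1 + k q.2.2.2 ∧ quarticExponent q = m).card ≤ 256 := by
      calc _ ≤ (m.support ×ˢ m.support ×ˢ m.support ×ˢ m.support).card := by
            refine Finset.card_le_card_of_injOn
              (fun q => (Sum.inl q.1, Sum.inl q.2.1, Sum.inr q.2.2.1, Sum.inr q.2.2.2)) ?_ ?_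
            · intro q hq
              have hq' := (Finset.mem_filter.1 hq).2.2
              have h1 := mem_support_quarticExponent q
              rw [hq'] at h1
              simp only [Finset.coe_product, Set.mem_prod, Finset.mem_coe]
              exact h1
            · rintro ⟨a, b, c, e⟩ - ⟨a', b', c', e'⟩ - h
              simpa using h
        _ = m.support.card * (m.support.card * (m.support.card * m.support.card)) := by
            simp only [Finset.card_product]
        _ ≤ 4 * (4 * (4 * 4)) := by gcongr
        _ = 256 := by norm_num
    rw [coeff_quartic, norm_mul, Complex.norm_natCast]
    have : ((Finset.univ.filter fun q : ι × ι × ι × ι =>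
        k q.1 + k q.2.1 = k q.2.2.1 + k q.2.2.2 ∧ quarticExponent q = m).card : ℝ) ≤ 256 := by
      exact_mod_cast hcard
    norm_num
    linarith

/-- The cubic nonlinearity on finitely many modes. -/
def finiteCubic (k : ι → Fin d → ℤ) (z : ι → ℂ) (x : ι) : ℂ :=
  ∑ a, ∑ b, ∑ c, if k a + k b = k c + k x then z a * z b * (starRingEnd ℂ) (z c) else 0

/-- The point of phase space with coordinates `z`. -/
def phasePoint (z : ι → ℂ) : ι ⊕ ι → ℂ := Sum.elim z fun x => (starRingEnd ℂ) (z x)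

lemma eval_pderiv_inr_quartic (k : ι → Fin d → ℤ) (z : ι → ℂ) (x : ι) :
    eval (phasePoint z) (pderiv (Sum.inr x) (quartic k)) = finiteCubic k z x := by
  rw [pderiv_inr_quartic, finiteCubic]
  simp only [map_sum]
  refine Finset.sum_congr rfl fun a _ => Finset.sum_congr rfl fun b _ =>
    Finset.sum_congr rfl fun c _ => ?_
  split_ifs <;> simp [phasePoint]

lemma eval_pderiv_inl_quartic (k : ι → Fin d → ℤ) (z : ι → ℂ) (x : ι) :
    eval (phasePoint z) (pderiv (Sum.inl x) (quartic k)) =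
      (starRingEnd ℂ) (finiteCubic k z x) := by
  rw [pderiv_inl_quartic, finiteCubic]
  simp only [map_sum]
  refine Finset.sum_congr rfl fun a _ => Finset.sum_congr rfl fun b _ =>
    Finset.sum_congr rfl fun c _ => ?_
  split_ifs <;> simp [phasePoint]

lemma pderiv_inl_diagForm (w : ι → ℂ) (x : ι) :
    pderiv (Sum.inl x) (diagForm w) = C (w x) * X (Sum.inr x) := by
  classical
  rw [diagForm, map_sum, Finset.sum_eq_single x]
  · simp [Derivation.leibniz, pderiv_X]
  · intro y _ hy
    simp [Derivation.leibniz, pderiv_X, hy]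
  · simp

lemma pderiv_inr_diagForm (w : ι → ℂ) (x : ι) :
    pderiv (Sum.inr x) (diagForm w) = C (w x) * X (Sum.inl x) := by
  classical
  rw [diagForm, map_sum, Finset.sum_eq_single x]
  · simp [Derivation.leibniz, pderiv_X]
  · intro y _ hy
    simp [Derivation.leibniz, pderiv_X, hy]
  · simp

/-- The derivative of a polynomial along a perturbed Hamiltonian flow. -/
lemma hasDerivAt_eval_phasePoint (k : ι → Fin d → ℤ) (ω : ι → ℝ) (P : Poly ι) {z : ℝ → ι → ℂ}
    {err : ι → ℂ} {t : ℝ}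
    (h : ∀ x, HasDerivAt (fun τ => z τ x)
      (-Complex.I * ((ω x : ℂ) * z t x + finiteCubic k (z t) x + err x)) t) :
    HasDerivAt (fun τ => eval (phasePoint (z τ)) P)
      (-Complex.I * eval (phasePoint (z t)) (pb P (diagForm (fun x => (ω x : ℂ)) + quartic k)) +
        ∑ v, eval (phasePoint (z t)) (pderiv v P) * phasePoint (fun x => -Complex.I * err x) v) t := by
  have hd : ∀ v, HasDerivAt (fun τ => phasePoint (z τ) v) (phasePoint (fun x =>
      -Complex.I * ((ω x : ℂ) * z t x + finiteCubic k (z t) x + err x)) v) t := by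
    rintro (x | x)
    · exact h x
    · exact (h x).star
  have h1 := hasDerivAt_eval P hd
  have h2 : ∑ v, eval (phasePoint (z t)) (pderiv v P) * phasePoint (fun x =>
      -Complex.I * ((ω x : ℂ) * z t x + finiteCubic k (z t) x + err x)) v =
      -Complex.I * eval (phasePoint (z t)) (pb P (diagForm (fun x => (ω x : ℂ)) + quartic k)) +
        ∑ v, eval (phasePoint (z t)) (pderiv v P) * phasePoint (fun x => -Complex.I * err x) v := by
    rw [Fintype.sum_sum_type, Fintype.sum_sum_type, pb, map_sum, Finset.mul_sum]
    rw [← Finset.sum_add_distrib, ← Finset.sum_add_distrib, ← Finset.sum_add_distrib]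
    refine Finset.sum_congr rfl fun x _ => ?_
    simp only [map_add, map_sub, map_mul, pderiv_inl_diagForm, pderiv_inr_diagForm, eval_C, eval_X,
      eval_pderiv_inl_quartic, eval_pderiv_inr_quartic]
    simp only [phasePoint, Sum.elim_inl, Sum.elim_inr, map_mul, map_add, map_neg, Complex.conj_I,
      Complex.conj_ofReal]
    ring
  rw [h2] at h1
  exact h1

lemma weightedSq_phasePoint (k : ι → Fin d → ℤ) (s : ℝ) (z : ι → ℂ) :
    weightedSq k s (fun v => ‖phasePoint z v‖) = 2 * ∑ x, jap (k x) ^ (2 * s) * ‖z x‖ ^ 2 := by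
  rw [weightedSq, Fintype.sum_sum_type]
  simp only [phasePoint, freq, Sum.elim_inl, Sum.elim_inr, RCLike.norm_conj]
  ring

end Quartic

/-! ### The energy estimate -/

section Coefficients

variable {d : ℕ}

/-- The Fourier coefficients of an element of `H^s`. -/
def coeffOf (s : ℝ) (x : Hs d) (n : Fin d → ℤ) : ℂ := ((jap n ^ (-s) : ℝ) : ℂ) * x n

lemma coeffOf_sub (s : ℝ) (x y : Hs d) (n : Fin d → ℤ) :
    coeffOf s (x - y) n = coeffOf s x n - coeffOf s y n := by
  simp only [coeffOf, lp.coeFn_sub, Pi.sub_apply, mul_sub]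

lemma jap_rpow_mul_coeffOf (s : ℝ) (x : Hs d) (n : Fin d → ℤ) :
    ((jap n ^ s : ℝ) : ℂ) * coeffOf s x n = x n := by
  rw [coeffOf, ← mul_assoc, ← Complex.ofReal_mul, ← Real.rpow_add (jap_pos n)]
  simp

lemma jap_rpow_mul_norm_coeffOf_sq (s : ℝ) (x : Hs d) (n : Fin d → ℤ) :
    jap n ^ (2 * s) * ‖coeffOf s x n‖ ^ 2 = ‖x n‖ ^ 2 := by
  have hj := jap_pos n
  have h := congrArg (fun w : ℂ => ‖w‖ ^ 2) (jap_rpow_mul_coeffOf s x n)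
  simp only [norm_mul, Complex.norm_real, Real.norm_of_nonneg (Real.rpow_nonneg hj.le s),
    mul_pow] at h
  rw [← h, ← Real.rpow_natCast (jap n ^ s), ← Real.rpow_mul hj.le, mul_comm s]
  norm_num

lemma coeffOf_conv {s : ℝ} (hs : (d : ℝ) ≤ s) (x y : Hs d) (n : Fin d → ℤ) :
    coeffOf s (conv s hs x y) n = ∑' k, coeffOf s x k * coeffOf s y (n - k) := by
  rw [coeffOf, conv_apply, convCoeff, ← tsum_mul_left]
  refine tsum_congr fun k => ?_
  have h : ((jap n ^ (-s) : ℝ) : ℂ) * ((jap n ^ s : ℝ) : ℂ) = 1 := by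
    rw [← Complex.ofReal_mul, ← Real.rpow_add (jap_pos n)]
    simp
  rw [convWeight, coeffOf, coeffOf]
  push_cast
  linear_combination (((jap k ^ (-s) : ℝ) : ℂ) * ((jap (n - k) ^ (-s) : ℝ) : ℂ) * x k * y (n - k)) * h

lemma coeffOf_conjRefl (s : ℝ) (x : Hs d) (n : Fin d → ℤ) :
    coeffOf s (conjRefl x) n = (starRingEnd ℂ) (coeffOf s x (-n)) := by
  simp [coeffOf, jap_neg]

lemma coeffOf_proj_of_notMem (s : ℝ) {Λ : Finset (Fin d → ℤ)} {n : Fin d → ℤ} (hn : n ∉ Λ)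
    (x : Hs d) : coeffOf s (proj Λ x) n = 0 := by
  rw [coeffOf, proj_apply_of_notMem hn, mul_zero]

lemma coeffOf_proj_of_mem (s : ℝ) {Λ : Finset (Fin d → ℤ)} {n : Fin d → ℤ} (hn : n ∈ Λ)
    (x : Hs d) : coeffOf s (proj Λ x) n = coeffOf s x n := by
  rw [coeffOf, proj_apply_of_mem hn, coeffOf]

/-- On finitely many modes the nonlinearity is given by the finite sum. -/
lemma coeffOf_cubic_proj {s : ℝ} (hs : (d : ℝ) ≤ s) (Λ : Finset (Fin d → ℤ)) (x : Hs d)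
    (n : {n // n ∈ Λ}) :
    coeffOf s (cubic s hs (proj Λ x)) n =
      finiteCubic (Subtype.val : {n // n ∈ Λ} → Fin d → ℤ) (fun a => coeffOf s x a) n := by
  classical
  set f : (Fin d → ℤ) → ℂ := coeffOf s (proj Λ x) with hf
  have hf0 : ∀ k, k ∉ Λ → f k = 0 := fun k hk => coeffOf_proj_of_notMem s hk x
  have hfΛ : ∀ a : {n // n ∈ Λ}, f a = coeffOf s x a := fun a => coeffOf_proj_of_mem s a.2 x
  have hstep : ∀ k, coeffOf s (conv s hs (proj Λ x) (proj Λ x)) k =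
      ∑ a : {n // n ∈ Λ}, ∑ b : {n // n ∈ Λ}, if (a : Fin d → ℤ) + b = k then f a * f b else 0 := by
    intro k
    rw [coeffOf_conv, tsum_eq_sum (s := Λ) fun l hl => by rw [← hf, hf0 l hl, zero_mul],
      ← Finset.sum_coe_sort]
    refine Finset.sum_congr rfl fun a _ => ?_
    by_cases hk : k - a ∈ Λ
    · rw [Finset.sum_eq_single ⟨k - a, hk⟩]
      · simp [hf]
      · intro b _ hb
        rw [if_neg]
        intro h
        exact hb (Subtype.ext (eq_sub_of_add_eq' h))
      · simp
    · rw [← hf, hf0 _ hk, mul_zero]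
      refine (Finset.sum_eq_zero fun b _ => ?_).symm
      rw [if_neg]
      intro h
      refine hk ?_
      rw [← h, add_sub_cancel_left]
      exact b.2
  rw [cubic, coeffOf_conv, ← (Equiv.addRight (n : Fin d → ℤ)).tsum_eq, finiteCubic]
  rw [tsum_eq_sum (s := Λ) (fun c hc => by
    rw [coeffOf_conjRefl]
    simp only [Equiv.coe_addRight, sub_add_cancel_right, neg_neg]
    rw [← hf, hf0 c hc, map_zero, mul_zero]), ← Finset.sum_coe_sort]
  have hterm : ∀ c : {n // n ∈ Λ},
      coeffOf s (conv s hs (proj Λ x) (proj Λ x)) (Equiv.addRight (n : Fin d → ℤ) c) *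
        coeffOf s (conjRefl (proj Λ x)) (n - Equiv.addRight (n : Fin d → ℤ) c) =
      ∑ a : {n // n ∈ Λ}, ∑ b : {n // n ∈ Λ}, if (a : Fin d → ℤ) + b = c + n then
        coeffOf s x a * coeffOf s x b * (starRingEnd ℂ) (coeffOf s x c) else 0 := by
    intro c
    rw [hstep, coeffOf_conjRefl, Finset.sum_mul]
    refine Finset.sum_congr rfl fun a _ => ?_
    rw [Finset.sum_mul]
    refine Finset.sum_congr rfl fun b _ => ?_
    have h1 : -((n : Fin d → ℤ) - Equiv.addRight (n : Fin d → ℤ) c) = c := by simp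
    rw [h1, ← hf, hfΛ, hfΛ, hfΛ]
    by_cases hk : (a : Fin d → ℤ) + b = c + n
    · rw [if_pos hk, if_pos (show (a : Fin d → ℤ) + b = Equiv.addRight (n : Fin d → ℤ) c from hk)]
    · rw [if_neg hk, if_neg (show ¬(a : Fin d → ℤ) + b = Equiv.addRight (n : Fin d → ℤ) c from hk),
        zero_mul]
  rw [Finset.sum_congr rfl fun c _ => hterm c, Finset.sum_comm]
  exact Finset.sum_congr rfl fun a _ => Finset.sum_comm

lemma hasDerivAt_coeffOf_rot (ω : (Fin d → ℤ) → ℝ) {s : ℝ} (hs : (d : ℝ) ≤ s) {y : ℝ → Hs d}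
    {t : ℝ} (h : HasDerivAt y (field ω s hs t (y t)) t) (n : Fin d → ℤ) :
    HasDerivAt (fun τ => coeffOf s (rot ω (-τ) (y τ)) n)
      (-Complex.I * ((ω n : ℂ) * coeffOf s (rot ω (-t) (y t)) n +
        coeffOf s (cubic s hs (rot ω (-t) (y t))) n)) t := by
  have h1 : HasDerivAt (fun τ => y τ n) (field ω s hs t (y t) n) t :=
    (lp.evalCLM ℝ (fun _ : Fin d → ℤ => ℂ) 2 n).hasFDerivAt.comp_hasDerivAt t h
  have h2 : HasDerivAt (fun τ : ℝ => Complex.exp ((-τ * ω n : ℝ) * Complex.I))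
      (Complex.exp ((-t * ω n : ℝ) * Complex.I) * (((-1 * ω n : ℝ) : ℂ) * Complex.I)) t := by
    have h3 : HasDerivAt (fun τ : ℝ => -τ * ω n) (-1 * ω n) t :=
      (hasDerivAt_id t).neg.mul_const (ω n)
    exact (h3.ofReal_comp.mul_const Complex.I).cexp
  have h4 := (h2.mul h1).const_mul ((jap n ^ (-s) : ℝ) : ℂ)
  have h5 : (fun τ => coeffOf s (rot ω (-τ) (y τ)) n) = fun τ => ((jap n ^ (-s) : ℝ) : ℂ) *
      (Complex.exp ((-τ * ω n : ℝ) * Complex.I) * y τ n) := by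
    funext τ
    rw [coeffOf, rot_apply]
  have h6 : field ω s hs t (y t) n = -Complex.I * (Complex.exp ((t * ω n : ℝ) * Complex.I) *
      cubic s hs (rot ω (-t) (y t)) n) := rfl
  have h7 : Complex.exp ((-t * ω n : ℝ) * Complex.I) * Complex.exp ((t * ω n : ℝ) * Complex.I) = 1 := by
    rw [← Complex.exp_add]
    push_cast
    ring_nf
    exact Complex.exp_zero
  have h8 : -Complex.I * ((ω n : ℂ) * coeffOf s (rot ω (-t) (y t)) n +
        coeffOf s (cubic s hs (rot ω (-t) (y t))) n) = ((jap n ^ (-s) : ℝ) : ℂ) *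
      (Complex.exp ((-t * ω n : ℝ) * Complex.I) * (((-1 * ω n : ℝ) : ℂ) * Complex.I) * y t n +
        Complex.exp ((-t * ω n : ℝ) * Complex.I) * field ω s hs t (y t) n) := by
    rw [h6, coeffOf, coeffOf, rot_apply]
    push_cast at h7 ⊢
    linear_combination
      (((jap n ^ (-s) : ℝ) : ℂ) * (Complex.I * cubic s hs (rot ω (-t) (y t)) n)) * h7
  rw [h5, h8]
  exact h4

end Coefficients

section EnergyEstimate

open MvPolynomial

variable {d : ℕ}

/-- The constant in the bounds for the homogeneous parts of the energy. -/
def energyConst (C s S : ℝ) (p : ℕ) : ℝ := C * (4 * (2 * p + 2 : ℝ) ^ s) * S ^ p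

lemma energyConst_nonneg {C S : ℝ} (s : ℝ) (hC : 0 ≤ C) (hS : 0 ≤ S) (p : ℕ) :
    0 ≤ energyConst C s S p := by
  unfold energyConst
  positivity

lemma sum_freq_le {ν : ℕ} {s : ℝ} (hs : (ν : ℝ) + d ≤ s) (Λ : Finset (Fin d → ℤ)) :
    ∑ v, jap (freq (Subtype.val : {n // n ∈ Λ} → Fin d → ℤ) v) ^ (2 * ((ν : ℝ) - s)) ≤
      2 * ∑' n : Fin d → ℤ, jap n ^ (-(2 * (s - ν))) := by
  have hsum : Summable fun n : Fin d → ℤ => jap n ^ (-(2 * (s - ν))) :=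
    summable_jap_rpow (by linarith)
  have h := hsum.sum_le_tsum Λ fun n _ => Real.rpow_nonneg (jap_pos n).le _
  rw [Fintype.sum_sum_type]
  simp only [freq, Sum.elim_inl, Sum.elim_inr]
  rw [← two_mul, Finset.sum_coe_sort Λ fun n => jap n ^ (2 * ((ν : ℝ) - s))]
  have h2 : ∀ n : Fin d → ℤ, jap n ^ (2 * ((ν : ℝ) - s)) = jap n ^ (-(2 * (s - ν))) := fun n => by
    congr 1
    ring
  simp only [h2]
  linarith

lemma eval_diagForm_jap (s : ℝ) (Λ : Finset (Fin d → ℤ)) (x : Hs d) :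
    eval (phasePoint fun n : {n // n ∈ Λ} => coeffOf s x n)
      (diagForm fun n : {n // n ∈ Λ} => ((jap (n : Fin d → ℤ) ^ (2 * s) : ℝ) : ℂ)) =
      ((∑ n ∈ Λ, ‖x n‖ ^ 2 : ℝ) : ℂ) := by
  rw [diagForm, map_sum, ← Finset.sum_coe_sort Λ, Complex.ofReal_sum]
  refine Finset.sum_congr rfl fun n _ => ?_
  simp only [map_mul, eval_C, eval_X, phasePoint, Sum.elim_inl, Sum.elim_inr]
  rw [Complex.mul_conj', ← jap_rpow_mul_norm_coeffOf_sq s x n]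
  push_cast
  rfl

lemma weightedSq_coeffOf_le (s : ℝ) (Λ : Finset (Fin d → ℤ)) (x : Hs d) :
    weightedSq (Subtype.val : {n // n ∈ Λ} → Fin d → ℤ) s
      (fun v => ‖phasePoint (fun n : {n // n ∈ Λ} => coeffOf s x n) v‖) ≤ 2 * ‖x‖ ^ 2 := by
  rw [weightedSq_phasePoint]
  simp only [jap_rpow_mul_norm_coeffOf_sq]
  rw [Finset.sum_coe_sort Λ fun n => ‖x n‖ ^ 2, ← norm_proj_sq]
  have := pow_le_pow_left₀ (norm_nonneg _) (norm_proj_le Λ x) 2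
  linarith

/-- The truncated energy is almost conserved. -/
lemma truncated_energy_estimate {ω : (Fin d → ℤ) → ℝ} {s : ℝ} (hs : (d : ℝ) ≤ s) {ν r : ℕ} {C S : ℝ}
    (hC : 0 ≤ C) {Λ : Finset (Fin d → ℤ)}
    (hS : ∑ v, jap (freq (Subtype.val : {n // n ∈ Λ} → Fin d → ℤ) v) ^ (2 * ((ν : ℝ) - s)) ≤ S)
    {E : ℕ → Poly {n // n ∈ Λ}} {Q : Poly {n // n ∈ Λ}}
    (hE0 : E 0 = diagForm fun n : {n // n ∈ Λ} => ((jap (n : Fin d → ℤ) ^ (2 * s) : ℝ) : ℂ))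
    (hE : ∀ i ≤ r + 1, IsClass (Subtype.val : {n // n ∈ Λ} → Fin d → ℤ) (i + 1) s ν C (E i))
    (hQ : IsClass (Subtype.val : {n // n ∈ Λ} → Fin d → ℤ) (r + 3) s ν C Q)
    (hpb : pb (∑ i ∈ Finset.range (r + 2), E i)
      (diagForm (fun n : {n // n ∈ Λ} => (ω n : ℂ)) + quartic Subtype.val) = Q)
    {y : ℝ → Hs d} {t ρ η : ℝ} (hρ : 0 < ρ) (hρ1 : ρ ≤ 1) (hη : 0 < η)
    (hy : ∀ τ ∈ Set.uIcc 0 t, ‖y τ‖ ≤ ρ ∧ HasDerivAt y (field ω s hs τ (y τ)) τ)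
    (htail : ∀ τ ∈ Set.uIcc 0 t, ‖y τ - proj Λ (y τ)‖ ≤ η) :
    ∑ n ∈ Λ, ‖y t n‖ ^ 2 ≤ ∑ n ∈ Λ, ‖y 0 n‖ ^ 2 +
      2 * ((∑ i ∈ Finset.range (r + 1), energyConst C s S (i + 1) * 2 ^ (i + 2)) * ρ ^ 4) +
      (energyConst C s S (r + 2) * (2 * ρ ^ 2) ^ (r + 3) +
        6 * (convConst d s + 1) * η * ∑ i ∈ Finset.range (r + 2),
          energyConst C s S i * 6 ^ (i + 1)) * |t| := by
  have hs0 : 0 ≤ s := (Nat.cast_nonneg d).trans hs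
  have hS0 : 0 ≤ S := le_trans (Finset.sum_nonneg fun v _ => Real.rpow_nonneg (jap_pos _).le _) hS
  have hk : Function.Injective (Subtype.val : {n // n ∈ Λ} → Fin d → ℤ) := Subtype.val_injective
  have hcc := convConst_nonneg d s
  let X : ℝ → Hs d := fun τ => rot ω (-τ) (y τ)
  let z : ℝ → {n // n ∈ Λ} → ℂ := fun τ n => coeffOf s (X τ) n
  let err : ℝ → {n // n ∈ Λ} → ℂ := fun τ n =>
    coeffOf s (cubic s hs (X τ)) n - coeffOf s (cubic s hs (proj Λ (X τ))) n
  have hXn : ∀ τ, ‖X τ‖ = ‖y τ‖ := fun τ => norm_rot ω _ _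
  have hW : ∀ τ ∈ Set.uIcc 0 t, weightedSq (Subtype.val : {n // n ∈ Λ} → Fin d → ℤ) s
      (fun v => ‖phasePoint (z τ) v‖) ≤ 2 * ρ ^ 2 := by
    intro τ hτ
    refine (weightedSq_coeffOf_le s Λ (X τ)).trans ?_
    have := pow_le_pow_left₀ (norm_nonneg _) (hy τ hτ).1 2
    rw [hXn]
    linarith
  have hρ2 : 2 * ρ ^ 2 ≤ 2 := by
    have := pow_le_one₀ (n := 2) hρ.le hρ1
    linarith
  have herr : ∀ τ ∈ Set.uIcc 0 t, weightedSq (Subtype.val : {n // n ∈ Λ} → Fin d → ℤ) s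
      (fun v => ‖phasePoint (fun n => -Complex.I * err τ n) v‖) ≤
        (6 * (convConst d s + 1) * η) ^ 2 := by
    intro τ hτ
    have h1 := weightedSq_coeffOf_le s Λ (cubic s hs (X τ) - cubic s hs (proj Λ (X τ)))
    rw [weightedSq_phasePoint] at h1 ⊢
    simp only [norm_mul, norm_neg, Complex.norm_I, one_mul]
    simp only [coeffOf_sub] at h1
    refine h1.trans ?_
    have h2 := norm_cubic_sub_le hs (x := X τ) (y := proj Λ (X τ)) (ρ := 1)
      (by rw [hXn]; exact (hy τ hτ).1.trans hρ1)
      ((norm_proj_le Λ _).trans (by rw [hXn]; exact (hy τ hτ).1.trans hρ1))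
    have h3 : ‖X τ - proj Λ (X τ)‖ ≤ η := by
      have h4 : X τ - proj Λ (X τ) = rot ω (-τ) (y τ - proj Λ (y τ)) := by
        rw [map_sub, ← proj_rot]
      rw [h4, norm_rot]
      exact htail τ hτ
    have h5 : ‖cubic s hs (X τ) - cubic s hs (proj Λ (X τ))‖ ≤ 3 * (convConst d s + 1) * η := by
      refine h2.trans ?_
      rw [one_pow, mul_one]
      exact mul_le_mul (by linarith) h3 (norm_nonneg _) (by positivity)
    have h6 := pow_le_pow_left₀ (norm_nonneg _) h5 2
    nlinarith [sq_nonneg (3 * (convConst d s + 1) * η)]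
  have hderiv : ∀ τ ∈ Set.uIcc 0 t, HasDerivAt
      (fun τ => eval (phasePoint (z τ)) (∑ i ∈ Finset.range (r + 2), E i))
      (-Complex.I * eval (phasePoint (z τ)) Q + ∑ i ∈ Finset.range (r + 2),
        ∑ v, eval (phasePoint (z τ)) (pderiv v (E i)) *
          phasePoint (fun n => -Complex.I * err τ n) v) τ := by
    intro τ hτ
    have h1 := hasDerivAt_eval_phasePoint (Subtype.val : {n // n ∈ Λ} → Fin d → ℤ)
      (fun n => ω n) (∑ i ∈ Finset.range (r + 2), E i) (z := z) (err := err τ) (t := τ) (by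
        intro n
        have h2 := hasDerivAt_coeffOf_rot ω hs (hy τ hτ).2 n
        have h3 : (ω n : ℂ) * z τ n + finiteCubic Subtype.val (z τ) n + err τ n =
            (ω n : ℂ) * coeffOf s (rot ω (-τ) (y τ)) n +
              coeffOf s (cubic s hs (rot ω (-τ) (y τ))) n := by
          have h4 := coeffOf_cubic_proj hs Λ (X τ) n
          simp only [z, err]
          rw [h4]
          simp only [X]
          ring
        rw [h3]
        exact h2)
    rw [hpb] at h1
    have h5 : ∑ v, eval (phasePoint (z τ)) (pderiv v (∑ i ∈ Finset.range (r + 2), E i)) *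
          phasePoint (fun n => -Complex.I * err τ n) v = ∑ i ∈ Finset.range (r + 2),
        ∑ v, eval (phasePoint (z τ)) (pderiv v (E i)) *
          phasePoint (fun n => -Complex.I * err τ n) v := by
      rw [Finset.sum_comm]
      refine Finset.sum_congr rfl fun v _ => ?_
      rw [map_sum, map_sum, Finset.sum_mul]
    rw [h5] at h1
    exact h1
  have hbound : ∀ τ ∈ Set.uIcc 0 t, ‖-Complex.I * eval (phasePoint (z τ)) Q +
      ∑ i ∈ Finset.range (r + 2), ∑ v, eval (phasePoint (z τ)) (pderiv v (E i)) *
          phasePoint (fun n => -Complex.I * err τ n) v‖ ≤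
      energyConst C s S (r + 2) * (2 * ρ ^ 2) ^ (r + 3) +
        6 * (convConst d s + 1) * η * ∑ i ∈ Finset.range (r + 2),
          energyConst C s S i * 6 ^ (i + 1) := by
    intro τ hτ
    refine (norm_add_le _ _).trans (add_le_add ?_ ?_)
    · rw [norm_mul, norm_neg, Complex.norm_I, one_mul]
      refine (norm_eval_le_majorant Q _).trans ((majorant_le hk hs0 hQ hS
        (fun v => norm_nonneg _)).trans ?_)
      refine mul_le_mul_of_nonneg_left (pow_le_pow_left₀ (weightedSq_nonneg _ _ _) (hW τ hτ) _)
        (energyConst_nonneg s hC hS0 (r + 2))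
    · rw [Finset.mul_sum]
      refine (norm_sum_le _ _).trans (Finset.sum_le_sum fun i hi => ?_)
      have h1 := norm_sum_eval_pderiv_le hk hs0 (hE i (by
        have := Finset.mem_range.1 hi
        omega)) hS (η := 6 * (convConst d s + 1) * η) (by positivity)
        ((hW τ hτ).trans hρ2) (herr τ hτ)
      refine h1.trans (le_of_eq ?_)
      rw [energyConst]
      norm_num
  have hdiff : ‖eval (phasePoint (z t)) (∑ i ∈ Finset.range (r + 2), E i) -
      eval (phasePoint (z 0)) (∑ i ∈ Finset.range (r + 2), E i)‖ ≤
      (energyConst C s S (r + 2) * (2 * ρ ^ 2) ^ (r + 3) +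
        6 * (convConst d s + 1) * η * ∑ i ∈ Finset.range (r + 2),
          energyConst C s S i * 6 ^ (i + 1)) * |t| := by
    have h1 := (convex_uIcc (0 : ℝ) t).norm_image_sub_le_of_norm_hasDerivWithin_le
      (fun τ hτ => (hderiv τ hτ).hasDerivWithinAt) hbound Set.left_mem_uIcc Set.right_mem_uIcc
    rw [sub_zero, Real.norm_eq_abs] at h1
    exact h1
  have hrest : ∀ τ ∈ Set.uIcc 0 t, ‖eval (phasePoint (z τ)) (∑ i ∈ Finset.range (r + 2), E i) -
      ((∑ n ∈ Λ, ‖y τ n‖ ^ 2 : ℝ) : ℂ)‖ ≤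
      (∑ i ∈ Finset.range (r + 1), energyConst C s S (i + 1) * 2 ^ (i + 2)) * ρ ^ 4 := by
    intro τ hτ
    have h1 : eval (phasePoint (z τ)) (E 0) = ((∑ n ∈ Λ, ‖y τ n‖ ^ 2 : ℝ) : ℂ) := by
      rw [hE0]
      have h2 := eval_diagForm_jap s Λ (X τ)
      simp only [X, norm_rot_apply] at h2
      exact h2
    rw [Finset.sum_range_succ', map_add, h1, add_sub_cancel_right, map_sum, Finset.sum_mul]
    refine (norm_sum_le _ _).trans (Finset.sum_le_sum fun i hi => ?_)
    have hi' := Finset.mem_range.1 hi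
    refine (norm_eval_le_majorant _ _).trans ((majorant_le hk hs0 (hE (i + 1) (by omega)) hS
      (fun v => norm_nonneg _)).trans ?_)
    rw [mul_assoc (energyConst C s S (i + 1))]
    refine mul_le_mul_of_nonneg_left ?_ (energyConst_nonneg s hC hS0 (i + 1))
    refine (pow_le_pow_left₀ (weightedSq_nonneg _ _ _) (hW τ hτ) _).trans ?_
    rw [mul_pow, ← pow_mul]
    exact mul_le_mul_of_nonneg_left (pow_le_pow_of_le_one hρ.le hρ1 (by omega)) (by positivity)
  have h0 := hrest 0 Set.left_mem_uIcc
  have ht := hrest t Set.right_mem_uIcc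
  have hfin : ‖((∑ n ∈ Λ, ‖y t n‖ ^ 2 : ℝ) : ℂ) - ((∑ n ∈ Λ, ‖y 0 n‖ ^ 2 : ℝ) : ℂ)‖ ≤
      (∑ i ∈ Finset.range (r + 1), energyConst C s S (i + 1) * 2 ^ (i + 2)) * ρ ^ 4 +
      (energyConst C s S (r + 2) * (2 * ρ ^ 2) ^ (r + 3) +
        6 * (convConst d s + 1) * η * ∑ i ∈ Finset.range (r + 2),
          energyConst C s S i * 6 ^ (i + 1)) * |t| +
      (∑ i ∈ Finset.range (r + 1), energyConst C s S (i + 1) * 2 ^ (i + 2)) * ρ ^ 4 := by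
    have h1 : ∀ a b e e' : ℂ, a - b = -(e - a) + (e - e') + (e' - b) := fun a b e e' => by ring
    rw [h1 _ _ (eval (phasePoint (z t)) (∑ i ∈ Finset.range (r + 2), E i))
      (eval (phasePoint (z 0)) (∑ i ∈ Finset.range (r + 2), E i))]
    refine (norm_add₃_le).trans ?_
    rw [norm_neg]
    exact add_le_add (add_le_add ht hdiff) h0
  rw [← Complex.ofReal_sub, Complex.norm_real, Real.norm_eq_abs] at hfin
  have := (le_abs_self _).trans hfin
  linarith

/-- Long time control of the Sobolev norm by the modified energy. -/
theorem exists_energy_estimate {A : ℕ} {v : (Fin d → ℤ) → ℝ} (hv : IsDiophantine A v) {R : ℝ}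
    (hR : 0 ≤ R) (hb : ∀ n, |v n| ≤ R / jap n) (r : ℕ) :
    ∃ s₁ : ℝ, ∀ (s : ℝ) (hs : (d : ℝ) ≤ s), s₁ ≤ s → ∃ a : ℝ, 0 ≤ a ∧
      ∀ (y : ℝ → Hs d) (t ρ : ℝ), 0 < ρ → ρ ≤ 1 →
        (∀ τ ∈ Set.uIcc 0 t, ‖y τ‖ ≤ ρ ∧
          HasDerivAt y (field (fun n => normSq n + v n) s hs τ (y τ)) τ) →
        ‖y t‖ ^ 2 ≤ ‖y 0‖ ^ 2 + a * (ρ ^ 4 + |t| * ρ ^ (2 * (r + 3))) := by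
  obtain ⟨γ, α, hγ, hsd⟩ := exists_smallDivisors hv hR hb
  obtain ⟨ν, hν⟩ := exists_energy d r α hγ 128 (by norm_num)
  refine ⟨ν + d, fun s hs hs₁ => ?_⟩
  obtain ⟨C, hC, hE⟩ := hν s ((Nat.cast_nonneg d).trans hs)
  obtain ⟨S, hSdef⟩ : ∃ S, S = 2 * ∑' n : Fin d → ℤ, jap n ^ (-(2 * (s - ν))) := ⟨_, rfl⟩
  have hS0 : 0 ≤ S := by
    rw [hSdef]
    exact mul_nonneg zero_le_two (tsum_nonneg fun n => Real.rpow_nonneg (jap_pos n).le _)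
  obtain ⟨a₁, ha₁⟩ : ∃ a₁, a₁ = ∑ i ∈ Finset.range (r + 1),
    energyConst C s S (i + 1) * 2 ^ (i + 2) := ⟨_, rfl⟩
  obtain ⟨a₂, ha₂⟩ : ∃ a₂, a₂ = energyConst C s S (r + 2) := ⟨_, rfl⟩
  obtain ⟨a₃, ha₃⟩ : ∃ a₃, a₃ = ∑ i ∈ Finset.range (r + 2), energyConst C s S i * 6 ^ (i + 1) :=
    ⟨_, rfl⟩
  have ha₁0 : 0 ≤ a₁ := by
    rw [ha₁]
    exact Finset.sum_nonneg fun i _ => mul_nonneg (energyConst_nonneg s hC hS0 _) (by positivity)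
  have ha₂0 : 0 ≤ a₂ := ha₂ ▸ energyConst_nonneg s hC hS0 _
  refine ⟨2 * a₁ + a₂ * 2 ^ (r + 3), by positivity, fun y t ρ hρ hρ1 hy => ?_⟩
  have hcont : ContinuousOn y (Set.uIcc 0 t) := fun τ hτ =>
    (hy τ hτ).2.continuousAt.continuousWithinAt
  have hK : IsCompact (y '' Set.uIcc 0 t) := isCompact_uIcc.image_of_continuousOn hcont
  have key : ∀ η : ℝ, 0 < η → ‖y t‖ ^ 2 ≤ ‖y 0‖ ^ 2 + 2 * (a₁ * ρ ^ 4) +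
      (a₂ * (2 * ρ ^ 2) ^ (r + 3) + 6 * (convConst d s + 1) * η * a₃) * |t| + η ^ 2 := by
    intro η hη
    obtain ⟨Λ, hΛ⟩ := exists_norm_sub_proj_le hK hη
    have htail : ∀ τ ∈ Set.uIcc 0 t, ‖y τ - proj Λ (y τ)‖ ≤ η := fun τ hτ =>
      hΛ _ (Set.mem_image_of_mem y hτ)
    obtain ⟨E, Q, hE0, hEi, hQ, hpb⟩ := hE {n // n ∈ Λ} Subtype.val
      (fun n => normSq (n : Fin d → ℤ) + v n) (quartic Subtype.val) Subtype.val_injective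
      (hsd _ _) (isClass_quartic _)
    have h1 := truncated_energy_estimate (ω := fun n => normSq n + v n) hs hC
      (sum_freq_le (Λ := Λ) hs₁) hE0 hEi hQ hpb hρ hρ1 hη hy htail
    rw [← hSdef, ← ha₁, ← ha₂, ← ha₃] at h1
    have h2 := norm_sub_proj_sq Λ (y t)
    have h3 := norm_sub_proj_sq Λ (y 0)
    have h4 := pow_le_pow_left₀ (norm_nonneg _) (htail t Set.right_mem_uIcc) 2
    have h5 := sq_nonneg ‖y 0 - proj Λ (y 0)‖
    linarith
  have hlim : Tendsto (fun η : ℝ => ‖y 0‖ ^ 2 + 2 * (a₁ * ρ ^ 4) +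
      (a₂ * (2 * ρ ^ 2) ^ (r + 3) + 6 * (convConst d s + 1) * η * a₃) * |t| + η ^ 2) (𝓝[>] 0)
      (𝓝 (‖y 0‖ ^ 2 + 2 * (a₁ * ρ ^ 4) +
      (a₂ * (2 * ρ ^ 2) ^ (r + 3) + 6 * (convConst d s + 1) * 0 * a₃) * |t| + 0 ^ 2)) :=
    (Continuous.tendsto (by fun_prop) 0).mono_left nhdsWithin_le_nhds
  have hle := ge_of_tendsto hlim (by
    filter_upwards [self_mem_nhdsWithin] with η hη using key η hη)
  refine hle.trans ?_
  have h1 : 0 ≤ a₂ * 2 ^ (r + 3) * ρ ^ 4 := by positivity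
  have h2 : 0 ≤ a₁ * (|t| * ρ ^ (2 * (r + 3))) := by positivity
  rw [mul_pow, ← pow_mul]
  nlinarith

end EnergyEstimate

/-! ### Functions on the torus and their coefficients -/

section TorusFunctions

open UnitAddTorus

local instance : MeasureSpace UnitAddCircle := ⟨AddCircle.haarAddCircle⟩

local instance : IsProbabilityMeasure (volume : Measure UnitAddCircle) :=
  inferInstanceAs (IsProbabilityMeasure AddCircle.haarAddCircle)

variable {d : ℕ}

/-- The Fourier coefficient as a continuous linear functional. -/
def coeffL (n : Fin d → ℤ) : C(Torus d, ℂ) →L[ℂ] ℂ :=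
  (lp.evalCLM ℂ (fun _ : Fin d → ℤ => ℂ) 2 n).comp
    ((mFourierBasis (d := Fin d)).repr.toContinuousLinearEquiv.toContinuousLinearMap.comp
      (ContinuousMap.toLp (E := ℂ) 2 (volume : Measure (UnitAddTorus (Fin d))) ℂ))

lemma coeffL_apply (n : Fin d → ℤ) (f : C(Torus d, ℂ)) : coeffL n f = mFourierCoeff f n := by
  change mFourierBasis.repr (ContinuousMap.toLp (E := ℂ) 2 volume ℂ f) n = _
  rw [mFourierBasis_repr, mFourierCoeff_toLp]

lemma mFourierCoeff_sub (f g : C(Torus d, ℂ)) (n : Fin d → ℤ) :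
    mFourierCoeff (f - g : C(Torus d, ℂ)) n = mFourierCoeff f n - mFourierCoeff g n := by
  rw [← coeffL_apply, map_sub, coeffL_apply, coeffL_apply]

lemma mFourierCoeff_mFourier (k n : Fin d → ℤ) :
    mFourierCoeff (mFourier k) n = if n = k then 1 else 0 := by
  rw [← coeffL_apply]
  change mFourierBasis.repr (ContinuousMap.toLp (E := ℂ) 2 volume ℂ (mFourier k)) n = _
  have h : ContinuousMap.toLp (E := ℂ) 2 volume ℂ (mFourier k) = mFourierBasis k := by
    rw [coe_mFourierBasis]
  rw [h, mFourierBasis.repr_self, lp.single_apply, Pi.single_apply]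

lemma mFourierCoeff_mFourier_mul (k n : Fin d → ℤ) (g : C(Torus d, ℂ)) :
    mFourierCoeff (mFourier k * g : C(Torus d, ℂ)) n = mFourierCoeff g (n - k) := by
  unfold mFourierCoeff
  congr 1
  funext x
  rw [ContinuousMap.mul_apply, smul_eq_mul, smul_eq_mul, ← mul_assoc, ← mFourier_add]
  congr 3
  abel

lemma mFourierCoeff_star (f : C(Torus d, ℂ)) (n : Fin d → ℤ) :
    mFourierCoeff (star f : C(Torus d, ℂ)) n = (starRingEnd ℂ) (mFourierCoeff f (-n)) := by
  unfold mFourierCoeff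
  rw [← integral_conj]
  congr 1
  funext x
  rw [smul_eq_mul, smul_eq_mul, map_mul, ← mFourier_neg, neg_neg, ContinuousMap.star_apply]
  rfl

/-- The coefficients of a product. -/
lemma mFourierCoeff_mul {f : C(Torus d, ℂ)} (hf : Summable (mFourierCoeff f)) (g : C(Torus d, ℂ))
    (n : Fin d → ℤ) :
    mFourierCoeff (f * g : C(Torus d, ℂ)) n = ∑' k, mFourierCoeff f k * mFourierCoeff g (n - k) := by
  have h1 := (hasSum_mFourier_series_of_summable hf).mul_right g
  have h2 := (coeffL n).hasSum h1
  rw [coeffL_apply] at h2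
  rw [← h2.tsum_eq]
  refine tsum_congr fun k => ?_
  rw [smul_mul_assoc, map_smul, coeffL_apply, mFourierCoeff_mFourier_mul, smul_eq_mul]

lemma eq_of_mFourierCoeff_eq {f g : C(Torus d, ℂ)}
    (h : ∀ n, mFourierCoeff f n = mFourierCoeff g n) : f = g := by
  have h0 : ∀ n, mFourierCoeff (f - g : C(Torus d, ℂ)) n = 0 := fun n => by
    rw [mFourierCoeff_sub, h n, sub_self]
  have h1 : Summable (mFourierCoeff (f - g : C(Torus d, ℂ))) := by
    rw [show mFourierCoeff (f - g : C(Torus d, ℂ)) = fun _ => 0 from funext h0]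
    exact summable_zero
  refine ContinuousMap.ext fun x => sub_eq_zero.1 ?_
  have h2 := hasSum_mFourier_series_apply_of_summable h1 x
  have h3 : (fun n => mFourierCoeff (f - g : C(Torus d, ℂ)) n • mFourier n x) = fun _ => 0 :=
    funext fun n => by rw [h0, zero_smul]
  rw [h3] at h2
  exact h2.unique hasSum_zero

lemma summable_norm_coeffOf {s : ℝ} (hs : (d : ℝ) ≤ s) (x : Hs d) :
    Summable fun n => ‖coeffOf s x n‖ := by
  have h1 : Summable fun n : Fin d → ℤ => (jap n ^ (-s)) ^ 2 := by
    have h2 : Summable fun n : Fin d → ℤ => jap n ^ (-(2 * s)) := summable_jap_rpow (by linarith)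
    refine h2.congr fun n => ?_
    rw [← Real.rpow_natCast, ← Real.rpow_mul (jap_pos n).le]
    congr 1
    push_cast
    ring
  have h3 := (summable_mul_and_tsum_sq_le (fun n => Real.rpow_nonneg (jap_pos n).le _)
    (fun n => norm_nonneg (x n)) h1 x.summable_sq).1
  refine h3.congr fun n => ?_
  rw [coeffOf, norm_mul, Complex.norm_real, Real.norm_of_nonneg (Real.rpow_nonneg (jap_pos n).le _)]

/-- The function with given coefficients. -/
def toTorusFun (s : ℝ) (x : Hs d) : C(Torus d, ℂ) := ∑' n, coeffOf s x n • mFourier n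

lemma mFourierCoeff_toTorusFun {s : ℝ} (hs : (d : ℝ) ≤ s) (x : Hs d) (n : Fin d → ℤ) :
    mFourierCoeff (toTorusFun s x) n = coeffOf s x n := by
  have h : Summable fun k => coeffOf s x k • (mFourier k : C(Torus d, ℂ)) := by
    refine Summable.of_norm ?_
    simpa only [norm_smul, mFourier_norm, mul_one] using summable_norm_coeffOf hs x
  rw [← coeffL_apply, toTorusFun, (coeffL n).map_tsum h, tsum_eq_single n]
  · rw [map_smul, coeffL_apply, mFourierCoeff_mFourier, if_pos rfl, smul_eq_mul, mul_one]
  · intro k hk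
    rw [map_smul, coeffL_apply, mFourierCoeff_mFourier, if_neg hk.symm, smul_zero]

lemma ofReal_mul_enorm_sq {s : ℝ} (c : ℂ) (n : Fin d → ℤ) :
    ENNReal.ofReal ((1 + normSq n) ^ s) * ‖c‖ₑ ^ 2 = ENNReal.ofReal (jap n ^ (2 * s) * ‖c‖ ^ 2) := by
  rw [← jap_rpow_two_mul, ENNReal.ofReal_mul (Real.rpow_nonneg (jap_pos n).le _),
    ENNReal.ofReal_pow (norm_nonneg _), ofReal_norm]

lemma sobolevNorm_eq {s : ℝ} {f : C(Torus d, ℂ)} {x : Hs d}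
    (h : ∀ n, mFourierCoeff f n = coeffOf s x n) : sobolevNorm s f = ENNReal.ofReal ‖x‖ := by
  have h1 : ∀ n : Fin d → ℤ, ENNReal.ofReal ((1 + normSq n) ^ s) * ‖mFourierCoeff f n‖ₑ ^ 2 =
      ENNReal.ofReal (‖x n‖ ^ 2) := fun n => by
    rw [ofReal_mul_enorm_sq, h, jap_rpow_mul_norm_coeffOf_sq]
  rw [sobolevNorm]
  simp only [h1]
  rw [← ENNReal.ofReal_tsum_of_nonneg (fun n => sq_nonneg _) x.summable_sq, ← Hs.norm_sq,
    ENNReal.ofReal_rpow_of_nonneg (sq_nonneg _) (by norm_num), ← Real.sqrt_eq_rpow,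
    Real.sqrt_sq (norm_nonneg _)]

lemma exists_coeffOf_eq {s : ℝ} {f : C(Torus d, ℂ)} (h : sobolevNorm s f < ∞) :
    ∃ x : Hs d, ∀ n, mFourierCoeff f n = coeffOf s x n := by
  have h1 : ∑' n : Fin d → ℤ, ENNReal.ofReal (jap n ^ (2 * s) * ‖mFourierCoeff f n‖ ^ 2) ≠ ∞ := by
    intro htop
    simp only [← ofReal_mul_enorm_sq] at htop
    rw [sobolevNorm, htop, ENNReal.top_rpow_of_pos (by norm_num)] at h
    exact lt_irrefl _ h
  have h2 := ENNReal.summable_toReal h1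
  have h3 : ∀ n : Fin d → ℤ, ‖((jap n ^ s : ℝ) : ℂ) * mFourierCoeff f n‖ ^ 2 =
      (ENNReal.ofReal (jap n ^ (2 * s) * ‖mFourierCoeff f n‖ ^ 2)).toReal := fun n => by
    have hj := jap_pos n
    rw [ENNReal.toReal_ofReal (by positivity), norm_mul, mul_pow, Complex.norm_real,
      Real.norm_of_nonneg (by positivity), ← Real.rpow_natCast (jap n ^ s), ← Real.rpow_mul hj.le,
      mul_comm s]
    norm_num
  refine ⟨⟨fun n => ((jap n ^ s : ℝ) : ℂ) * mFourierCoeff f n,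
    memℓp_two_of_summable (by simpa only [h3] using h2)⟩, fun n => ?_⟩
  change _ = ((jap n ^ (-s) : ℝ) : ℂ) * (((jap n ^ s : ℝ) : ℂ) * mFourierCoeff f n)
  rw [← mul_assoc, ← Complex.ofReal_mul, ← Real.rpow_add (jap_pos n)]
  simp

/-- The coefficients of the nonlinearity. -/
lemma mFourierCoeff_cubic {s : ℝ} (hs : (d : ℝ) ≤ s) {f : C(Torus d, ℂ)} {x : Hs d}
    (h : ∀ n, mFourierCoeff f n = coeffOf s x n) (n : Fin d → ℤ) :
    mFourierCoeff (fun a => ((‖f a‖ ^ 2 : ℝ) : ℂ) * f a) n = coeffOf s (cubic s hs x) n := by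
  have hfun : mFourierCoeff f = coeffOf s x := funext h
  have h1 : Summable (mFourierCoeff f) := by
    rw [hfun]
    exact (summable_norm_coeffOf hs x).of_norm
  have h2 : mFourierCoeff (f * f : C(Torus d, ℂ)) = coeffOf s (conv s hs x x) := by
    funext k
    rw [mFourierCoeff_mul h1, coeffOf_conv, hfun]
  have h3 : (fun a => ((‖f a‖ ^ 2 : ℝ) : ℂ) * f a) = ⇑(f * f * star f) := by
    funext a
    simp only [ContinuousMap.mul_apply, ContinuousMap.star_apply]
    change _ = f a * f a * (starRingEnd ℂ) (f a)
    rw [mul_assoc, Complex.mul_conj']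
    push_cast
    ring
  rw [h3, mFourierCoeff_mul (by rw [h2]; exact (summable_norm_coeffOf hs _).of_norm), cubic,
    coeffOf_conv, h2]
  refine tsum_congr fun k => ?_
  rw [mFourierCoeff_star, coeffOf_conjRefl, hfun]

end TorusFunctions

/-! ### Solutions of the Cauchy problem -/

section Solutions

open UnitAddTorus

variable {d : ℕ}

lemma continuousAt_rot_comp (ω : (Fin d → ℤ) → ℝ) {y : ℝ → Hs d} {θ : ℝ → ℝ} {t : ℝ}
    (hθ : ContinuousAt θ t) (hy : ContinuousAt y t) :
    ContinuousAt (fun τ => rot ω (θ τ) (y τ)) t :=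
  (continuous_rot ω).continuousAt.comp₂ hθ hy

lemma isSolutionOn_of_hasDerivAt {v : (Fin d → ℤ) → ℝ} {s : ℝ} (hs : (d : ℝ) ≤ s) {J : Set ℝ}
    {y : ℝ → Hs d}
    (hy : ∀ t ∈ J, HasDerivAt y (field (fun n => normSq n + v n) s hs t (y t)) t) :
    IsSolutionOn v s J fun t => toTorusFun s (rot (fun n => normSq n + v n) (-t) (y t)) := by
  have hcoeff := fun x : Hs d => mFourierCoeff_toTorusFun hs x
  refine ⟨fun t _ => ?_, fun t₀ ht₀ => ?_, fun t ht n => ?_⟩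
  · rw [sobolevNorm_eq (hcoeff _)]
    exact ENNReal.ofReal_lt_top
  · have h1 : ∀ t, sobolevNorm s (toTorusFun s (rot (fun n => normSq n + v n) (-t) (y t)) -
        toTorusFun s (rot (fun n => normSq n + v n) (-t₀) (y t₀))) =
        ENNReal.ofReal ‖rot (fun n => normSq n + v n) (-t) (y t) -
          rot (fun n => normSq n + v n) (-t₀) (y t₀)‖ := fun t =>
      sobolevNorm_eq fun n => by rw [mFourierCoeff_sub, hcoeff, hcoeff, coeffOf_sub]
    simp only [h1]
    have h2 := continuousAt_rot_comp (fun n => normSq n + v n) (θ := fun τ => -τ)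
      continuous_neg.continuousAt (hy t₀ ht₀).continuousAt
    have h3 := ENNReal.tendsto_ofReal (tendsto_iff_norm_sub_tendsto_zero.1 h2)
    rw [ENNReal.ofReal_zero] at h3
    exact h3.mono_left nhdsWithin_le_nhds
  · have h1 := hasDerivAt_coeffOf_rot (fun n => normSq n + v n) hs (hy t ht) n
    refine ⟨-Complex.I * (((normSq n + v n : ℝ) : ℂ) *
      coeffOf s (rot (fun n => normSq n + v n) (-t) (y t)) n +
        coeffOf s (cubic s hs (rot (fun n => normSq n + v n) (-t) (y t))) n), ?_, ?_⟩
    · simp only [hcoeff]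
      exact h1
    · rw [mFourierCoeff_cubic hs (hcoeff _), hcoeff]
      push_cast
      linear_combination (-(((normSq n : ℂ) + v n) *
        coeffOf s (rot (fun n => normSq n + v n) (-t) (y t)) n +
          coeffOf s (cubic s hs (rot (fun n => normSq n + v n) (-t) (y t))) n)) * Complex.I_mul_I

/-- A curve in `H^s` whose coefficients are differentiable, with continuous derivative in `H^s`, is
differentiable. -/
lemma hasDerivAt_of_coeff {a b : ℝ} {Y g : ℝ → Hs d} (hg : ContinuousOn g (Set.Ioo a b))
    (h : ∀ t ∈ Set.Ioo a b, ∀ n, HasDerivAt (fun τ => Y τ n) (g t n) t) :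
    ∀ t ∈ Set.Ioo a b, HasDerivAt Y (g t) t := by
  intro t₀ ht₀
  have hI : ∀ t ∈ Set.Ioo a b, HasDerivAt (fun t => Y t₀ + ∫ τ in t₀..t, g τ) (g t) t := by
    intro t ht
    have h1 : IntervalIntegrable g volume t₀ t :=
      (hg.mono (Set.OrdConnected.uIcc_subset inferInstance ht₀ ht)).intervalIntegrable
    exact (intervalIntegral.integral_hasDerivAt_right h1
      (hg.stronglyMeasurableAtFilter isOpen_Ioo t ht)
      (hg.continuousAt (isOpen_Ioo.mem_nhds ht))).const_add _
  have heq : ∀ t ∈ Set.Ioo a b, Y t = Y t₀ + ∫ τ in t₀..t, g τ := by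
    intro t ht
    ext n
    have h2 : ∀ τ ∈ Set.Ioo a b, HasDerivWithinAt
        (fun τ => Y τ n - (Y t₀ + ∫ σ in t₀..τ, g σ : Hs d) n) 0 (Set.Ioo a b) τ := by
      intro τ hτ
      have h3 : HasDerivAt (fun τ => (Y t₀ + ∫ σ in t₀..τ, g σ : Hs d) n) (g τ n) τ :=
        (lp.evalCLM ℝ (fun _ : Fin d → ℤ => ℂ) 2 n).hasFDerivAt.comp_hasDerivAt τ (hI τ hτ)
      have h4 := ((h τ hτ n).sub h3).hasDerivWithinAt (s := Set.Ioo a b)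
      rw [sub_self] at h4
      exact h4
    have h5 := (convex_Ioo a b).norm_image_sub_le_of_norm_hasDerivWithin_le (C := 0) h2
      (fun τ _ => by simp) ht₀ ht
    rw [zero_mul, norm_le_zero_iff, intervalIntegral.integral_same, add_zero, sub_self,
      sub_zero] at h5
    exact sub_eq_zero.1 h5
  exact (hI t₀ ht₀).congr_of_eventuallyEq
    (Filter.eventually_of_mem (isOpen_Ioo.mem_nhds ht₀) heq)

/-- A solution in the sense of coefficients is a solution in the interaction picture. -/
lemma IsSolutionOn.exists_hasDerivAt {v : (Fin d → ℤ) → ℝ} {s : ℝ} (hs : (d : ℝ) ≤ s) {a b : ℝ}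
    {w : ℝ → C(Torus d, ℂ)} (hw : IsSolutionOn v s (Set.Ioo a b) w) :
    ∃ Y : ℝ → Hs d,
      (∀ t ∈ Set.Ioo a b, HasDerivAt Y (field (fun n => normSq n + v n) s hs t (Y t)) t) ∧
      ∀ t ∈ Set.Ioo a b, ∀ n, mFourierCoeff (w t) n =
        coeffOf s (rot (fun n => normSq n + v n) (-t) (Y t)) n := by
  have hex : ∀ t, ∃ x : Hs d, t ∈ Set.Ioo a b → ∀ n, mFourierCoeff (w t) n = coeffOf s x n := by
    intro t
    by_cases ht : t ∈ Set.Ioo a b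
    · obtain ⟨x, hx⟩ := exists_coeffOf_eq (hw.mem_sobolev t ht)
      exact ⟨x, fun _ => hx⟩
    · exact ⟨0, fun h => absurd h ht⟩
  choose x hx using hex
  have hrot : ∀ t, rot (fun n => normSq n + v n) (-t) (rot (fun n => normSq n + v n) t (x t)) =
      x t := fun t => by
    rw [rot_rot, neg_add_cancel, rot_zero]
  refine ⟨fun t => rot (fun n => normSq n + v n) t (x t), ?_, fun t ht n => by
    rw [hrot]
    exact hx t ht n⟩
  have hxc : ∀ t₀ ∈ Set.Ioo a b, ContinuousAt x t₀ := by
    intro t₀ ht₀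
    have h1 := hw.continuous_sobolev t₀ ht₀
    rw [isOpen_Ioo.nhdsWithin_eq ht₀] at h1
    have h2 : (fun t => sobolevNorm s (w t - w t₀)) =ᶠ[𝓝 t₀]
        fun t => ENNReal.ofReal ‖x t - x t₀‖ := by
      filter_upwards [isOpen_Ioo.mem_nhds ht₀] with t ht
      exact sobolevNorm_eq fun n => by
        rw [mFourierCoeff_sub, hx t ht, hx t₀ ht₀, coeffOf_sub]
    have h3 := (ENNReal.tendsto_toReal ENNReal.zero_ne_top).comp (h1.congr' h2)
    simp only [Function.comp_def, ENNReal.toReal_ofReal (norm_nonneg _), ENNReal.toReal_zero] at h3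
    exact tendsto_iff_norm_sub_tendsto_zero.2 h3
  have hYc : ∀ t₀ ∈ Set.Ioo a b,
      ContinuousAt (fun t => rot (fun n => normSq n + v n) t (x t)) t₀ := fun t₀ ht₀ =>
    continuousAt_rot_comp _ continuousAt_id (hxc t₀ ht₀)
  refine hasDerivAt_of_coeff (fun t ht => ?_) fun t ht n => ?_
  · exact ((continuous_field _ hs).continuousAt.comp
      (continuousAt_id.prodMk (hYc t ht))).continuousWithinAt
  · obtain ⟨c, hc, heq⟩ := hw.equation t ht n
    rw [mFourierCoeff_cubic hs (hx t ht), hx t ht n] at heq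
    have h1 : HasDerivAt (fun τ => coeffOf s (x τ) n) c t := by
      refine hc.congr_of_eventuallyEq ?_
      filter_upwards [isOpen_Ioo.mem_nhds ht] with τ hτ
      exact (hx τ hτ n).symm
    have h2 : HasDerivAt (fun τ : ℝ => Complex.exp ((τ * (normSq n + v n) : ℝ) * Complex.I))
        (Complex.exp ((t * (normSq n + v n) : ℝ) * Complex.I) *
          (((1 * (normSq n + v n) : ℝ) : ℂ) * Complex.I)) t := by
      have h3 : HasDerivAt (fun τ : ℝ => τ * (normSq n + v n)) (1 * (normSq n + v n)) t :=
        (hasDerivAt_id t).mul_const _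
      exact (h3.ofReal_comp.mul_const Complex.I).cexp
    have h4 := h2.mul (h1.const_mul ((jap n ^ s : ℝ) : ℂ))
    have h5 : (fun τ => rot (fun n => normSq n + v n) τ (x τ) n) = fun τ =>
        Complex.exp ((τ * (normSq n + v n) : ℝ) * Complex.I) *
          (((jap n ^ s : ℝ) : ℂ) * coeffOf s (x τ) n) := by
      funext τ
      rw [jap_rpow_mul_coeffOf, rot_apply]
    have h6 : field (fun n => normSq n + v n) s hs t (rot (fun n => normSq n + v n) t (x t)) n =
        -Complex.I * (Complex.exp ((t * (normSq n + v n) : ℝ) * Complex.I) *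
          (((jap n ^ s : ℝ) : ℂ) * coeffOf s (cubic s hs (x t)) n)) := by
      rw [field, hrot, jap_rpow_mul_coeffOf]
      rfl
    have h7 : field (fun n => normSq n + v n) s hs t (rot (fun n => normSq n + v n) t (x t)) n =
        Complex.exp ((t * (normSq n + v n) : ℝ) * Complex.I) *
          (((1 * (normSq n + v n) : ℝ) : ℂ) * Complex.I) *
            (((jap n ^ s : ℝ) : ℂ) * coeffOf s (x t) n) +
          Complex.exp ((t * (normSq n + v n) : ℝ) * Complex.I) * (((jap n ^ s : ℝ) : ℂ) * c) := by
      rw [h6]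
      have hc' : c = -Complex.I * (((normSq n : ℂ) + v n) * coeffOf s (x t) n +
          coeffOf s (cubic s hs (x t)) n) := by
        linear_combination (-Complex.I) * heq + c * Complex.I_mul_I
      rw [hc']
      push_cast
      ring
    rw [h5, h7]
    exact h4

lemma eqOn_of_hasDerivAt_field (ω : (Fin d → ℤ) → ℝ) {s : ℝ} (hs : (d : ℝ) ≤ s) {T : ℝ}
    {y Y : ℝ → Hs d} (hy : ∀ t ∈ Set.Ioo (-T) T, HasDerivAt y (field ω s hs t (y t)) t)
    (hY : ∀ t ∈ Set.Ioo (-T) T, HasDerivAt Y (field ω s hs t (Y t)) t) (h0 : Y 0 = y 0) :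
    Set.EqOn Y y (Set.Ioo (-T) T) := by
  intro t ht
  obtain ⟨t₁, ht₁, ht₁T⟩ := exists_between (abs_lt.2 ht)
  have ht₁0 : 0 < t₁ := (abs_nonneg t).trans_lt ht₁
  have hsub : Set.Icc (-t₁) t₁ ⊆ Set.Ioo (-T) T := fun τ hτ =>
    ⟨by linarith [hτ.1], by linarith [hτ.2]⟩
  have hb : ∀ {z : ℝ → Hs d}, (∀ t ∈ Set.Ioo (-T) T, HasDerivAt z (field ω s hs t (z t)) t) →
      ∃ ρ, ∀ τ ∈ Set.Icc (-t₁) t₁, ‖z τ‖ ≤ ρ := fun hz =>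
    isCompact_Icc.exists_bound_of_continuousOn fun τ hτ =>
      (hz τ (hsub hτ)).continuousAt.continuousWithinAt
  obtain ⟨ρ₁, hρ₁⟩ := hb hy
  obtain ⟨ρ₂, hρ₂⟩ := hb hY
  have hC := convConst_nonneg d s
  refine ODE_solution_unique_of_mem_Ioo (v := field ω s hs)
    (s := fun _ => Metric.closedBall 0 (max ρ₁ ρ₂)) (t₀ := 0)
    (K := Real.toNNReal (3 * convConst d s * max ρ₁ ρ₂ ^ 2))
    (fun τ _ => LipschitzOnWith.of_dist_le_mul fun x hx x' hx' => ?_)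
    ⟨neg_lt_zero.2 ht₁0, ht₁0⟩ (fun τ hτ => ⟨hY τ (hsub (Set.Ioo_subset_Icc_self hτ)), ?_⟩)
    (fun τ hτ => ⟨hy τ (hsub (Set.Ioo_subset_Icc_self hτ)), ?_⟩) h0 (abs_lt.1 ht₁)
  · rw [mem_closedBall_zero_iff] at hx hx'
    rw [dist_eq_norm, dist_eq_norm, Real.coe_toNNReal _ (by positivity)]
    exact norm_field_sub_le ω hs τ hx hx'
  · rw [mem_closedBall_zero_iff]
    exact (hρ₂ τ (Set.Ioo_subset_Icc_self hτ)).trans (le_max_right _ _)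
  · rw [mem_closedBall_zero_iff]
    exact (hρ₁ τ (Set.Ioo_subset_Icc_self hτ)).trans (le_max_left _ _)

/-- A continuity argument. -/
lemma le_of_bootstrap {h : ℝ → ℝ} {a b : ℝ} (hab : a < b) (hc : ContinuousOn h (Set.Icc 0 1))
    (h0 : h 0 ≤ a)
    (step : ∀ θ ∈ Set.Icc (0 : ℝ) 1, (∀ θ' ∈ Set.Icc 0 θ, h θ' ≤ b) → h θ ≤ a) : h 1 ≤ a := by
  refine step 1 ⟨zero_le_one, le_rfl⟩ ?_
  by_contra! hcon
  obtain ⟨θ₀, hθ₀, hbθ₀⟩ := hcon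
  have hK : IsCompact (Set.Icc (0 : ℝ) 1 ∩ h ⁻¹' Set.Ici b) :=
    isCompact_Icc.of_isClosed_subset
      (hc.preimage_isClosed_of_isClosed isClosed_Icc isClosed_Ici) Set.inter_subset_left
  obtain ⟨θ, ⟨hθ, hbθ⟩, hmin⟩ := hK.exists_isLeast ⟨θ₀, hθ₀, hbθ₀.le⟩
  have hsub : Set.Icc 0 θ ⊆ Set.Icc (0 : ℝ) 1 := Set.Icc_subset_Icc_right hθ.2
  have hbθ' : h θ = b := by
    obtain ⟨θ', hθ', hv⟩ := intermediate_value_Icc hθ.1 (hc.mono hsub)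
      (show b ∈ Set.Icc (h 0) (h θ) from ⟨h0.trans hab.le, hbθ⟩)
    have := hmin ⟨hsub hθ', hv.ge⟩
    rwa [le_antisymm hθ'.2 this] at hv
  have := step θ hθ fun θ' hθ' => by
    rcases hθ'.2.lt_or_eq with hlt | heq
    · by_contra hgt
      exact absurd (hmin ⟨hsub hθ', (not_le.1 hgt).le⟩) (not_le.2 hlt)
    · rw [heq, hbθ']
  linarith

end Solutions

section MainEstimate

variable {d : ℕ}

lemma abs_le_div_jap_of_mem_potentialSpace {R : ℝ} (hR : 0 < R) {m : ℕ} (hm : 1 ≤ m)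
    {v : (Fin d → ℤ) → ℝ} (hv : v ∈ potentialSpace d R m) (n : Fin d → ℤ) :
    |v n| ≤ R / jap n := by
  have h1 : 0 < (1 + Real.sqrt (normSq n)) ^ m := by positivity
  have h2 : |R⁻¹ * v n * (1 + Real.sqrt (normSq n)) ^ m| ≤ 1 / 2 := abs_le.2 (hv n)
  rw [abs_mul, abs_mul, abs_of_pos (inv_pos.2 hR), abs_of_pos h1] at h2
  have h3 : jap n ≤ (1 + Real.sqrt (normSq n)) ^ m :=
    (jap_le_one_add_sqrt n).trans (le_self_pow₀ (by linarith [Real.sqrt_nonneg (normSq n)])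
      (by omega))
  rw [le_div_iff₀ (jap_pos n)]
  have h4 : |v n| * (1 + Real.sqrt (normSq n)) ^ m ≤ R := by
    have h5 : R * (R⁻¹ * |v n| * (1 + Real.sqrt (normSq n)) ^ m) ≤ R * (1 / 2) :=
      mul_le_mul_of_nonneg_left h2 hR.le
    have h6 : R * (R⁻¹ * |v n| * (1 + Real.sqrt (normSq n)) ^ m) =
        |v n| * (1 + Real.sqrt (normSq n)) ^ m := by field_simp
    linarith
  exact (mul_le_mul_of_nonneg_left h3 (abs_nonneg _)).trans h4

lemma rpow_neg_mul_pow_le {ε B : ℝ} {r : ℕ} (hε : 0 < ε) (hε1 : ε ≤ 1) (hB : B ≤ r) :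
    ε ^ (-B) * ε ^ (4 * r) ≤ 1 := by
  rw [← Real.rpow_natCast, ← Real.rpow_add hε]
  refine Real.rpow_le_one hε.le hε1 ?_
  push_cast
  have : (0 : ℝ) ≤ r := Nat.cast_nonneg r
  linarith

/-- Solutions in the interaction picture stay small for a long time. -/
theorem exists_small_solution {A : ℕ} {v : (Fin d → ℤ) → ℝ} (hv : IsDiophantine A v) {R : ℝ}
    (hR : 0 ≤ R) (hb : ∀ n, |v n| ≤ R / jap n) (B : ℝ) :
    ∃ s₁ : ℝ, ∀ (s : ℝ) (hs : (d : ℝ) ≤ s), s₁ ≤ s → ∃ ε₀ : ℝ, 0 < ε₀ ∧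
      ∀ ε : ℝ, 0 < ε → ε ≤ ε₀ → ∀ y₀ : Hs d, ‖y₀‖ ≤ ε ^ 2 → ∃ y : ℝ → Hs d, y 0 = y₀ ∧
        ∀ t ∈ Set.Ioo (-(ε ^ (-B))) (ε ^ (-B)),
          HasDerivAt y (field (fun n => normSq n + v n) s hs t (y t)) t ∧
            ‖y t‖ ≤ 3 / 2 * ε ^ 2 := by
  obtain ⟨r, hr⟩ := exists_nat_ge B
  obtain ⟨s₁, h₁⟩ := exists_energy_estimate hv hR hb r
  refine ⟨s₁, fun s hs hs₁ => ?_⟩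
  obtain ⟨a, ha, hest⟩ := h₁ s hs hs₁
  obtain ⟨c, hc⟩ : ∃ c, c = a * (2 ^ 4 + 2 ^ (2 * (r + 3))) := ⟨_, rfl⟩
  have hc0 : 0 ≤ c := by rw [hc]; positivity
  refine ⟨min (1 / 2) (1 / (c + 1)), lt_min (by norm_num) (by positivity),
    fun ε hε hεε₀ y₀ hy₀ => ?_⟩
  have hε2 : ε ≤ 1 / 2 := hεε₀.trans (min_le_left _ _)
  have hεc : ε ≤ 1 / (c + 1) := hεε₀.trans (min_le_right _ _)
  have hε1 : ε ≤ 1 := by linarith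
  have hcε : c * ε ^ 4 ≤ 1 := by
    have h1 : ε ^ 4 ≤ ε := pow_le_of_le_one hε.le hε1 (by norm_num)
    calc c * ε ^ 4 ≤ (c + 1) * (1 / (c + 1)) :=
          mul_le_mul (by linarith) (h1.trans hεc) (by positivity) (by positivity)
      _ = 1 := by field_simp
  have hρ : 0 < 2 * ε ^ 2 := by positivity
  have hρ1 : 2 * ε ^ 2 ≤ 1 := by nlinarith
  have hT : 0 < ε ^ (-B) := Real.rpow_pos_of_pos hε _
  obtain ⟨y, hy0, hy⟩ := exists_cutoff_solution (fun n => normSq n + v n) hs hρ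
    (T := ε ^ (-B) + 1) (by linarith) y₀
  have hder : ∀ t, |t| < ε ^ (-B) →
      HasDerivAt y (field (fun n => normSq n + v n) s hs t (radialRetraction (2 * ε ^ 2) (y t))) t := by
    intro t ht
    rw [abs_lt] at ht
    exact (hy t ⟨by linarith [ht.1], by linarith [ht.2]⟩).hasDerivAt
      (Icc_mem_nhds (by linarith [ht.1]) (by linarith [ht.2]))
  have hstep : ∀ t, |t| < ε ^ (-B) → (∀ τ ∈ Set.uIcc 0 t, ‖y τ‖ ≤ 2 * ε ^ 2) →
      ‖y t‖ ≤ 3 / 2 * ε ^ 2 := by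
    intro t ht hle
    have h1 := hest y t (2 * ε ^ 2) hρ hρ1 fun τ hτ => ⟨hle τ hτ, by
      have h2 : |τ| < ε ^ (-B) := by
        have := Set.abs_sub_left_of_mem_uIcc hτ
        simp only [sub_zero] at this
        exact this.trans_lt ht
      have h3 := hder τ h2
      rwa [radialRetraction_of_norm_le hρ (hle τ hτ)] at h3⟩
    have h4 : ‖y 0‖ ^ 2 ≤ ε ^ 4 := by
      rw [hy0]
      calc ‖y₀‖ ^ 2 ≤ (ε ^ 2) ^ 2 := pow_le_pow_left₀ (norm_nonneg _) hy₀ 2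
        _ = ε ^ 4 := by ring
    have h5 : |t| * (2 * ε ^ 2) ^ (2 * (r + 3)) ≤ 2 ^ (2 * (r + 3)) * ε ^ 8 := by
      have h6 := rpow_neg_mul_pow_le hε hε1 hr
      calc |t| * (2 * ε ^ 2) ^ (2 * (r + 3)) ≤ ε ^ (-B) * (2 * ε ^ 2) ^ (2 * (r + 3)) :=
            mul_le_mul_of_nonneg_right ht.le (by positivity)
        _ = 2 ^ (2 * (r + 3)) * ((ε ^ (-B) * ε ^ (4 * r)) * ε ^ 12) := by
            rw [mul_pow, ← pow_mul, show 2 * (2 * (r + 3)) = 4 * r + 12 by ring, pow_add]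
            ring
        _ ≤ 2 ^ (2 * (r + 3)) * (1 * ε ^ 8) := by
            refine mul_le_mul_of_nonneg_left ?_ (by positivity)
            exact mul_le_mul h6 (pow_le_pow_of_le_one hε.le hε1 (by norm_num)) (by positivity)
              zero_le_one
        _ = _ := by ring
    have h7 : ‖y t‖ ^ 2 ≤ (3 / 2 * ε ^ 2) ^ 2 := by
      have h8 : a * ((2 * ε ^ 2) ^ 4 + |t| * (2 * ε ^ 2) ^ (2 * (r + 3))) ≤ c * ε ^ 8 := by
        have h9 : (2 * ε ^ 2) ^ 4 + |t| * (2 * ε ^ 2) ^ (2 * (r + 3)) ≤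
            (2 ^ 4 + 2 ^ (2 * (r + 3))) * ε ^ 8 := by
          have : (2 * ε ^ 2) ^ 4 = 2 ^ 4 * ε ^ 8 := by ring
          rw [this, add_mul]
          exact add_le_add le_rfl h5
        rw [hc, mul_assoc]
        exact mul_le_mul_of_nonneg_left h9 ha
      have h10 : c * ε ^ 8 ≤ ε ^ 4 := by
        calc c * ε ^ 8 = (c * ε ^ 4) * ε ^ 4 := by ring
          _ ≤ 1 * ε ^ 4 := mul_le_mul_of_nonneg_right hcε (by positivity)
          _ = ε ^ 4 := one_mul _
      have h11 : (0 : ℝ) < ε ^ 4 := by positivity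
      have h12 : (3 / 2 * ε ^ 2) ^ 2 = 9 / 4 * ε ^ 4 := by ring
      rw [h12]
      linarith
    exact (sq_le_sq₀ (norm_nonneg _) (by positivity)).1 h7
  have hsmall : ∀ t, |t| < ε ^ (-B) → ‖y t‖ ≤ 3 / 2 * ε ^ 2 := by
    intro t ht
    have habs : ∀ θ ∈ Set.Icc (0 : ℝ) 1, |θ * t| < ε ^ (-B) := fun θ hθ => by
      rw [abs_mul, abs_of_nonneg hθ.1]
      exact (mul_le_of_le_one_left (abs_nonneg t) hθ.2).trans_lt ht
    have h := le_of_bootstrap (h := fun θ => ‖y (θ * t)‖) (a := 3 / 2 * ε ^ 2) (b := 2 * ε ^ 2)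
      (by nlinarith [sq_nonneg ε, pow_pos hε 2])
      (fun θ hθ => by
        have h1 : ContinuousAt y (θ * t) := (hder _ (habs θ hθ)).continuousAt
        have h2 : ContinuousAt (fun θ : ℝ => θ * t) θ := by fun_prop
        exact (ContinuousAt.comp (f := fun θ : ℝ => θ * t) h1 h2).norm.continuousWithinAt)
      (by
        simp only [zero_mul, hy0]
        nlinarith [sq_nonneg ε])
      (fun θ hθ hle => by
        refine hstep (θ * t) (habs θ hθ) fun τ hτ => ?_
        obtain ⟨θ', hθ', rfl⟩ : ∃ θ' ∈ Set.Icc 0 θ, θ' * t = τ := by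
          rcases eq_or_ne t 0 with rfl | ht0
          · refine ⟨0, ⟨le_rfl, hθ.1⟩, ?_⟩
            simp only [mul_zero, Set.uIcc_self, Set.mem_singleton_iff] at hτ ⊢
            exact hτ.symm
          · have h1 : τ ∈ (fun a => a * t) '' Set.uIcc 0 θ := by
              rw [Set.image_mul_const_uIcc, zero_mul]
              exact hτ
            obtain ⟨θ', hθ', h2⟩ := h1
            rw [Set.uIcc_of_le hθ.1] at hθ'
            exact ⟨θ', hθ', h2⟩
        exact hle θ' hθ')
    simpa using h
  refine ⟨y, hy0, fun t ht => ?_⟩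
  have ht' := abs_lt.2 ht
  have h1 := hsmall t ht'
  refine ⟨?_, h1⟩
  have h2 := hder t ht'
  rwa [radialRetraction_of_norm_le hρ (h1.trans (by nlinarith [sq_nonneg ε]))] at h2

end MainEstimate

end

end NLSTorus

theorem theorem1 (d : ℕ) (hd : 1 ≤ d) (R : ℝ) (hR : 0 < R) (m : ℕ) (hm : 1 ≤ m) :
    ∃ 𝒱 : Set ((Fin d → ℤ) → ℝ),
      𝒱 ⊆ NLSTorus.potentialSpace d R m ∧
      MeasurableSet 𝒱 ∧
      NLSTorus.potentialLaw d R m 𝒱 = 1 ∧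
      ∀ v ∈ 𝒱, ∀ B : ℝ, 0 < B →
        ∃ s₀ : ℝ, (d : ℝ) / 2 < s₀ ∧ ∀ s : ℝ, s₀ ≤ s →
          ∃ ε₀ : ℝ, 0 < ε₀ ∧ ∀ ε : ℝ, 0 < ε → ε ≤ ε₀ →
            ∀ u₀ : C(NLSTorus.Torus d, ℂ),
              NLSTorus.sobolevNorm s u₀ ≤ ENNReal.ofReal (ε ^ 2) →
              ∃ u : ℝ → C(NLSTorus.Torus d, ℂ),
                NLSTorus.IsSolutionOn v s (Set.Ioo (-(ε ^ (-B))) (ε ^ (-B))) u ∧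
                u 0 = u₀ ∧
                (∀ w : ℝ → C(NLSTorus.Torus d, ℂ),
                  NLSTorus.IsSolutionOn v s (Set.Ioo (-(ε ^ (-B))) (ε ^ (-B))) w →
                  w 0 = u₀ → Set.EqOn w u (Set.Ioo (-(ε ^ (-B))) (ε ^ (-B)))) ∧
                (⨆ t ∈ Set.Ioo (-(ε ^ (-B))) (ε ^ (-B)), NLSTorus.sobolevNorm s (u t))
                  < ENNReal.ofReal (2 * ε ^ 2) := by
  obtain ⟨𝒱, hsub, hmeas, hprob, hdio⟩ := NLSTorus.exists_full_measure (d := d) hR m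
  refine ⟨𝒱, hsub, hmeas, hprob, fun v hv B _ => ?_⟩
  obtain ⟨s₁, h₁⟩ := NLSTorus.exists_small_solution (hdio v hv) hR.le
    (NLSTorus.abs_le_div_jap_of_mem_potentialSpace hR hm (hsub hv)) B
  have hd0 : (1 : ℝ) ≤ d := by exact_mod_cast hd
  refine ⟨max s₁ d, lt_of_lt_of_le (by linarith) (le_max_right _ _), fun s hs₀ => ?_⟩
  have hs : (d : ℝ) ≤ s := (le_max_right _ _).trans hs₀
  obtain ⟨ε₀, hε₀, h₂⟩ := h₁ s hs ((le_max_left _ _).trans hs₀)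
  refine ⟨ε₀, hε₀, fun ε hε hεε₀ u₀ hu₀ => ?_⟩
  obtain ⟨x₀, hx₀⟩ := NLSTorus.exists_coeffOf_eq (hu₀.trans_lt ENNReal.ofReal_lt_top)
  rw [NLSTorus.sobolevNorm_eq hx₀, ENNReal.ofReal_le_ofReal_iff (by positivity)] at hu₀
  obtain ⟨y, hy0, hy⟩ := h₂ ε hε hεε₀ x₀ hu₀
  have hT : 0 < ε ^ (-B) := Real.rpow_pos_of_pos hε _
  have h0 : (0 : ℝ) ∈ Set.Ioo (-(ε ^ (-B))) (ε ^ (-B)) := ⟨neg_lt_zero.2 hT, hT⟩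
  refine ⟨_, NLSTorus.isSolutionOn_of_hasDerivAt hs fun t ht => (hy t ht).1, ?_, ?_, ?_⟩
  · refine NLSTorus.eq_of_mFourierCoeff_eq fun n => ?_
    rw [NLSTorus.mFourierCoeff_toTorusFun hs, hx₀, neg_zero, NLSTorus.rot_zero, hy0]
  · intro w hw hw0 t ht
    obtain ⟨Y, hY, hwY⟩ := hw.exists_hasDerivAt hs
    have hY0 : Y 0 = y 0 := by
      ext n
      rw [← NLSTorus.jap_rpow_mul_coeffOf s (Y 0), ← NLSTorus.jap_rpow_mul_coeffOf s (y 0), hy0]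
      have h := hwY 0 h0 n
      rw [neg_zero, NLSTorus.rot_zero, hw0, hx₀] at h
      rw [h]
    have hYy := NLSTorus.eqOn_of_hasDerivAt_field _ hs (fun t ht => (hy t ht).1) hY hY0
    refine NLSTorus.eq_of_mFourierCoeff_eq fun n => ?_
    rw [NLSTorus.mFourierCoeff_toTorusFun hs, hwY t ht, hYy ht]
  · have hle : (⨆ t ∈ Set.Ioo (-(ε ^ (-B))) (ε ^ (-B)), NLSTorus.sobolevNorm s
        (NLSTorus.toTorusFun s (NLSTorus.rot (fun n => NLSTorus.normSq n + v n) (-t) (y t)))) ≤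
        ENNReal.ofReal (3 / 2 * ε ^ 2) := by
      refine iSup₂_le fun t ht => ?_
      rw [NLSTorus.sobolevNorm_eq (NLSTorus.mFourierCoeff_toTorusFun hs _), NLSTorus.norm_rot]
      exact ENNReal.ofReal_le_ofReal (hy t ht).2
    refine hle.trans_lt ((ENNReal.ofReal_lt_ofReal_iff (by positivity)).2 ?_)
    have := pow_pos hε 2
    linarith
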